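/- Let $n\ge 1$ and let $\hat c_1,\dots,\hat c_{2n}$ be the Jordan–Wigner generators on $n$ qubits, $\hat c_{2j-1}=\sigma^z_1\otimes\cdots\otimes\sigma^z_{j-1}\otimes\sigma^x_j\otimes I\otimes\cdots\otimes I$ and $\hat c_{2j}=\sigma^z_1\otimes\cdots\otimes\sigma^z_{j-1}\otimes\sigma^y_j\otimes I\otimes\cdots\otimes I$ for $1\le j\le n$. Let $1\ge b_1\ge b_2\ge\cdots\ge b_{2n}\ge 0$, and let $\Phi$ be the fermionic product channel with attenuation coefficients $b_p$, that is, the linear map on operators on $n$ qubits given on the basis of monomials $\hat c(\mathbf x)=\hat c_1^{x_1}\cdots\hat c_{2n}^{x_{2n}}$, $\mathbf x\in\{0,1\}^{2n}$, by $\Phi(\hat c(\mathbf x))=\bigl(\prod_{p:\,x_p=1}b_p\bigr)\,\hat c(\mathbf x)$. A state (density operator) $\rho$ of $n$ qubits is called Gaussian if $\rho=U\rho_\lambda U^\dagger$ with $\rho_\lambda=2^{-n}\prod_{j=1}^n(I+\lambda_j\sigma^z_j)$ for some real $\lambda_1,\dots,\lambda_n$ and $U=\exp(iH_2+iH_1)$,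 where $H_2$ and $H_1$ are Hermitian linear combinations of the operators $\hat c_p\hat c_q$ and of the operators $\hat c_p$, respectively. Put $$\rho_*=\frac1{2^n}(I+\hat c_1)(I-i\hat c_2\hat c_3)\cdots(I-i\hat c_{2n-2}\hat c_{2n-1}).$$ Then $\rho_*$ is a Gaussian state, and for every Gaussian state $\rho$ the operators $\Phi(\rho)$ and $\Phi(\rho_*)$ are states with $$\Phi(\rho)\prec\Phi(\rho_*),$$ that is, for every $k$ the sum of the $k$ largest eigenvalues (with multiplicity) of $\Phi(\rho)$ is at most that of $\Phi(\rho_*)$, with equality for $k=2^n$. Moreover $S_\alpha(\Phi(\rho))\ge S_\alpha(\Phi(\rho_*))$ for every Gaussian state $\rho$ and every $\alpha\in[0,\infty]$, where $S_\alpha(\rho)=\frac1{1-\alpha}\log_2\operatorname{Tr}\rho^\alpha$ is the Rényi entropy for $\alpha\in(0,1)\cup(1,\infty)$, and $S_0(\rho)=\log_2\operatorname{rank}\rho$, $S_1(\rho)=-\operatorname{Tr}\rho\log_2\rho$, $S_\infty(\rho)=-\log_2\|\rho\|$. -/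

import Mathlib

open Matrix
open scoped ComplexOrder ENNReal

namespace FermionicChannel

noncomputable section

/-- Operators on the Hilbert space of `n` qubits, as matrices in the standard basis, which is
indexed by bit strings. -/
abbrev QubitOp (n : ℕ) : Type := Matrix (Fin n → Fin 2) (Fin n → Fin 2) ℂ

/-- The Pauli matrix `σ^x`. -/
def pauliX : Matrix (Fin 2) (Fin 2) ℂ := !![0, 1; 1, 0]

/-- The Pauli matrix `σ^y`. -/
def pauliY : Matrix (Fin 2) (Fin 2) ℂ := !![0, -Complex.I; Complex.I, 0]

/-- The Pauli matrix `σ^z`. -/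
def pauliZ : Matrix (Fin 2) (Fin 2) ℂ := !![1, 0; 0, -1]

/-- The tensor product `A 0 ⊗ A 1 ⊗ ⋯ ⊗ A (n - 1)` of one-qubit operators. -/
def tensor {n : ℕ} (A : Fin n → Matrix (Fin 2) (Fin 2) ℂ) : QubitOp n :=
  Matrix.of fun x y => ∏ j, A j (x j) (y j)

/-- The tensor factor on qubit `k` of the generator with (zero-based) number `p`, which belongs to
qubit `p / 2`: `σ^z` on the earlier qubits, `σ^x` or `σ^y` on qubit `p / 2`, and the identity on
the later ones. -/
def majoranaFactor (p k : ℕ) : Matrix (Fin 2) (Fin 2) ℂ :=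
  if k < p / 2 then pauliZ
  else if k = p / 2 then (if p % 2 = 0 then pauliX else pauliY)
  else 1

/-- The Jordan–Wigner generators. Numbering starts at zero: `majorana p` is `ĉ_{p+1}`. -/
def majorana {n : ℕ} (p : Fin (2 * n)) : QubitOp n :=
  tensor fun k => majoranaFactor p k

/-- The monomial `ĉ(x) = ĉ_1^{x_1} ĉ_2^{x_2} ⋯ ĉ_{2n}^{x_{2n}}` of a binary string `x`. -/
def monomial {n : ℕ} (x : Fin (2 * n) → Fin 2) : QubitOp n :=
  (List.ofFn fun p => majorana p ^ (x p : ℕ)).prod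

/-- The fermionic product channel with attenuation coefficients `b`: the linear map that multiplies
the component of an operator along each monomial `ĉ(x)` by the product of the `b_p` with `x_p = 1`.
The monomials are orthogonal for the trace inner product, with `Tr (ĉ(x)† ĉ(x)) = 2 ^ n`. -/
def channel {n : ℕ} (b : Fin (2 * n) → ℝ) : QubitOp n →ₗ[ℂ] QubitOp n where
  toFun A := ∑ x : Fin (2 * n) → Fin 2,
    ((((∏ p, b p ^ (x p : ℕ)) : ℝ) : ℂ) * (((monomial x)ᴴ * A).trace / 2 ^ n)) • monomial x
  map_add' A B := by
    simp only [Matrix.trace_add, add_div, mul_add, add_smul,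
      Finset.sum_add_distrib]
  map_smul' c A := by
    simp only [Matrix.mul_smul, Matrix.trace_smul, smul_eq_mul, RingHom.id_apply,
      Finset.smul_sum, smul_smul]
    refine Finset.sum_congr rfl fun x _ => ?_
    congr 1
    ring

/-! ### The channel is the one determined by its action on the monomials -/

theorem tensor_mul {n : ℕ} (A B : Fin n → Matrix (Fin 2) (Fin 2) ℂ) :
    tensor A * tensor B = tensor fun k => A k * B k := by
  ext x y
  simp only [tensor, Matrix.mul_apply, Matrix.of_apply, ← Finset.prod_mul_distrib]
  rw [Finset.prod_univ_sum, Fintype.piFinset_univ]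

theorem tensor_one {n : ℕ} : tensor (fun _ : Fin n => 1) = 1 := by
  ext x y
  simp only [tensor, Matrix.of_apply, Matrix.one_apply]
  rw [Finset.prod_ite_zero]
  simp [funext_iff]

theorem tensor_smul {n : ℕ} (e : Fin n → ℂ) (A : Fin n → Matrix (Fin 2) (Fin 2) ℂ) :
    tensor (fun k => e k • A k) = (∏ k, e k) • tensor A := by
  ext x y
  simp [tensor, Finset.prod_mul_distrib]

theorem tensor_conjTranspose {n : ℕ} (A : Fin n → Matrix (Fin 2) (Fin 2) ℂ) :
    (tensor A)ᴴ = tensor fun k => (A k)ᴴ := by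
  ext x y
  simp [tensor, Matrix.conjTranspose_apply]

theorem majoranaFactor_mul_self (p k : ℕ) : majoranaFactor p k * majoranaFactor p k = 1 := by
  unfold majoranaFactor
  split_ifs <;> ext i j <;> fin_cases i <;> fin_cases j <;>
    simp [pauliX, pauliY, pauliZ, Matrix.mul_apply]

theorem majoranaFactor_conjTranspose (p k : ℕ) : (majoranaFactor p k)ᴴ = majoranaFactor p k := by
  unfold majoranaFactor
  split_ifs <;> ext i j <;> fin_cases i <;> fin_cases j <;>
    simp [pauliX, pauliY, pauliZ, Matrix.conjTranspose_apply]

theorem majoranaFactor_anticomm {p q : ℕ} (h : p < q) (k : ℕ) :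
    majoranaFactor p k * majoranaFactor q k =
      (if k = p / 2 then (-1 : ℂ) else 1) • (majoranaFactor q k * majoranaFactor p k) := by
  have h2 : p / 2 ≤ q / 2 := by omega
  unfold majoranaFactor
  split_ifs <;> first
    | omega
    | (ext i j; fin_cases i <;> fin_cases j <;>
        simp [pauliX, pauliY, pauliZ, Matrix.mul_apply])

theorem majorana_mul_self {n : ℕ} (p : Fin (2 * n)) :
    (majorana p : QubitOp n) * majorana p = 1 := by
  simp only [majorana, tensor_mul, majoranaFactor_mul_self, tensor_one]

theorem majorana_conjTranspose {n : ℕ} (p : Fin (2 * n)) :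
    (majorana p : QubitOp n)ᴴ = majorana p := by
  simp only [majorana, tensor_conjTranspose, majoranaFactor_conjTranspose]

theorem majorana_anticomm_of_lt {n : ℕ} {p q : Fin (2 * n)} (h : p < q) :
    (majorana p : QubitOp n) * majorana q = (-1 : ℂ) • (majorana q * majorana p) := by
  simp only [majorana, tensor_mul, majoranaFactor_anticomm (Fin.lt_def.mp h), tensor_smul]
  congr 1
  have hp : (p : ℕ) / 2 < n := by omega
  rw [Finset.prod_eq_single (⟨(p : ℕ) / 2, hp⟩ : Fin n)]
  · simp
  · intro k _ hk
    rw [if_neg]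
    intro h'
    exact hk (Fin.ext h')
  · simp

theorem majorana_anticomm {n : ℕ} {p q : Fin (2 * n)} (h : p ≠ q) :
    (majorana p : QubitOp n) * majorana q = (-1 : ℂ) • (majorana q * majorana p) := by
  rcases lt_or_gt_of_ne h with h | h
  · exact majorana_anticomm_of_lt h
  · rw [majorana_anticomm_of_lt h, smul_smul]
    norm_num

/-- The sign in the commutation relation between `ĉ_p` and `ĉ(x)`. -/
def monomialSign {n : ℕ} (p : Fin (2 * n)) (x : Fin (2 * n) → Fin 2) : ℝ :=
  (-1) ^ (x p : ℕ) * ∏ q, (-1) ^ (x q : ℕ)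

theorem mul_list_prod_comm {n : ℕ} (a : QubitOp n) {ι : Type} (l : List ι) (f : ι → QubitOp n)
    (e : ι → ℂ) (h : ∀ i, a * f i = e i • (f i * a)) :
    a * (l.map f).prod = (l.map e).prod • ((l.map f).prod * a) := by
  induction l with
  | nil => simp
  | cons i l ih =>
    simp only [List.map_cons, List.prod_cons]
    rw [← mul_assoc, h, Matrix.smul_mul, mul_assoc, ih, Matrix.mul_smul, smul_smul, mul_assoc]

theorem majorana_mul_monomial {n : ℕ} (p : Fin (2 * n)) (x : Fin (2 * n) → Fin 2) :
    majorana p * monomial x = (monomialSign p x : ℂ) • (monomial x * majorana p) := by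
  have key := mul_list_prod_comm (majorana p) (List.finRange (2 * n))
    (fun q => majorana q ^ (x q : ℕ))
    (fun q => (if q = p then (-1) ^ (x p : ℕ) else 1) * (-1) ^ (x q : ℕ)) (by
      intro q
      have hx : x q = 0 ∨ x q = 1 := by
        generalize x q = u
        fin_cases u <;> simp
      by_cases hq : q = p
      · subst hq
        rcases hx with hx | hx <;> simp [hx]
      · rcases hx with hx | hx
        · simp [hx, hq]
        · simpa [hx, hq] using majorana_anticomm (Ne.symm hq))
  rw [monomial, List.ofFn_eq_map, key]
  congr 1
  rw [← List.ofFn_eq_map, List.prod_ofFn, Finset.prod_mul_distrib, monomialSign]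
  simp

theorem monomialSign_mul_self {n : ℕ} (p : Fin (2 * n)) (x : Fin (2 * n) → Fin 2) :
    monomialSign p x * monomialSign p x = 1 := by
  have h : ∀ m : ℕ, ((-1 : ℝ) ^ m) * (-1) ^ m = 1 := fun m => by
    rw [← mul_pow]; norm_num
  rw [monomialSign, Finset.prod_pow_eq_pow_sum, ← pow_add, h]

theorem exists_monomialSign_ne {n : ℕ} {x y : Fin (2 * n) → Fin 2} (hxy : x ≠ y) :
    ∃ p, monomialSign p x * monomialSign p y = -1 := by
  by_contra! hne
  have hsq : ∀ (m : ℕ), ((-1 : ℝ) ^ m = 1 ∨ (-1 : ℝ) ^ m = -1) := fun m => neg_one_pow_eq_or ℝ m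
  set P : ℝ := (∏ q, (-1) ^ (x q : ℕ)) * ∏ q, (-1) ^ (y q : ℕ) with hP
  have hPP : P = 1 ∨ P = -1 := by
    rw [hP, Finset.prod_pow_eq_pow_sum, Finset.prod_pow_eq_pow_sum, ← pow_add]
    exact hsq _
  have hs : ∀ p, (-1 : ℝ) ^ (x p : ℕ) * (-1) ^ (y p : ℕ) = P := by
    intro p
    have h1 := hne p
    have h2 : monomialSign p x * monomialSign p y =
        ((-1 : ℝ) ^ (x p : ℕ) * (-1) ^ (y p : ℕ)) * P := by
      rw [monomialSign, monomialSign, hP]; ring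
    rw [h2, ← pow_add] at h1
    rw [← pow_add]
    rcases hPP with h | h <;> rcases hsq ((x p : ℕ) + y p) with h' | h' <;>
      rw [h, h'] at h1 <;> rw [h, h'] <;> norm_num at h1
  have hP1 : P = 1 := by
    have : P = ∏ _p : Fin (2 * n), P := by
      conv_lhs => rw [hP, ← Finset.prod_mul_distrib]
      exact Finset.prod_congr rfl fun p _ => hs p
    rw [this, Finset.prod_const, Finset.card_univ, Fintype.card_fin, pow_mul]
    rcases hPP with h | h <;> simp [h]
  apply hxy
  funext p
  have := hs p
  rw [hP1] at this
  generalize x p = u at this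
  generalize y p = v at this
  fin_cases u <;> fin_cases v <;> first | rfl | (norm_num at this)

theorem monomial_conjTranspose_mul_self {n : ℕ} (x : Fin (2 * n) → Fin 2) :
    (monomial x)ᴴ * monomial x = 1 := by
  have h : monomial x ∈ unitary (QubitOp n) := by
    refine Submonoid.list_prod_mem _ fun A hA => ?_
    obtain ⟨p, rfl⟩ := (List.mem_ofFn' _ _).mp hA
    refine pow_mem ?_ _
    rw [Unitary.mem_iff, Matrix.star_eq_conjTranspose, majorana_conjTranspose,
      majorana_mul_self]
    exact ⟨rfl, rfl⟩
  exact (Unitary.mem_iff.mp h).1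

theorem trace_monomial {n : ℕ} (x y : Fin (2 * n) → Fin 2) :
    ((monomial x)ᴴ * monomial y).trace = if x = y then 2 ^ n else 0 := by
  split_ifs with h
  · subst h
    rw [monomial_conjTranspose_mul_self, Matrix.trace_one]
    simp
  · obtain ⟨p, hp⟩ := exists_monomialSign_ne h
    set a : QubitOp n := majorana p with ha
    have haa : a * a = 1 := majorana_mul_self p
    have hx : a * (monomial x)ᴴ = (monomialSign p x : ℂ) • ((monomial x)ᴴ * a) := by
      have h1 := congrArg conjTranspose (majorana_mul_monomial p x)
      rw [conjTranspose_mul, conjTranspose_smul, conjTranspose_mul, majorana_conjTranspose,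
        ← ha] at h1
      rw [h1, smul_smul]
      have : (monomialSign p x : ℂ) * star (monomialSign p x : ℂ) = 1 := by
        rw [Complex.star_def, Complex.conj_ofReal]
        exact_mod_cast monomialSign_mul_self p x
      rw [this, one_smul]
    have hy : a * monomial y = (monomialSign p y : ℂ) • (monomial y * a) :=
      majorana_mul_monomial p y
    have h2 : a * ((monomial x)ᴴ * monomial y) * a = (-1 : ℂ) • ((monomial x)ᴴ * monomial y) := by
      rw [← mul_assoc, hx, Matrix.smul_mul, Matrix.mul_assoc _ a, hy, Matrix.mul_smul, smul_smul,
        Matrix.smul_mul, Matrix.mul_assoc, Matrix.mul_assoc, haa, Matrix.mul_one]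
      congr 1
      exact_mod_cast hp
    have h3 := congrArg Matrix.trace h2
    rw [Matrix.trace_mul_comm, ← mul_assoc, haa, one_mul, Matrix.trace_smul, smul_eq_mul] at h3
    linear_combination h3 / 2

/-- The defining rule `Φ(ĉ(x)) = (∏_{p : x_p = 1} b_p) ĉ(x)`. -/
theorem channel_monomial {n : ℕ} (b : Fin (2 * n) → ℝ) (x : Fin (2 * n) → Fin 2) :
    channel b (monomial x) = (((∏ p, b p ^ (x p : ℕ)) : ℝ) : ℂ) • monomial x := by
  change (∑ y : Fin (2 * n) → Fin 2, ((((∏ p, b p ^ (y p : ℕ)) : ℝ) : ℂ) *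
    (((monomial y)ᴴ * monomial x).trace / 2 ^ n)) • (monomial y : QubitOp n)) = _
  rw [Finset.sum_eq_single x]
  · rw [trace_monomial, if_pos rfl, div_self (by positivity), mul_one]
  · intro y _ hy
    rw [trace_monomial, if_neg hy]
    simp
  · simp

/-- The monomials span all operators. -/
theorem span_monomial (n : ℕ) :
    Submodule.span ℂ (Set.range (monomial : (Fin (2 * n) → Fin 2) → QubitOp n)) = ⊤ := by
  have hli : LinearIndependent ℂ (monomial : (Fin (2 * n) → Fin 2) → QubitOp n) := by
    rw [Fintype.linearIndependent_iff]
    intro g hg x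
    have h1 := congrArg (fun A : QubitOp n => ((monomial x)ᴴ * A).trace) hg
    simp only [Matrix.mul_sum, Matrix.mul_smul, Matrix.trace_sum, Matrix.trace_smul,
      trace_monomial, Matrix.mul_zero, Matrix.trace_zero] at h1
    simpa using h1
  refine hli.span_eq_top_of_card_eq_finrank' ?_
  simp [Module.finrank_matrix, pow_mul, ← mul_pow]

/-- The channel is the only linear map with the defining rule. -/
theorem channel_unique {n : ℕ} (b : Fin (2 * n) → ℝ) (Ψ : QubitOp n →ₗ[ℂ] QubitOp n)
    (h : ∀ x, Ψ (monomial x) = (((∏ p, b p ^ (x p : ℕ)) : ℝ) : ℂ) • monomial x) :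
    Ψ = channel b := by
  refine LinearMap.ext_on_range (span_monomial n) fun x => ?_
  rw [h, channel_monomial]

/-! ### Gaussian states -/

/-- A state (density operator). -/
structure IsState {n : ℕ} (ρ : QubitOp n) : Prop where
  posSemidef : ρ.PosSemidef
  trace_eq_one : ρ.trace = 1

/-- The standard Gaussian operator `ρ_λ = 2^{-n} ∏_j (I + λ_j σ^z_j)`. -/
def standardGaussian {n : ℕ} (l : Fin n → ℝ) : QubitOp n :=
  (1 / 2 ^ n : ℂ) • tensor fun j => 1 + (l j : ℂ) • pauliZ

/-- A state `ρ` is Gaussian if `ρ = U ρ_λ U†` with `U = exp (i H₂ + i H₁)`, where `H₂` and `H₁` are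
Hermitian linear combinations of the operators `ĉ_p ĉ_q` and `ĉ_p` respectively. -/
def IsGaussian {n : ℕ} (ρ : QubitOp n) : Prop :=
  IsState ρ ∧ ∃ (l : Fin n → ℝ) (H₂ H₁ : QubitOp n),
    H₂.IsHermitian ∧
    H₂ ∈ Submodule.span ℂ
      (Set.range fun pq : Fin (2 * n) × Fin (2 * n) => majorana pq.1 * majorana pq.2) ∧
    H₁.IsHermitian ∧
    H₁ ∈ Submodule.span ℂ (Set.range fun p : Fin (2 * n) => majorana p) ∧
    ρ = NormedSpace.exp (Complex.I • H₂ + Complex.I • H₁) * standardGaussian l *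
      (NormedSpace.exp (Complex.I • H₂ + Complex.I • H₁))ᴴ

/-- The operator `ρ_* = 2^{-n} (I + ĉ_1)(I - i ĉ_2 ĉ_3) ⋯ (I - i ĉ_{2n-2} ĉ_{2n-1})`. -/
def rhoStar (n : ℕ) (hn : 1 ≤ n) : QubitOp n :=
  (1 / 2 ^ n : ℂ) • ((1 + majorana (⟨0, by omega⟩ : Fin (2 * n))) *
    (List.ofFn fun j : Fin (n - 1) =>
      1 - Complex.I • (majorana (⟨2 * j + 1, by omega⟩ : Fin (2 * n)) *
        majorana (⟨2 * j + 2, by omega⟩ : Fin (2 * n)))).prod)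

/-! ### Majorization and entropies -/

/-- The spectrum of a state: its eigenvalues, with multiplicity, in non-increasing order. -/
def IsState.spec {n : ℕ} {ρ : QubitOp n} (h : IsState ρ) :
    Fin (Fintype.card (Fin n → Fin 2)) → ℝ :=
  h.posSemidef.isHermitian.eigenvalues₀

theorem IsState.spec_antitone {n : ℕ} {ρ : QubitOp n} (h : IsState ρ) : Antitone h.spec :=
  h.posSemidef.isHermitian.eigenvalues₀_antitone

/-- The majorization relation `ρ ≺ η` between states: for each `k`, the sum of the `k` largest
eigenvalues of `ρ` is at most that of `η`, and the sums of all eigenvalues are equal. -/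
def IsState.Majorized {n : ℕ} {ρ η : QubitOp n} (hρ : IsState ρ) (hη : IsState η) : Prop :=
  (∀ k : ℕ, ∑ j with Fin.val j < k, hρ.spec j ≤ ∑ j with Fin.val j < k, hη.spec j) ∧
    ∑ j, hρ.spec j = ∑ j, hη.spec j

/-- The Rényi entropy `S_α(ρ) = (1 - α)⁻¹ log₂ Tr ρ^α` of order `α ∈ [0, ∞]`, where the orders
`0`, `1` and `∞` are given by the logarithm of the rank, the von Neumann entropy and minus
the logarithm of the largest eigenvalue. -/
def IsState.renyiEntropy {n : ℕ} {ρ : QubitOp n} (h : IsState ρ) (α : ℝ≥0∞) : ℝ :=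
  if α = 0 then Real.logb 2 ρ.rank
  else if α = 1 then -∑ j, h.spec j * Real.logb 2 (h.spec j)
  else if α = ⊤ then -Real.logb 2 (⨆ j, h.spec j)
  else 1 / (1 - α.toReal) * Real.logb 2 (∑ j, h.spec j ^ α.toReal)

end

end FermionicChannel

open FermionicChannel

namespace FermionicChannel

noncomputable section

/-! The parity operator `P` anticommutes with every Majorana generator. Put `γ_0 = P` and `γ_p = i
ĉ_p P`: these are `2n + 1` anticommuting Hermitian involutions with `ĉ_p ĉ_q = γ_p γ_q` and `ĉ_p = i
γ_0 γ_p`. The linear and quadratic terms in the exponent of a Gaussian unitary are thus all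
quadratic in the `γ`'s, so conjugation by the unitary is an orthogonal transformation of their real
span. Hence a Gaussian state is `2^{-n} ∏ (1 + λ_j Z_j)` with `Z_j = -i γ(f_j) γ(g_j)` for
orthonormal vectors `f_j`, `g_j` of `ℝ^{2n+1}` (`IsGaussian.exists_productState`).

Even operators in the `γ`'s are symbols of even elements of the exterior algebra, and there the
channel is the functorial action of the diagonal map `D = diag(1, b_1, …, b_{2n})`
(`channel_symbolMap`). The symbol of a product state is the exponential of a bivector; `D` sends it
to the exponential of another real bivector, and the canonical form of skew maps makes that one a
product state again, with parameters `μ_1 ≥ ⋯ ≥ μ_n ≥ 0` (`exists_channel_productState_eq`). For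
`ρ_*` the parameters are `ν_1 = 1·b_1`, `ν_2 = b_2 b_3`, and so on: consecutive diagonal entries of
`D` paired off in decreasing order.

The heart is the inequality `μ_1 ⋯ μ_k ≤ ν_1 ⋯ ν_k` (`prod_le_prod_starCoeff`). The left side is
`Tr(Φ(ρ) A) = Tr(ρ Φ(A))`, where `A` is the product of the first `k` involutions of `Φ(ρ)`. Since
`A` is the symbol of a decomposable `2k`-vector, so is `Φ(A)` up to a phase, which makes it a
multiple of a unitary; its size is therefore its normalized Hilbert–Schmidt norm, at most the
product of the `2k` largest diagonal entries of `D`.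

The eigenvalues of a product state are the products of the numbers `(1 ± μ_j) / 2`. Weak
log-majorization of the parameters is realized by transfers that keep the product of two parameters,
and by increases of one parameter; both raise every convex trace function
(`SpectrumMajorized.of_prod_take_le`). Suitable convex functions then yield majorization and all the
entropy inequalities. -/

/-! ### Clifford generators with a parity generator adjoined -/

/-- The parity operator `σ^z ⊗ ⋯ ⊗ σ^z`. -/
def parity (n : ℕ) : QubitOp n := tensor fun _ => pauliZ

theorem pauliZ_mul_self : pauliZ * pauliZ = 1 := by
  ext i j; fin_cases i <;> fin_cases j <;> simp [pauliZ]

theorem pauliZ_conjTranspose : pauliZᴴ = pauliZ := by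
  ext i j; fin_cases i <;> fin_cases j <;> simp [pauliZ, Matrix.conjTranspose_apply]

theorem parity_mul_self (n : ℕ) : parity n * parity n = 1 := by
  simp only [parity, tensor_mul, pauliZ_mul_self, tensor_one]

theorem parity_conjTranspose (n : ℕ) : (parity n)ᴴ = parity n := by
  simp only [parity, tensor_conjTranspose, pauliZ_conjTranspose]

theorem majoranaFactor_mul_pauliZ (p k : ℕ) :
    majoranaFactor p k * pauliZ =
      (if k = p / 2 then (-1 : ℂ) else 1) • (pauliZ * majoranaFactor p k) := by
  unfold majoranaFactor
  split_ifs <;> first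
    | omega
    | (ext i j; fin_cases i <;> fin_cases j <;>
        simp [pauliX, pauliY, pauliZ])

theorem majorana_mul_parity {n : ℕ} (p : Fin (2 * n)) :
    majorana p * parity n = -(parity n * majorana p) := by
  simp only [majorana, parity, tensor_mul, majoranaFactor_mul_pauliZ, tensor_smul]
  have hp : (p : ℕ) / 2 < n := by omega
  rw [Finset.prod_eq_single (⟨(p : ℕ) / 2, hp⟩ : Fin n)]
  · simp
  · intro k _ hk
    rw [if_neg]
    intro h'
    exact hk (Fin.ext h')
  · simp

theorem majorana_mul_majorana_of_ne {n : ℕ} {p q : Fin (2 * n)} (h : p ≠ q) :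
    (majorana p : QubitOp n) * majorana q = -(majorana q * majorana p) := by
  rw [majorana_anticomm h, neg_one_smul]

/-- `2n + 1` mutually anticommuting Hermitian involutions whose even products include all the
Jordan–Wigner generators and their products in pairs. -/
def cliffordGen {n : ℕ} (a : Fin (2 * n + 1)) : QubitOp n :=
  Fin.cases (motive := fun _ => QubitOp n) (parity n)
    (fun p => Complex.I • (majorana p * parity n)) a

theorem cliffordGen_zero {n : ℕ} : (cliffordGen 0 : QubitOp n) = parity n := rfl

theorem cliffordGen_succ {n : ℕ} (p : Fin (2 * n)) :
    cliffordGen p.succ = Complex.I • (majorana p * parity n) := rfl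

theorem majorana_mul_parity_mul {n : ℕ} (p q : Fin (2 * n)) :
    (majorana p * parity n) * (majorana q * parity n) = -(majorana p * majorana q) := by
  rw [mul_assoc, ← mul_assoc (parity n), ← neg_eq_iff_eq_neg.mpr (majorana_mul_parity q),
    neg_mul, mul_neg, mul_assoc (majorana q), parity_mul_self, mul_one]

theorem cliffordGen_succ_mul_succ {n : ℕ} (p q : Fin (2 * n)) :
    (cliffordGen p.succ : QubitOp n) * cliffordGen q.succ = majorana p * majorana q := by
  rw [cliffordGen_succ, cliffordGen_succ, smul_mul_smul_comm, majorana_mul_parity_mul,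
    Complex.I_mul_I, neg_one_smul, neg_neg]

theorem cliffordGen_zero_mul_succ {n : ℕ} (p : Fin (2 * n)) :
    (cliffordGen 0 : QubitOp n) * cliffordGen p.succ = (-Complex.I) • majorana p := by
  rw [cliffordGen_succ, cliffordGen_zero, mul_smul_comm, ← mul_assoc,
    ← neg_eq_iff_eq_neg.mpr (majorana_mul_parity p), neg_mul, mul_assoc, parity_mul_self, mul_one,
    smul_neg, neg_smul]

theorem cliffordGen_mul_self {n : ℕ} (a : Fin (2 * n + 1)) :
    (cliffordGen a : QubitOp n) * cliffordGen a = 1 := by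
  refine Fin.cases ?_ (fun p => ?_) a
  · exact parity_mul_self n
  · rw [cliffordGen_succ_mul_succ, majorana_mul_self]

theorem cliffordGen_conjTranspose {n : ℕ} (a : Fin (2 * n + 1)) :
    (cliffordGen a : QubitOp n)ᴴ = cliffordGen a := by
  refine Fin.cases ?_ (fun p => ?_) a
  · exact parity_conjTranspose n
  · rw [cliffordGen_succ, conjTranspose_smul, conjTranspose_mul, majorana_conjTranspose,
      parity_conjTranspose, majorana_mul_parity]
    simp

theorem cliffordGen_anticomm {n : ℕ} {a b : Fin (2 * n + 1)} (h : a ≠ b) :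
    (cliffordGen a : QubitOp n) * cliffordGen b = -(cliffordGen b * cliffordGen a) := by
  have h0 : ∀ p : Fin (2 * n), (cliffordGen 0 : QubitOp n) * cliffordGen p.succ
      = -(cliffordGen p.succ * cliffordGen 0) := fun p => by
    rw [cliffordGen_zero_mul_succ, cliffordGen_succ, cliffordGen_zero, smul_mul_assoc, mul_assoc,
      parity_mul_self, mul_one, neg_smul]
  revert h
  refine Fin.cases ?_ (fun p => ?_) a
  · refine Fin.cases (fun h => absurd rfl h) (fun q _ => h0 q) b
  · refine Fin.cases (fun _ => by rw [h0, neg_neg]) (fun q h => ?_) b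
    rw [cliffordGen_succ_mul_succ, cliffordGen_succ_mul_succ,
      majorana_mul_majorana_of_ne fun h' => h (congrArg _ h')]

/-- This turns the linear part `H₁` of the exponent of a Gaussian unitary into a quadratic
expression in the extended generators. -/
theorem majorana_eq_cliffordGen {n : ℕ} (p : Fin (2 * n)) :
    majorana p = Complex.I • ((cliffordGen 0 : QubitOp n) * cliffordGen p.succ) := by
  rw [cliffordGen_zero_mul_succ, smul_smul]
  simp

/-- Complex coefficient vectors over the extended family of generators. -/
abbrev CoeffVec (n : ℕ) : Type := Fin (2 * n + 1) → ℂ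

/-- The linear combination of the generators with given coefficients. -/
def cliffordLin (n : ℕ) : CoeffVec n →ₗ[ℂ] QubitOp n := Fintype.linearCombination ℂ cliffordGen

theorem cliffordLin_apply {n : ℕ} (v : CoeffVec n) :
    cliffordLin n v = ∑ a, v a • cliffordGen a := rfl

theorem cliffordLin_single {n : ℕ} (a : Fin (2 * n + 1)) :
    cliffordLin n (Pi.single a 1) = cliffordGen a := by
  rw [cliffordLin_apply, Finset.sum_eq_single a] <;> simp +contextual

theorem cliffordLin_mul_add_mul {n : ℕ} (u v : CoeffVec n) :
    cliffordLin n u * cliffordLin n v + cliffordLin n v * cliffordLin n u =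
      (2 * u ⬝ᵥ v) • (1 : QubitOp n) := by
  have hab : ∀ a b : Fin (2 * n + 1), (cliffordGen a : QubitOp n) * cliffordGen b +
      cliffordGen b * cliffordGen a = if a = b then (2 : ℂ) • 1 else 0 := by
    intro a b
    split_ifs with h
    · subst h
      rw [cliffordGen_mul_self, two_smul]
    · rw [cliffordGen_anticomm h, neg_add_cancel]
  have h1 : cliffordLin n u * cliffordLin n v =
      ∑ a, ∑ b, (u a * v b) • ((cliffordGen a : QubitOp n) * cliffordGen b) := by
    simp only [cliffordLin_apply, Finset.sum_mul_sum, smul_mul_smul_comm]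
  have h2 : cliffordLin n v * cliffordLin n u =
      ∑ a, ∑ b, (u a * v b) • ((cliffordGen b : QubitOp n) * cliffordGen a) := by
    simp only [cliffordLin_apply, Finset.sum_mul_sum, smul_mul_smul_comm]
    rw [Finset.sum_comm]
    simp only [mul_comm]
  rw [h1, h2, ← Finset.sum_add_distrib]
  simp only [← Finset.sum_add_distrib, ← smul_add, hab]
  simp only [smul_ite, smul_zero, Finset.sum_ite_eq, Finset.mem_univ, if_true, smul_smul,
    dotProduct, Finset.mul_sum, Finset.sum_smul]
  exact Finset.sum_congr rfl fun a _ => by rw [mul_comm]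

theorem cliffordLin_mul_self {n : ℕ} (u : CoeffVec n) :
    cliffordLin n u * cliffordLin n u = (u ⬝ᵥ u) • (1 : QubitOp n) := by
  have h := cliffordLin_mul_add_mul u u
  rw [← two_smul ℂ, mul_smul] at h
  exact smul_right_injective _ (two_ne_zero : (2 : ℂ) ≠ 0) h

theorem cliffordLin_anticomm {n : ℕ} {u v : CoeffVec n} (h : u ⬝ᵥ v = 0) :
    cliffordLin n u * cliffordLin n v = -(cliffordLin n v * cliffordLin n u) := by
  rw [eq_neg_iff_add_eq_zero, cliffordLin_mul_add_mul, h, mul_zero, zero_smul]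

theorem cliffordLin_conjTranspose {n : ℕ} (u : CoeffVec n) :
    (cliffordLin n u)ᴴ = cliffordLin n (star u) := by
  simp only [cliffordLin_apply, conjTranspose_sum, conjTranspose_smul, cliffordGen_conjTranspose,
    Pi.star_apply]

/-! ### The symbol map from the exterior algebra to operators -/

/-- The bilinear dot product on coefficient vectors. -/
def dotForm (n : ℕ) : LinearMap.BilinForm ℂ (CoeffVec n) := Matrix.toBilin' 1

theorem dotForm_apply {n : ℕ} (u v : CoeffVec n) : dotForm n u v = u ⬝ᵥ v := by
  rw [dotForm, Matrix.toBilin'_apply', Matrix.one_mulVec]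

/-- This is the form in which `CliffordAlgebra.changeForm` asks for the bilinear form relating two
quadratic forms; here it leads from the zero form, whose Clifford algebra is the exterior algebra,
to the dot product. -/
theorem dotForm_toQuadraticMap_eq (n : ℕ) :
    (dotForm n).toQuadraticMap = (dotForm n).toQuadraticMap - 0 := (sub_zero _).symm

/-- The operator represented by an element of the Clifford algebra of the dot product. -/
def cliffordRep (n : ℕ) : CliffordAlgebra (dotForm n).toQuadraticMap →ₐ[ℂ] QubitOp n :=
  CliffordAlgebra.lift _ ⟨cliffordLin n, fun v => by
    rw [cliffordLin_mul_self, Algebra.algebraMap_eq_smul_one, LinearMap.BilinMap.toQuadraticMap_apply,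
      dotForm_apply]⟩

/-- The linear symbol map: it sends a wedge product of orthogonal vectors to the product of the
corresponding combinations of generators. -/
def symbolMap (n : ℕ) : ExteriorAlgebra ℂ (CoeffVec n) →ₗ[ℂ] QubitOp n :=
  (cliffordRep n).toLinearMap ∘ₗ
    CliffordAlgebra.changeForm (dotForm_toQuadraticMap_eq n)

theorem symbolMap_one (n : ℕ) : symbolMap n 1 = 1 := by
  simp [symbolMap]

/-- Left contraction with a vector by the dot product. -/
def contraction {n : ℕ} (v : CoeffVec n) :
    ExteriorAlgebra ℂ (CoeffVec n) →ₗ[ℂ] ExteriorAlgebra ℂ (CoeffVec n) :=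
  CliffordAlgebra.contractLeft (Q := (0 : QuadraticForm ℂ (CoeffVec n))) (dotForm n v)

theorem contraction_one {n : ℕ} (v : CoeffVec n) : contraction v 1 = 0 :=
  CliffordAlgebra.contractLeft_one _ (dotForm n v)

theorem contraction_ι_mul {n : ℕ} (v x : CoeffVec n) (z : ExteriorAlgebra ℂ (CoeffVec n)) :
    contraction v (ExteriorAlgebra.ι ℂ x * z) =
      (v ⬝ᵥ x) • z - ExteriorAlgebra.ι ℂ x * contraction v z := by
  rw [← dotForm_apply]
  exact CliffordAlgebra.contractLeft_ι_mul _ _ _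

/-- Wedge and Clifford multiplication by a vector differ by the contraction with that vector, so
they agree where the contraction vanishes. -/
theorem symbolMap_ι_mul {n : ℕ} (v : CoeffVec n) {z : ExteriorAlgebra ℂ (CoeffVec n)}
    (h : contraction v z = 0) :
    symbolMap n (ExteriorAlgebra.ι ℂ v * z) = cliffordLin n v * symbolMap n z := by
  have h1 := CliffordAlgebra.changeForm_ι_mul (dotForm_toQuadraticMap_eq n) v z
  rw [← CliffordAlgebra.changeForm_contractLeft] at h1
  have h2 : CliffordAlgebra.contractLeft (Q := (0 : QuadraticForm ℂ (CoeffVec n)))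
    (dotForm n v) z = 0 := h
  rw [h2, map_zero, sub_zero] at h1
  have h3 := congrArg (cliffordRep n) h1
  rw [map_mul (cliffordRep n)] at h3
  refine h3.trans ?_
  congr 1
  exact CliffordAlgebra.lift_ι_apply _ _ _

/-- The ordered product of the factors `α_j + β_j Z_j`. -/
def affineProd {A ι : Type*} [Ring A] [Algebra ℂ A] (Z : ι → A) (α β : ι → ℂ) (L : List ι) : A :=
  (L.map fun j => α j • (1 : A) + β j • Z j).prod

theorem affineProd_nil {A ι : Type*} [Ring A] [Algebra ℂ A] (Z : ι → A) (α β : ι → ℂ) :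
    affineProd Z α β [] = 1 := rfl

theorem affineProd_cons {A ι : Type*} [Ring A] [Algebra ℂ A] (Z : ι → A) (α β : ι → ℂ) (i : ι)
    (L : List ι) :
    affineProd Z α β (i :: L) = (α i • (1 : A) + β i • Z i) * affineProd Z α β L := by
  simp [affineProd]

theorem affineProd_smul {A ι : Type*} [Ring A] [Algebra ℂ A] (Z : ι → A) (c : ι → ℂ)
    (α β : ι → ℂ) (L : List ι) :
    affineProd (fun j => c j • Z j) α β L = affineProd Z α (fun j => β j * c j) L := by
  simp only [affineProd, smul_smul]

theorem map_affineProd {A B ι : Type*} [Ring A] [Algebra ℂ A] [Ring B] [Algebra ℂ B]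
    (F : A →ₐ[ℂ] B) (Z : ι → A) (α β : ι → ℂ) (L : List ι) :
    F (affineProd Z α β L) = affineProd (fun j => F (Z j)) α β L := by
  simp [affineProd, map_list_prod, Function.comp_def]

/-- Two families of coefficient vectors, all of them mutually orthogonal. -/
structure OrthogonalPairs {n : ℕ} {ι : Type*} (u w : ι → CoeffVec n) : Prop where
  left : ∀ i j, i ≠ j → u i ⬝ᵥ u j = 0
  right : ∀ i j, i ≠ j → w i ⬝ᵥ w j = 0
  cross : ∀ i j, u i ⬝ᵥ w j = 0

/-- The bivector of a pair in the exterior algebra. -/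
def wedgePair {n : ℕ} {ι : Type*} (u w : ι → CoeffVec n) (j : ι) :
    ExteriorAlgebra ℂ (CoeffVec n) :=
  ExteriorAlgebra.ι ℂ (u j) * ExteriorAlgebra.ι ℂ (w j)

/-- The product of the two combinations of generators of a pair. -/
def cliffordPair {n : ℕ} {ι : Type*} (u w : ι → CoeffVec n) (j : ι) : QubitOp n :=
  cliffordLin n (u j) * cliffordLin n (w j)

theorem contraction_affineProd {n : ℕ} {ι : Type*} (u w : ι → CoeffVec n) (α β : ι → ℂ)
    (v : CoeffVec n) (L : List ι) (hu : ∀ j ∈ L, v ⬝ᵥ u j = 0) (hw : ∀ j ∈ L, v ⬝ᵥ w j = 0) :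
    contraction v (affineProd (wedgePair u w) α β L) = 0 := by
  induction L with
  | nil => exact contraction_one v
  | cons i L ih =>
    have ih' := ih (fun j hj => hu j (List.mem_cons_of_mem _ hj))
      (fun j hj => hw j (List.mem_cons_of_mem _ hj))
    rw [affineProd_cons, add_mul, map_add, smul_mul_assoc, smul_mul_assoc, one_mul, map_smul,
      map_smul, ih', wedgePair, mul_assoc, contraction_ι_mul, contraction_ι_mul, ih',
      hu i List.mem_cons_self, hw i List.mem_cons_self]
    simp

/-- All the vectors involved are mutually orthogonal, so every contraction that could distinguish
the wedge product from the operator product is zero. -/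
theorem symbolMap_affineProd {n : ℕ} {ι : Type*} {u w : ι → CoeffVec n} (h : OrthogonalPairs u w)
    (α β : ι → ℂ) {L : List ι} (hL : L.Nodup) :
    symbolMap n (affineProd (wedgePair u w) α β L) = affineProd (cliffordPair u w) α β L := by
  induction L with
  | nil => exact symbolMap_one n
  | cons i L ih =>
    obtain ⟨hi, hL'⟩ := List.nodup_cons.mp hL
    have hne : ∀ j ∈ L, i ≠ j := fun j hj hij => hi (hij ▸ hj)
    have h1 : contraction (w i) (affineProd (wedgePair u w) α β L) = 0 :=
      contraction_affineProd u w α β _ L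
        (fun j _ => by rw [dotProduct_comm]; exact h.cross j i) (fun j hj => h.right i j (hne j hj))
    have h2 : contraction (u i) (affineProd (wedgePair u w) α β L) = 0 :=
      contraction_affineProd u w α β _ L
        (fun j hj => h.left i j (hne j hj)) (fun j _ => h.cross i j)
    rw [affineProd_cons, affineProd_cons, ← ih hL', add_mul, add_mul, map_add, smul_mul_assoc,
      smul_mul_assoc, smul_mul_assoc, smul_mul_assoc, one_mul, one_mul, map_smul, map_smul,
      wedgePair, mul_assoc, symbolMap_ι_mul, symbolMap_ι_mul _ h1, cliffordPair, mul_assoc]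
    rw [contraction_ι_mul, h.cross, h2]
    simp

theorem contraction_map_ι_prod {n : ℕ} (v : CoeffVec n) (l : List (CoeffVec n))
    (h : ∀ x ∈ l, v ⬝ᵥ x = 0) : contraction v (l.map (ExteriorAlgebra.ι ℂ)).prod = 0 := by
  induction l with
  | nil => exact contraction_one v
  | cons x l ih =>
    rw [List.map_cons, List.prod_cons, contraction_ι_mul, h x List.mem_cons_self,
      ih fun y hy => h y (List.mem_cons_of_mem _ hy)]
    simp

theorem symbolMap_map_ι_prod {n : ℕ} {l : List (CoeffVec n)}
    (h : l.Pairwise fun x y => x ⬝ᵥ y = 0) :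
    symbolMap n (l.map (ExteriorAlgebra.ι ℂ)).prod = (l.map (cliffordLin n)).prod := by
  induction l with
  | nil => exact symbolMap_one n
  | cons x l ih =>
    obtain ⟨hx, hl⟩ := List.pairwise_cons.mp h
    rw [List.map_cons, List.prod_cons, List.map_cons, List.prod_cons,
      symbolMap_ι_mul _ (contraction_map_ι_prod x l hx), ih hl]

/-! ### The channel in terms of the symbol map -/

/-- The attenuation coefficient of a monomial. -/
def attenuation {n : ℕ} (b : Fin (2 * n) → ℝ) (x : Fin (2 * n) → Fin 2) : ℝ :=
  ∏ p, b p ^ (x p : ℕ)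

theorem channel_apply {n : ℕ} (b : Fin (2 * n) → ℝ) (A : QubitOp n) :
    channel b A = ∑ x, ((attenuation b x : ℂ) * (((monomial x)ᴴ * A).trace / 2 ^ n)) • monomial x :=
  rfl

theorem trace_monomial_mul_channel {n : ℕ} (b : Fin (2 * n) → ℝ) (x : Fin (2 * n) → Fin 2)
    (A : QubitOp n) :
    ((monomial x)ᴴ * channel b A).trace = attenuation b x * ((monomial x)ᴴ * A).trace := by
  rw [channel_apply, Matrix.mul_sum, Matrix.trace_sum, Finset.sum_eq_single x]
  · rw [Matrix.mul_smul, Matrix.trace_smul, trace_monomial, if_pos rfl, smul_eq_mul, mul_assoc,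
      div_mul_cancel₀ _ (by positivity)]
  · intro y _ hy
    rw [Matrix.mul_smul, Matrix.trace_smul, trace_monomial, if_neg hy.symm, smul_zero]
  · simp

/-- With all coefficients equal to 1 the channel fixes the monomials, so by uniqueness it is the
identity; its definition is then the expansion. -/
theorem eq_sum_monomial {n : ℕ} (A : QubitOp n) :
    A = ∑ x, (((monomial x)ᴴ * A).trace / 2 ^ n) • monomial x := by
  have h := channel_unique (n := n) (fun _ => 1) LinearMap.id (by simp)
  have h2 := LinearMap.congr_fun h A
  rw [channel_apply] at h2
  simpa [attenuation] using h2

/-- Some generator commutes with one of `A`, `monomial y` and anticommutes with the other.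
Conjugation by it changes the sign of the product, whose trace must vanish. -/
theorem trace_monomial_eq_zero_of_sign {n : ℕ} {x y : Fin (2 * n) → Fin 2} (hxy : y ≠ x)
    {A : QubitOp n}
    (hA : ∀ p, majorana p * A = (monomialSign p x : ℂ) • (A * majorana p)) :
    ((monomial y)ᴴ * A).trace = 0 := by
  obtain ⟨p, hp⟩ := exists_monomialSign_ne hxy
  set a : QubitOp n := majorana p with ha
  have haa : a * a = 1 := majorana_mul_self p
  have hy : a * (monomial y)ᴴ = (monomialSign p y : ℂ) • ((monomial y)ᴴ * a) := by
    have h1 := congrArg conjTranspose (majorana_mul_monomial p y)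
    rw [conjTranspose_mul, conjTranspose_smul, conjTranspose_mul, majorana_conjTranspose,
      ← ha] at h1
    rw [h1, smul_smul]
    have : (monomialSign p y : ℂ) * star (monomialSign p y : ℂ) = 1 := by
      rw [Complex.star_def, Complex.conj_ofReal]
      exact_mod_cast monomialSign_mul_self p y
    rw [this, one_smul]
  have h2 : a * ((monomial y)ᴴ * A) * a = (-1 : ℂ) • ((monomial y)ᴴ * A) := by
    rw [← mul_assoc, hy, Matrix.smul_mul, Matrix.mul_assoc _ a, hA, Matrix.mul_smul, smul_smul,
      Matrix.smul_mul, Matrix.mul_assoc, Matrix.mul_assoc, haa, Matrix.mul_one]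
    congr 1
    exact_mod_cast hp
  have h3 := congrArg Matrix.trace h2
  rw [Matrix.trace_mul_comm, ← mul_assoc, haa, one_mul, Matrix.trace_smul, smul_eq_mul] at h3
  linear_combination h3 / 2

/-- The commutation signs with all generators determine an operator up to a scalar, so its
attenuation can be found without ordering factors or tracking phases. -/
theorem channel_of_sign {n : ℕ} (b : Fin (2 * n) → ℝ) {x : Fin (2 * n) → Fin 2} {A : QubitOp n}
    (hA : ∀ p, majorana p * A = (monomialSign p x : ℂ) • (A * majorana p)) :
    channel b A = (attenuation b x : ℂ) • A := by
  have h1 : A = (((monomial x)ᴴ * A).trace / 2 ^ n) • monomial x := by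
    conv_lhs => rw [eq_sum_monomial A]
    refine Finset.sum_eq_single x (fun y _ hy => ?_) (by simp)
    rw [trace_monomial_eq_zero_of_sign hy hA, zero_div, zero_smul]
  rw [h1, map_smul, channel_monomial, smul_comm, attenuation]

/-- The attenuation coefficients of the extended family of generators. -/
def extCoeff {n : ℕ} (b : Fin (2 * n) → ℝ) : Fin (2 * n + 1) → ℝ := Fin.cons 1 b

/-- The product of a list of generators. -/
def genProd {n : ℕ} (L : List (Fin (2 * n + 1))) : QubitOp n := (L.map cliffordGen).prod

/-- The bit string of the generators occurring in a list. -/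
def listIndicator {n : ℕ} (L : List (Fin (2 * n + 1))) (p : Fin (2 * n)) : Fin 2 :=
  if p.succ ∈ L then 1 else 0

theorem cliffordGen_mul_genProd {n : ℕ} (a : Fin (2 * n + 1)) {L : List (Fin (2 * n + 1))}
    (hL : L.Nodup) :
    cliffordGen a * genProd L =
      ((-1) ^ L.length * (if a ∈ L then -1 else 1) : ℂ) • (genProd L * cliffordGen a) := by
  have key := mul_list_prod_comm (cliffordGen a : QubitOp n) L cliffordGen
    (fun i => if i = a then 1 else -1) (by
      intro i
      split_ifs with h
      · rw [h, one_smul]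
      · rw [cliffordGen_anticomm (Ne.symm h), neg_one_smul])
  rw [genProd, key]
  congr 1
  clear key
  induction L with
  | nil => simp
  | cons i L ih =>
    obtain ⟨hi, hL'⟩ := List.nodup_cons.mp hL
    rw [List.map_cons, List.prod_cons, ih hL', List.length_cons, pow_succ]
    by_cases h : i = a
    · subst h
      simp [hi]
    · simp only [List.mem_cons, Ne.symm h, false_or, if_neg h]
      ring

theorem prod_map_eq_mul_prod {m : ℕ} {L : List (Fin (m + 1))} (hL : L.Nodup)
    (f : Fin (m + 1) → ℝ) :
    (L.map f).prod =
      (if 0 ∈ L then f 0 else 1) * ∏ p : Fin m, if p.succ ∈ L then f p.succ else 1 := by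
  rw [← Fin.prod_univ_succ (fun a => if a ∈ L then f a else 1), ← List.prod_toFinset f hL,
    ← Finset.prod_filter]
  congr 1
  ext a
  simp

theorem majorana_mul_genProd {n : ℕ} (p : Fin (2 * n)) {L : List (Fin (2 * n + 1))}
    (hL : L.Nodup) (he : Even L.length) :
    majorana p * genProd L =
      (monomialSign p (listIndicator L) : ℂ) • (genProd L * majorana p) := by
  have h1 : majorana p * genProd L = (((if (0 : Fin (2 * n + 1)) ∈ L then -1 else 1) *
      (if p.succ ∈ L then -1 else 1) : ℂ)) • (genProd L * majorana p) := by
    rw [majorana_eq_cliffordGen, smul_mul_assoc, mul_assoc, cliffordGen_mul_genProd p.succ hL,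
      mul_smul_comm, ← mul_assoc, cliffordGen_mul_genProd 0 hL, he.neg_one_pow, smul_mul_assoc,
      mul_smul_comm, ← mul_assoc, smul_comm Complex.I, smul_comm Complex.I, smul_smul]
    congr 1
    ring
  rw [h1]
  congr 1
  have hprod := prod_map_eq_mul_prod hL fun _ => (-1 : ℝ)
  rw [List.map_const', List.prod_replicate, he.neg_one_pow] at hprod
  have hx : ∀ q, (-1 : ℝ) ^ (listIndicator L q : ℕ) = if q.succ ∈ L then -1 else 1 := by
    intro q
    unfold listIndicator
    split_ifs <;> simp
  rw [monomialSign]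
  simp only [hx]
  -- The list has even length, so the number of its nonzero indices is odd exactly when the index
  -- `0` occurs.
  have h0 : (∏ q : Fin (2 * n), if q.succ ∈ L then (-1 : ℝ) else 1) =
      if (0 : Fin (2 * n + 1)) ∈ L then -1 else 1 := by
    split_ifs at hprod ⊢ <;> linarith
  rw [h0]
  split_ifs <;> norm_num

theorem attenuation_listIndicator {n : ℕ} (b : Fin (2 * n) → ℝ) {L : List (Fin (2 * n + 1))}
    (hL : L.Nodup) : attenuation b (listIndicator L) = (L.map (extCoeff b)).prod := by
  rw [prod_map_eq_mul_prod hL, extCoeff, Fin.cons_zero, ite_self, one_mul, attenuation]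
  refine Finset.prod_congr rfl fun p _ => ?_
  unfold listIndicator
  split_ifs <;> simp

/-- In an even product the parity operators contributed by the generators cancel, leaving a phase
times a Majorana monomial. This is why the index `0` carries the coefficient 1 and why evenness is
required. -/
theorem channel_genProd {n : ℕ} (b : Fin (2 * n) → ℝ) {L : List (Fin (2 * n + 1))}
    (hL : L.Nodup) (he : Even L.length) :
    channel b (genProd L) = ((L.map (extCoeff b)).prod : ℂ) • genProd L := by
  rw [channel_of_sign b fun p => majorana_mul_genProd p hL he, attenuation_listIndicator b hL]

/-! ### The channel as diagonal scaling of the exterior algebra -/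

/-- The wedge product of a list of standard basis vectors. -/
def wedgeBasis {n : ℕ} (L : List (Fin (2 * n + 1))) : ExteriorAlgebra ℂ (CoeffVec n) :=
  (L.map fun a => ExteriorAlgebra.ι ℂ (Pi.single a (1 : ℂ) : CoeffVec n)).prod

theorem wedgeBasis_eq_zero {n : ℕ} {L : List (Fin (2 * n + 1))} (hL : ¬ L.Nodup) :
    wedgeBasis L = 0 := by
  have h := ExteriorAlgebra.ιMulti_eq_zero_of_not_inj (R := ℂ)
    (v := fun i : Fin L.length => (Pi.single (L.get i) (1 : ℂ) : CoeffVec n)) (by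
      intro hinj
      refine hL (List.nodup_iff_injective_get.mpr fun i j hij => hinj ?_)
      simp only [hij])
  rw [ExteriorAlgebra.ιMulti_apply] at h
  rw [← h, wedgeBasis]
  congr 1
  conv_lhs => rw [← List.ofFn_get L, List.map_ofFn]
  rfl

theorem symbolMap_wedgeBasis {n : ℕ} {L : List (Fin (2 * n + 1))} (hL : L.Nodup) :
    symbolMap n (wedgeBasis L) = genProd L := by
  have h := symbolMap_map_ι_prod (n := n)
    (l := L.map fun a => (Pi.single a (1 : ℂ) : CoeffVec n)) (by
      rw [List.pairwise_map]
      refine hL.imp fun {a c} hac => ?_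
      rw [single_one_dotProduct, Pi.single_eq_of_ne hac])
  rw [List.map_map, List.map_map] at h
  rw [genProd, wedgeBasis]
  refine h.trans ?_
  congr 1
  exact List.map_congr_left fun a _ => cliffordLin_single a

/-- The diagonal map scaling the coefficient of each generator. -/
def scaleMap {n : ℕ} (d : Fin (2 * n + 1) → ℝ) : CoeffVec n →ₗ[ℂ] CoeffVec n :=
  LinearMap.mulLeft ℂ (fun a => (d a : ℂ) : CoeffVec n)

theorem scaleMap_apply {n : ℕ} (d : Fin (2 * n + 1) → ℝ) (v : CoeffVec n) (a : Fin (2 * n + 1)) :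
    scaleMap d v a = d a * v a := rfl

theorem scaleMap_single {n : ℕ} (d : Fin (2 * n + 1) → ℝ) (a : Fin (2 * n + 1)) :
    scaleMap d (Pi.single a 1) = (d a : ℂ) • (Pi.single a 1 : CoeffVec n) := by
  ext c
  rw [scaleMap_apply]
  by_cases h : c = a
  · subst h; simp
  · simp [h]

theorem map_scaleMap_wedgeBasis {n : ℕ} (d : Fin (2 * n + 1) → ℝ) (L : List (Fin (2 * n + 1))) :
    ExteriorAlgebra.map (scaleMap d) (wedgeBasis L) = ((L.map d).prod : ℂ) • wedgeBasis L := by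
  induction L with
  | nil => simp [wedgeBasis]
  | cons a L ih =>
    have hc : wedgeBasis (a :: L) =
      ExteriorAlgebra.ι ℂ (Pi.single a (1 : ℂ) : CoeffVec n) * wedgeBasis L := by
      simp [wedgeBasis]
    rw [hc, map_mul, ih, ExteriorAlgebra.map_apply_ι, scaleMap_single, map_smul,
      smul_mul_smul_comm]
    simp

/-- The span of the wedge products of basis vectors with a prescribed set of degrees. -/
def wedgeSpan (n : ℕ) (P : ℕ → Prop) : Submodule ℂ (ExteriorAlgebra ℂ (CoeffVec n)) :=
  Submodule.span ℂ {z | ∃ L : List (Fin (2 * n + 1)), P L.length ∧ wedgeBasis L = z}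

theorem ι_mul_mem_wedgeSpan {n : ℕ} {P R : ℕ → Prop} (hPR : ∀ k, P k → R (k + 1))
    (v : CoeffVec n) {z : ExteriorAlgebra ℂ (CoeffVec n)} (hz : z ∈ wedgeSpan n P) :
    ExteriorAlgebra.ι ℂ v * z ∈ wedgeSpan n R := by
  have hv : ExteriorAlgebra.ι ℂ v =
      ∑ a, v a • ExteriorAlgebra.ι ℂ (Pi.single a (1 : ℂ) : CoeffVec n) := by
    have h : v = ∑ a, v a • (Pi.single a (1 : ℂ) : CoeffVec n) := by
      ext c
      simp [Finset.sum_apply, Pi.single_apply]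
    conv_lhs => rw [h]
    simp only [map_sum, map_smul]
  induction hz using Submodule.span_induction with
  | mem z hz =>
    obtain ⟨L, hL, rfl⟩ := hz
    rw [hv, Finset.sum_mul]
    refine Submodule.sum_mem _ fun a _ => ?_
    rw [smul_mul_assoc]
    refine Submodule.smul_mem _ _ (Submodule.subset_span ⟨a :: L, hPR _ hL, ?_⟩)
    simp [wedgeBasis]
  | zero => simp
  | add x y _ _ hx hy => rw [mul_add]; exact Submodule.add_mem _ hx hy
  | smul c x _ hx => rw [mul_smul_comm]; exact Submodule.smul_mem _ _ hx

theorem one_mem_wedgeSpan {n : ℕ} {P : ℕ → Prop} (h : P 0) : 1 ∈ wedgeSpan n P :=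
  Submodule.subset_span ⟨[], h, rfl⟩

theorem map_ι_prod_mem_wedgeSpan {n : ℕ} (l : List (CoeffVec n)) :
    (l.map (ExteriorAlgebra.ι ℂ)).prod ∈ wedgeSpan n (· = l.length) := by
  induction l with
  | nil => exact one_mem_wedgeSpan rfl
  | cons v l ih =>
    rw [List.map_cons, List.prod_cons]
    exact ι_mul_mem_wedgeSpan (fun k hk => by simp [hk]) v ih

theorem wedgeSpan_mono {n : ℕ} {P R : ℕ → Prop} (h : ∀ k, P k → R k) :
    wedgeSpan n P ≤ wedgeSpan n R :=
  Submodule.span_mono fun _ ⟨L, hL, hz⟩ => ⟨L, h _ hL, hz⟩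

theorem affineProd_wedgePair_mem_wedgeSpan {n : ℕ} {ι : Type*} (u w : ι → CoeffVec n)
    (α β : ι → ℂ) (L : List ι) : affineProd (wedgePair u w) α β L ∈ wedgeSpan n Even := by
  induction L with
  | nil => exact one_mem_wedgeSpan (by simp)
  | cons i L ih =>
    rw [affineProd_cons, add_mul, smul_mul_assoc, smul_mul_assoc, one_mul, wedgePair, mul_assoc]
    refine Submodule.add_mem _ (Submodule.smul_mem _ _ ih) (Submodule.smul_mem _ _ ?_)
    exact ι_mul_mem_wedgeSpan (P := Odd) (fun k hk => hk.add_one) _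
      (ι_mul_mem_wedgeSpan (fun k hk => hk.add_one) _ ih)

/-- On a wedge of distinct basis vectors both sides multiply by the same product of coefficients,
and a wedge with a repeated vector is zero. -/
theorem channel_symbolMap {n : ℕ} (b : Fin (2 * n) → ℝ) {z : ExteriorAlgebra ℂ (CoeffVec n)}
    (hz : z ∈ wedgeSpan n Even) :
    channel b (symbolMap n z) =
      symbolMap n (ExteriorAlgebra.map (scaleMap (extCoeff b)) z) := by
  induction hz using Submodule.span_induction with
  | mem z hz =>
    obtain ⟨L, hL, rfl⟩ := hz
    by_cases hn : L.Nodup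
    · rw [map_scaleMap_wedgeBasis, map_smul, symbolMap_wedgeBasis hn, channel_genProd b hn hL]
    · simp [wedgeBasis_eq_zero hn]
  | zero => simp
  | add x y _ _ hx hy => simp only [map_add, hx, hy]
  | smul c x _ hx => simp only [map_smul, hx]

/-- An element of even degree `k` involves only monomials whose attenuation is a product of `k`
distinct extended coefficients, so a monomial with attenuation above all such products cannot occur
in its symbol. -/
theorem trace_monomial_mul_symbolMap_eq_zero {n : ℕ} (b : Fin (2 * n) → ℝ) {k : ℕ} {c : ℝ}
    (hk : Even k)
    (hc : ∀ L : List (Fin (2 * n + 1)), L.Nodup → L.length = k → (L.map (extCoeff b)).prod ≤ c)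
    {z : ExteriorAlgebra ℂ (CoeffVec n)} (hz : z ∈ wedgeSpan n (· = k))
    {x : Fin (2 * n) → Fin 2} (hx : c < attenuation b x) :
    ((monomial x)ᴴ * symbolMap n z).trace = 0 := by
  induction hz using Submodule.span_induction with
  | mem z hz =>
    obtain ⟨L, hL, rfl⟩ := hz
    by_cases hn : L.Nodup
    · rw [symbolMap_wedgeBasis hn]
      refine trace_monomial_eq_zero_of_sign (x := listIndicator L) ?_
        fun p => majorana_mul_genProd p hn (hL ▸ hk)
      rintro rfl
      rw [attenuation_listIndicator b hn] at hx
      exact absurd (hc L hn hL) (not_le.mpr hx)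
    · simp [wedgeBasis_eq_zero hn]
  | zero => simp
  | add x y _ _ hx hy => rw [map_add, mul_add, trace_add, hx, hy, add_zero]
  | smul c x _ hx => rw [map_smul, mul_smul_comm, trace_smul, hx, smul_zero]

/-! ### Products of independent commuting involutions -/

/-- A family of commuting Hermitian involutions such that for each of them there is an involution
that anticommutes with it and commutes with all the others. -/
structure IndependentInvolutions {N ι : Type*} [Fintype N] [DecidableEq N]
    (Z : ι → Matrix N N ℂ) : Prop where
  hermitian : ∀ j, (Z j)ᴴ = Z j
  mul_self : ∀ j, Z j * Z j = 1
  commute : ∀ i j, Commute (Z i) (Z j)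
  flip : ∀ j, ∃ G : Matrix N N ℂ, G * G = 1 ∧ G * Z j = -(Z j * G) ∧ ∀ i, i ≠ j → Commute G (Z i)

theorem commute_affineProd {A ι : Type*} [Ring A] [Algebra ℂ A] {Z : ι → A} (α β : ι → ℂ) {X : A}
    {L : List ι} (h : ∀ j ∈ L, Commute X (Z j)) : Commute X (affineProd Z α β L) := by
  induction L with
  | nil => exact Commute.one_right X
  | cons i L ih =>
    rw [affineProd_cons]
    refine Commute.mul_right (Commute.add_right ((Commute.one_right X).smul_right _)
      ((h i List.mem_cons_self).smul_right _)) (ih fun j hj => h j (List.mem_cons_of_mem _ hj))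

namespace IndependentInvolutions

variable {N ι : Type*} [Fintype N] [DecidableEq N] {Z : ι → Matrix N N ℂ}

theorem affineProd_mul (hZ : IndependentInvolutions Z) (α β α' β' : ι → ℂ) (L : List ι) :
    affineProd Z α β L * affineProd Z α' β' L =
      affineProd Z (fun j => α j * α' j + β j * β' j) (fun j => α j * β' j + β j * α' j) L := by
  induction L with
  | nil => simp [affineProd_nil]
  | cons i L ih =>
    rw [affineProd_cons, affineProd_cons, affineProd_cons, ← ih]
    have hc : Commute (α' i • (1 : Matrix N N ℂ) + β' i • Z i) (affineProd Z α β L) :=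
      Commute.add_left ((Commute.one_left _).smul_left _)
        ((commute_affineProd α β fun j _ => hZ.commute i j).smul_left _)
    rw [mul_assoc, ← mul_assoc (affineProd Z α β L), ← hc.eq, mul_assoc, ← mul_assoc]
    congr 1
    rw [add_mul, mul_add, mul_add]
    simp only [smul_mul_smul_comm, mul_one, one_mul, hZ.mul_self]
    module

theorem affineProd_conjTranspose (hZ : IndependentInvolutions Z) (α β : ι → ℂ) (L : List ι) :
    (affineProd Z α β L)ᴴ = affineProd Z (star α) (star β) L := by
  induction L with
  | nil => simp [affineProd_nil]
  | cons i L ih =>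
    have hc : Commute (star (α i) • (1 : Matrix N N ℂ) + star (β i) • Z i)
        (affineProd Z (star α) (star β) L) :=
      Commute.add_left ((Commute.one_left _).smul_left _)
        ((commute_affineProd _ _ fun j _ => hZ.commute i j).smul_left _)
    rw [affineProd_cons, affineProd_cons, conjTranspose_mul, ih, conjTranspose_add,
      conjTranspose_smul, conjTranspose_smul, conjTranspose_one, hZ.hermitian, ← hc.eq]
    rfl

theorem trace_affineProd (hZ : IndependentInvolutions Z) (α β : ι → ℂ) {L : List ι}
    (hL : L.Nodup) : (affineProd Z α β L).trace = Fintype.card N * (L.map α).prod := by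
  induction L with
  | nil => simp [affineProd_nil]
  | cons i L ih =>
    obtain ⟨hi, hL'⟩ := List.nodup_cons.mp hL
    obtain ⟨G, hGG, hG, hGc⟩ := hZ.flip i
    have hc : Commute G (affineProd Z α β L) :=
      commute_affineProd α β fun j hj => hGc j fun h => hi (h ▸ hj)
    have h0 : (Z i * affineProd Z α β L).trace = 0 := by
      have h1 : G * (Z i * affineProd Z α β L) * G = -(Z i * affineProd Z α β L) := by
        rw [← mul_assoc, hG, neg_mul, neg_mul, mul_assoc, mul_assoc, ← hc.eq, ← mul_assoc G,
          hGG, one_mul]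
      have h2 := congrArg Matrix.trace h1
      rw [Matrix.trace_mul_comm, ← mul_assoc, hGG, one_mul, Matrix.trace_neg] at h2
      linear_combination h2 / 2
    rw [affineProd_cons, add_mul, trace_add, smul_mul_assoc, smul_mul_assoc, trace_smul, trace_smul,
      h0, one_mul, ih hL', List.map_cons, List.prod_cons, smul_eq_mul, smul_zero, add_zero]
    ring

/-- The factor for `j` takes the values `s j` and `t j` on the two eigenspaces of `Z j`, so powers
act on these values separately. -/
theorem affineProd_pow (hZ : IndependentInvolutions Z) (s t : ι → ℂ) (L : List ι) (k : ℕ) :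
    affineProd Z (fun j => (s j + t j) / 2) (fun j => (s j - t j) / 2) L ^ k =
      affineProd Z (fun j => (s j ^ k + t j ^ k) / 2) (fun j => (s j ^ k - t j ^ k) / 2) L := by
  induction k with
  | zero => simp [affineProd]
  | succ k ih =>
    rw [pow_succ, ih, hZ.affineProd_mul]
    congr 1 <;> funext j <;> ring

end IndependentInvolutions

/-! ### The spectrum of a product of independent involutions -/

/-- The products of one of the two numbers `(1 ± a) / 2` for each entry `a` of a list. -/
def productSpectrum : List ℝ → List ℝ
  | [] => [1]
  | a :: l => (productSpectrum l).map (fun t => (1 + a) / 2 * t) ++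
      (productSpectrum l).map fun t => (1 - a) / 2 * t

theorem sum_pow_productSpectrum (l : List ℝ) (k : ℕ) :
    ((productSpectrum l).map (· ^ k)).sum =
      (l.map fun a => ((1 + a) / 2) ^ k + ((1 - a) / 2) ^ k).prod := by
  induction l with
  | nil => simp [productSpectrum]
  | cons a l ih =>
    simp only [productSpectrum, List.map_append, List.map_map, List.sum_append, List.map_cons,
      List.prod_cons, Function.comp_def, mul_pow, List.sum_map_mul_left, ih, add_mul]

/-- Only finitely many values occur, and on them `f` agrees with an interpolating polynomial. The
spectrum can thus be read off from traces of powers, without diagonalizing. -/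
theorem sum_map_eq_of_sum_pow_eq {ι : Type*} [Fintype ι] (e : ι → ℝ) (l : List ℝ)
    (h : ∀ k : ℕ, ∑ i, e i ^ k = (l.map (· ^ k)).sum) (f : ℝ → ℝ) :
    ∑ i, f (e i) = (l.map f).sum := by
  have hp : ∀ p : Polynomial ℝ, ∑ i, p.eval (e i) = (l.map fun t => p.eval t).sum := by
    intro p
    induction p using Polynomial.induction_on' with
    | add p q hp hq => simp only [Polynomial.eval_add, Finset.sum_add_distrib, hp, hq,
        List.sum_map_add]
    | monomial k c => simp only [Polynomial.eval_monomial, ← Finset.mul_sum, h,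
        List.sum_map_mul_left]
  let s : Finset ℝ := Finset.univ.image e ∪ l.toFinset
  have hs : ∀ t ∈ s, (Lagrange.interpolate s id f).eval t = f t := fun t ht =>
    Lagrange.eval_interpolate_at_node f (Function.injective_id.injOn) ht
  have h1 := hp (Lagrange.interpolate s id f)
  rw [Finset.sum_congr rfl fun i _ => hs (e i) (by simp [s])] at h1
  rw [h1]
  congr 1
  exact List.map_congr_left fun t ht => hs t (by simp [s, ht])

theorem trace_pow_eq_sum_eigenvalues₀ {N : Type*} [Fintype N] [DecidableEq N] {A : Matrix N N ℂ}
    (hA : A.IsHermitian) (k : ℕ) : (A ^ k).trace = ∑ i, ((hA.eigenvalues₀ i ^ k : ℝ) : ℂ) := by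
  have h1 : (A ^ k).trace = ∑ i, ((hA.eigenvalues i ^ k : ℝ) : ℂ) := by
    conv_lhs => rw [hA.spectral_theorem, ← map_pow, Unitary.conjStarAlgAut_apply,
      Matrix.trace_mul_comm, ← mul_assoc]
    simp [Matrix.diagonal_pow, Matrix.trace_diagonal]
  rw [h1]
  exact Equiv.sum_comp _ (fun i => ((hA.eigenvalues₀ i ^ k : ℝ) : ℂ))

theorem pow_smul_affineProd {A ι : Type*} [Ring A] [Algebra ℂ A] (Z : ι → A) (c : ℂ) (α β : ι → ℂ)
    (L : List ι) : c ^ L.length • affineProd Z α β L =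
      affineProd Z (fun j => c * α j) (fun j => c * β j) L := by
  induction L with
  | nil => simp [affineProd_nil]
  | cons i L ih =>
    rw [affineProd_cons, affineProd_cons, ← ih, List.length_cons, pow_succ', mul_smul_comm,
      ← smul_mul_assoc, ← smul_mul_assoc, mul_smul, smul_comm c, smul_add, smul_smul, smul_smul]

/-- The normalized product `2^{-n} ∏_j (1 + μ_j Z_j)`. -/
def productState {n : ℕ} (Z : Fin n → QubitOp n) (μ : Fin n → ℝ) : QubitOp n :=
  (1 / 2 ^ n : ℂ) • affineProd Z 1 (fun j => (μ j : ℂ)) (List.finRange n)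

theorem productState_isHermitian {n : ℕ} {Z : Fin n → QubitOp n} (hZ : IndependentInvolutions Z)
    (μ : Fin n → ℝ) : (productState Z μ).IsHermitian := by
  rw [Matrix.IsHermitian, productState, conjTranspose_smul, hZ.affineProd_conjTranspose]
  congr 1
  · simp
  · congr 1 <;> ext j <;> simp

theorem trace_productState {n : ℕ} {Z : Fin n → QubitOp n} (hZ : IndependentInvolutions Z)
    (μ : Fin n → ℝ) : (productState Z μ).trace = 1 := by
  rw [productState, trace_smul, hZ.trace_affineProd _ _ (List.nodup_finRange n),
    ← List.ofFn_eq_map, List.prod_ofFn]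
  simp

theorem sum_eigenvalues_productState {n : ℕ} {Z : Fin n → QubitOp n}
    (hZ : IndependentInvolutions Z) (μ : Fin n → ℝ) (h : (productState Z μ).IsHermitian)
    (f : ℝ → ℝ) :
    ∑ i, f (h.eigenvalues₀ i) = ((productSpectrum (List.ofFn μ)).map f).sum := by
  refine sum_map_eq_of_sum_pow_eq _ _ (fun k => ?_) f
  -- Sharing the normalization out as `1/2` per factor gives each factor the two values `(1 ± μ j) /
  -- 2`.
  have h2 : productState Z μ = affineProd Z
      (fun j => ((((1 + μ j) / 2 : ℝ) : ℂ) + (((1 - μ j) / 2 : ℝ) : ℂ)) / 2)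
      (fun j => ((((1 + μ j) / 2 : ℝ) : ℂ) - (((1 - μ j) / 2 : ℝ) : ℂ)) / 2) (List.finRange n) := by
    have h3 := pow_smul_affineProd Z (1 / 2) 1 (fun j => (μ j : ℂ)) (List.finRange n)
    rw [List.length_finRange, div_pow, one_pow] at h3
    rw [productState, h3]
    congr 1 <;> funext j <;> simp <;> ring
  have h1 := congrArg (fun A : QubitOp n => (A ^ k).trace) h2
  simp only [hZ.affineProd_pow] at h1
  rw [trace_pow_eq_sum_eigenvalues₀ h k, hZ.trace_affineProd _ _ (List.nodup_finRange n)] at h1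
  rw [sum_pow_productSpectrum, ← Complex.ofReal_inj, List.map_ofFn, List.prod_ofFn]
  rw [← List.ofFn_eq_map, List.prod_ofFn, Finset.prod_div_distrib] at h1
  push_cast at h1 ⊢
  rw [h1]
  simp only [Fintype.card_pi, Fintype.card_fin, Finset.prod_const, Finset.card_univ, Nat.cast_pow,
    Nat.cast_ofNat, Function.comp_apply]
  rw [mul_div_cancel₀ _ (by positivity)]
  push_cast
  rfl

theorem nonneg_of_mem_productSpectrum {l : List ℝ} (hl : ∀ a ∈ l, -1 ≤ a ∧ a ≤ 1) {t : ℝ}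
    (ht : t ∈ productSpectrum l) : 0 ≤ t := by
  induction l generalizing t with
  | nil => simp [productSpectrum] at ht; simp [ht]
  | cons a l ih =>
    have ha := hl a List.mem_cons_self
    have ih' := @ih fun x hx => hl x (List.mem_cons_of_mem _ hx)
    simp only [productSpectrum, List.mem_append, List.mem_map] at ht
    rcases ht with ⟨s, hs, rfl⟩ | ⟨s, hs, rfl⟩
    · exact mul_nonneg (by linarith) (ih' hs)
    · exact mul_nonneg (by linarith) (ih' hs)

theorem isState_productState {n : ℕ} {Z : Fin n → QubitOp n} (hZ : IndependentInvolutions Z)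
    {μ : Fin n → ℝ} (hμ : ∀ j, -1 ≤ μ j ∧ μ j ≤ 1) : IsState (productState Z μ) := by
  refine ⟨?_, trace_productState hZ μ⟩
  have hH := productState_isHermitian hZ μ
  rw [hH.posSemidef_iff_eigenvalues_nonneg]
  -- The spectral sum of the indicator of the negative reals counts the negative eigenvalues.
  have h1 := sum_eigenvalues_productState hZ μ hH (fun t => if t < 0 then 1 else 0)
  have h2 : ((productSpectrum (List.ofFn μ)).map fun t : ℝ => if t < 0 then (1 : ℝ) else 0).sum
      = 0 := by
    refine List.sum_eq_zero fun y hy => ?_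
    obtain ⟨t, ht, rfl⟩ := List.mem_map.mp hy
    have := nonneg_of_mem_productSpectrum (l := List.ofFn μ) (by
      intro a ha
      obtain ⟨j, rfl⟩ := (List.mem_ofFn' _ _).mp ha
      exact hμ j) ht
    simp [this]
  rw [h2, Finset.sum_eq_zero_iff_of_nonneg (fun i _ => by split_ifs <;> norm_num)] at h1
  intro i
  have h3 := h1 ((Fintype.equivOfCardEq (Fintype.card_fin _)).symm i) (Finset.mem_univ _)
  by_contra hneg
  change ¬ 0 ≤ hH.eigenvalues₀ _ at hneg
  rw [if_pos (not_le.mp hneg)] at h3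
  exact one_ne_zero h3

/-! ### Comparison of product spectra -/

/-- The comparison of two product spectra through the sums of all convex functions. -/
def SpectrumMajorized (l l' : List ℝ) : Prop :=
  ∀ f : ℝ → ℝ, ConvexOn ℝ (Set.Ici 0) f →
    ((productSpectrum l).map f).sum ≤ ((productSpectrum l').map f).sum

theorem sum_map_productSpectrum_cons (f : ℝ → ℝ) (a : ℝ) (l : List ℝ) :
    ((productSpectrum (a :: l)).map f).sum =
      ((productSpectrum l).map fun s => f ((1 + a) / 2 * s) + f ((1 - a) / 2 * s)).sum := by
  simp only [productSpectrum, List.map_append, List.map_map, List.sum_append, List.sum_map_add,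
    Function.comp_def]

theorem sum_map_productSpectrum_cons_cons (f : ℝ → ℝ) (a b : ℝ) (l : List ℝ) :
    ((productSpectrum (a :: b :: l)).map f).sum =
      ((productSpectrum l).map fun s =>
        f ((1 + a) / 2 * ((1 + b) / 2 * s)) + f ((1 - a) / 2 * ((1 + b) / 2 * s)) +
        (f ((1 + a) / 2 * ((1 - b) / 2 * s)) + f ((1 - a) / 2 * ((1 - b) / 2 * s)))).sum := by
  rw [sum_map_productSpectrum_cons, sum_map_productSpectrum_cons]

theorem convexOn_comp_mul {f : ℝ → ℝ} (hf : ConvexOn ℝ (Set.Ici 0) f) {c : ℝ} (hc : 0 ≤ c) :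
    ConvexOn ℝ (Set.Ici 0) fun s => f (c * s) := by
  refine ⟨convex_Ici 0, fun x hx y hy a b ha hb hab => ?_⟩
  have h := hf.2 (mul_nonneg hc hx : c * x ∈ Set.Ici (0 : ℝ)) (mul_nonneg hc hy) ha hb hab
  refine le_trans (le_of_eq ?_) h
  simp only [smul_eq_mul]
  congr 1
  ring

/-- The point `x'` is the mirror image of `x` in the interval from `y` to `y'`, so the two convexity
inequalities have interchanged weights and add up. -/
theorem convexOn_add_le {f : ℝ → ℝ} (hf : ConvexOn ℝ (Set.Ici 0) f) {x x' y y' : ℝ}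
    (hy : 0 ≤ y) (hyx : y ≤ x) (hxy : x ≤ y') (h : x + x' = y + y') :
    f x + f x' ≤ f y + f y' := by
  rcases eq_or_lt_of_le (hyx.trans hxy) with he | hlt
  · have h1 : x = y := le_antisymm (he ▸ hxy) hyx
    have h2 : x' = y' := by linarith
    rw [h1, h2]
  · have hd : 0 < y' - y := sub_pos.mpr hlt
    set t := (x - y) / (y' - y) with ht
    have ht0 : 0 ≤ t := div_nonneg (by linarith) hd.le
    have ht1 : t ≤ 1 := (div_le_one hd).mpr (by linarith)
    have htm : t * (y' - y) = x - y := div_mul_cancel₀ _ hd.ne'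
    have hy' : y' ∈ Set.Ici (0 : ℝ) := hy.trans hlt.le
    have h1 := hf.2 (Set.mem_Ici.mpr hy) hy' (sub_nonneg.mpr ht1) ht0 (by ring)
    have h2 := hf.2 (Set.mem_Ici.mpr hy) hy' ht0 (sub_nonneg.mpr ht1) (by ring)
    have e1 : (1 - t) • y + t • y' = x := by simp only [smul_eq_mul]; linarith
    have e2 : t • y + (1 - t) • y' = x' := by simp only [smul_eq_mul]; linarith
    rw [e1] at h1
    rw [e2] at h2
    simp only [smul_eq_mul] at h1 h2
    linarith

namespace SpectrumMajorized

theorem refl (l : List ℝ) : SpectrumMajorized l l := fun _ _ => le_rfl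

theorem trans {l₁ l₂ l₃ : List ℝ} (h : SpectrumMajorized l₁ l₂) (h' : SpectrumMajorized l₂ l₃) :
    SpectrumMajorized l₁ l₃ := fun f hf => (h f hf).trans (h' f hf)

theorem cons {l l' : List ℝ} (h : SpectrumMajorized l l') {a : ℝ} (ha : 0 ≤ a) (ha1 : a ≤ 1) :
    SpectrumMajorized (a :: l) (a :: l') := by
  intro f hf
  rw [sum_map_productSpectrum_cons, sum_map_productSpectrum_cons]
  exact h _ ((convexOn_comp_mul hf (by linarith)).add (convexOn_comp_mul hf (by linarith)))

theorem swap (a b : ℝ) (l : List ℝ) : SpectrumMajorized (a :: b :: l) (b :: a :: l) := by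
  intro f _
  rw [sum_map_productSpectrum_cons_cons, sum_map_productSpectrum_cons_cons]
  refine le_of_eq (congrArg List.sum (List.map_congr_left fun s _ => ?_))
  have e : ∀ p q : ℝ, p * (q * s) = q * (p * s) := fun p q => by ring
  rw [e ((1 + a) / 2), e ((1 + a) / 2), e ((1 - a) / 2), e ((1 - a) / 2)]
  ring

theorem reduce {c a : ℝ} (hc : 0 ≤ c) (hca : c ≤ a) (ha : a ≤ 1) {l : List ℝ}
    (hl : ∀ x ∈ l, 0 ≤ x ∧ x ≤ 1) : SpectrumMajorized (c :: l) (a :: l) := by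
  intro f hf
  rw [sum_map_productSpectrum_cons, sum_map_productSpectrum_cons]
  refine List.sum_le_sum fun s hs => ?_
  have hs0 := nonneg_of_mem_productSpectrum (fun x hx => ⟨by linarith [(hl x hx).1], (hl x hx).2⟩) hs
  rw [add_comm (f ((1 + a) / 2 * s))]
  refine convexOn_add_le hf (mul_nonneg (by linarith) hs0) ?_ ?_ (by ring)
  · exact mul_le_mul_of_nonneg_right (by linarith) hs0
  · exact mul_le_mul_of_nonneg_right (by linarith) hs0

/-- The four eigenvalue factors split into the pairs `(1 ± x)(1 ± y)` with equal signs, of sum `2(1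
+ xy)`, and with opposite signs, of sum `2(1 - xy)`. Keeping the product `xy = ab` keeps both sums,
while `x + y ≤ a + b` and `|x - y| ≤ a - b` say that each pair is spread further apart. -/
theorem transfer {x y a b : ℝ} (hx : 0 < x) (hy : 0 ≤ y) (ha : a ≤ 1) (hb : 0 ≤ b) (hbx : b ≤ x)
    (hxa : x ≤ a) (hxy : x * y = a * b) {l : List ℝ} (hl : ∀ x ∈ l, 0 ≤ x ∧ x ≤ 1) :
    SpectrumMajorized (x :: y :: l) (a :: b :: l) := by
  intro f hf
  rw [sum_map_productSpectrum_cons_cons, sum_map_productSpectrum_cons_cons]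
  refine List.sum_le_sum fun s hs => ?_
  have hs0 := nonneg_of_mem_productSpectrum (fun x hx => ⟨by linarith [(hl x hx).1], (hl x hx).2⟩) hs
  have hsum : x + y ≤ a + b := by
    have h1 : x * (x + y) ≤ x * (a + b) := by
      nlinarith [mul_nonneg (sub_nonneg.mpr hxa) (sub_nonneg.mpr hbx)]
    exact le_of_mul_le_mul_left h1 hx
  -- Use `(x - y)² = (x + y)² - 4xy` and the same identity for `a`, `b`.
  have hdiff : |x - y| ≤ a - b := by
    refine abs_le_of_sq_le_sq ?_ (by linarith)
    nlinarith
  obtain ⟨hd1, hd2⟩ := abs_le.mp hdiff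
  have hb1 : b ≤ 1 := by linarith
  have k1 : f ((1 + x) / 2 * ((1 + y) / 2 * s)) + f ((1 - x) / 2 * ((1 - y) / 2 * s)) ≤
      f ((1 - a) / 2 * ((1 - b) / 2 * s)) + f ((1 + a) / 2 * ((1 + b) / 2 * s)) := by
    have e : ∀ p q : ℝ, p / 2 * (q / 2 * s) = p * q * (s / 4) := fun p q => by ring
    simp only [e]
    have hs4 : 0 ≤ s / 4 := by linarith
    refine convexOn_add_le hf
      (mul_nonneg (mul_nonneg (by linarith) (by linarith)) hs4) ?_ ?_ ?_
    · exact mul_le_mul_of_nonneg_right (by nlinarith) hs4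
    · exact mul_le_mul_of_nonneg_right (by nlinarith) hs4
    · rw [← add_mul, ← add_mul]
      congr 1
      linear_combination 2 * hxy
  have k2 : f ((1 + x) / 2 * ((1 - y) / 2 * s)) + f ((1 - x) / 2 * ((1 + y) / 2 * s)) ≤
      f ((1 - a) / 2 * ((1 + b) / 2 * s)) + f ((1 + a) / 2 * ((1 - b) / 2 * s)) := by
    have e : ∀ p q : ℝ, p / 2 * (q / 2 * s) = p * q * (s / 4) := fun p q => by ring
    simp only [e]
    have hs4 : 0 ≤ s / 4 := by linarith
    refine convexOn_add_le hf
      (mul_nonneg (mul_nonneg (by linarith) (by linarith)) hs4) ?_ ?_ ?_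
    · exact mul_le_mul_of_nonneg_right (by nlinarith) hs4
    · exact mul_le_mul_of_nonneg_right (by nlinarith) hs4
    · rw [← add_mul, ← add_mul]
      congr 1
      linear_combination -2 * hxy
  linarith

theorem of_zero {μ ν : List ℝ} (hlen : μ.length = ν.length) (hμ : ∀ x ∈ μ, x = 0)
    (hν : ∀ x ∈ ν, 0 ≤ x ∧ x ≤ 1) : SpectrumMajorized μ ν := by
  induction μ generalizing ν with
  | nil =>
    rw [List.length_eq_zero_iff.mp hlen.symm]
    exact refl _
  | cons m μ ih =>
    cases ν with
    | nil => simp at hlen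
    | cons a ν =>
      have h0 : m = 0 := hμ m List.mem_cons_self
      subst h0
      have hν' : ∀ x ∈ ν, 0 ≤ x ∧ x ≤ 1 := fun x hx => hν x (List.mem_cons_of_mem _ hx)
      have ha := hν a List.mem_cons_self
      exact ((ih (by simpa using hlen) (fun x hx => hμ x (List.mem_cons_of_mem _ hx)) hν').cons
        le_rfl zero_le_one).trans (reduce le_rfl ha.1 ha.2 hν')

/-- After the head, find the first entry that is at most `m`; a transfer with its predecessor turns
one of the two into `m` and preserves their product. Prefixes ending before that place have all
entries at least `m`, and longer ones keep their product once `m` is counted. If no such entry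
exists, the last entry is lowered to `m`; the third alternative covers the lengths `k` that are then
out of range. -/
theorem exists_extract {m : ℝ} (hm : 0 < m) (l : List ℝ) (a : ℝ) (hma : m ≤ a)
    (ha : a ≤ 1) (hl : ∀ x ∈ l, 0 ≤ x ∧ x ≤ 1) :
    ∃ l' : List ℝ, l'.length = l.length ∧ (∀ x ∈ l', 0 ≤ x ∧ x ≤ 1) ∧
      SpectrumMajorized (m :: l') (a :: l) ∧
      ∀ k, m ^ k ≤ (l'.take k).prod ∨ m * (l'.take k).prod = ((a :: l).take (k + 1)).prod ∨
        l.length < k := by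
  induction l generalizing a with
  | nil =>
    refine ⟨[], rfl, by simp, reduce hm.le hma ha (by simp), fun k => ?_⟩
    cases k with
    | zero => simp
    | succ k => right; right; simp
  | cons b l ih =>
    have hb := hl b List.mem_cons_self
    have hl' : ∀ x ∈ l, 0 ≤ x ∧ x ≤ 1 := fun x hx => hl x (List.mem_cons_of_mem _ hx)
    rcases le_or_gt b m with hbm | hmb
    · have hy0 : 0 ≤ a * b / m := div_nonneg (mul_nonneg (by linarith) hb.1) hm.le
      have hy1 : a * b / m ≤ 1 := (div_le_one hm).mpr (by nlinarith [hb.1])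
      have hxy : m * (a * b / m) = a * b := mul_div_cancel₀ _ hm.ne'
      refine ⟨a * b / m :: l, rfl, ?_, transfer hm hy0 ha hb.1 hbm hma hxy hl', fun k => ?_⟩
      · intro x hx
        rcases List.mem_cons.mp hx with rfl | hx
        · exact ⟨hy0, hy1⟩
        · exact hl' x hx
      · cases k with
        | zero => left; simp
        | succ k =>
          right; left
          rw [List.take_succ_cons, List.take_succ_cons, List.take_succ_cons, List.prod_cons,
            List.prod_cons, List.prod_cons, ← mul_assoc, hxy, mul_assoc]
    · obtain ⟨l', h1, h2, h3, h4⟩ := ih b hmb.le hb.2 hl'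
      refine ⟨a :: l', by simp [h1], ?_, ?_, fun k => ?_⟩
      · intro x hx
        rcases List.mem_cons.mp hx with rfl | hx
        · exact ⟨by linarith, ha⟩
        · exact h2 x hx
      · exact (swap m a l').trans (h3.cons (by linarith) ha)
      · cases k with
        | zero => left; simp
        | succ k =>
          rw [List.take_succ_cons, List.take_succ_cons, List.prod_cons, List.prod_cons]
          rcases h4 k with h | h | h
          · left
            rw [pow_succ']
            exact mul_le_mul hma h (by positivity) (by linarith)
          · right; left
            rw [← h]
            ring
          · right; right
            simpa using h

/-- Weak log-majorization of the entries implies the comparison of the product spectra. -/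
theorem of_prod_take_le {μ ν : List ℝ} (hlen : μ.length = ν.length)
    (hμ : ∀ x ∈ μ, 0 ≤ x ∧ x ≤ 1) (hν : ∀ x ∈ ν, 0 ≤ x ∧ x ≤ 1)
    (hsort : μ.Pairwise (· ≥ ·))
    (h : ∀ k ≤ μ.length, (μ.take k).prod ≤ (ν.take k).prod) : SpectrumMajorized μ ν := by
  induction μ generalizing ν with
  | nil =>
    rw [List.length_eq_zero_iff.mp hlen.symm]
    exact refl _
  | cons m μ ih =>
    cases ν with
    | nil => simp at hlen
    | cons a ν =>
      have hm := hμ m List.mem_cons_self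
      obtain ⟨hs1, hs2⟩ := List.pairwise_cons.mp hsort
      have hμ' : ∀ x ∈ μ, 0 ≤ x ∧ x ≤ 1 := fun x hx => hμ x (List.mem_cons_of_mem _ hx)
      have hν' : ∀ x ∈ ν, 0 ≤ x ∧ x ≤ 1 := fun x hx => hν x (List.mem_cons_of_mem _ hx)
      have ha := hν a List.mem_cons_self
      rcases eq_or_lt_of_le hm.1 with h0 | hpos
      -- The list is sorted and nonnegative, so a zero head makes it identically zero.
      · refine of_zero hlen (fun x hx => ?_) hν
        rcases List.mem_cons.mp hx with rfl | hx
        · exact h0.symm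
        · exact le_antisymm (h0 ▸ hs1 x hx) (hμ' x hx).1
      · have hma : m ≤ a := by simpa using h 1 (by simp)
        obtain ⟨l', e1, e2, e3, e4⟩ := exists_extract hpos ν a hma ha.2 hν'
        have hlen' : μ.length = ν.length := by simpa using hlen
        refine SpectrumMajorized.trans
          ((ih (hlen'.trans e1.symm) hμ' e2 hs2 fun k hk => ?_).cons hm.1 hm.2) e3
        rcases e4 k with e | e | e
        -- Every later entry of the sorted list is at most its head `m`, hence a prefix product of
        -- length `k` is at most `m ^ k`.
        · refine le_trans ?_ e
          have hk' : (μ.take k).length = k := List.length_take_of_le hk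
          conv_rhs => rw [← hk']
          have : ∀ l : List ℝ, (∀ x ∈ l, 0 ≤ x ∧ x ≤ m) → l.prod ≤ m ^ l.length := by
            intro l
            induction l with
            | nil => simp
            | cons x l ihl =>
              intro hx
              rw [List.prod_cons, List.length_cons, pow_succ']
              have hx1 := hx x List.mem_cons_self
              have hx2 : ∀ y ∈ l, 0 ≤ y ∧ y ≤ m := fun y hy => hx y (List.mem_cons_of_mem _ hy)
              exact mul_le_mul hx1.2 (ihl hx2) (List.prod_nonneg fun y hy => (hx2 y hy).1) hm.1
          exact this _ fun x hx =>
            ⟨(hμ' x (List.mem_of_mem_take hx)).1, hs1 x (List.mem_of_mem_take hx)⟩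
        · have hk1 := h (k + 1) (by simpa using hk)
          rw [← e, List.take_succ_cons, List.prod_cons] at hk1
          exact le_of_mul_le_mul_left hk1 hpos
        · omega

end SpectrumMajorized

/-! ### Consequences for majorization and Rényi entropies -/

theorem IsState.spec_nonneg {n : ℕ} {ρ : QubitOp n} (h : IsState ρ)
    (j : Fin (Fintype.card (Fin n → Fin 2))) : 0 ≤ h.spec j := by
  have h1 := h.posSemidef.eigenvalues_nonneg
    ((Fintype.equivOfCardEq (Fintype.card_fin (Fintype.card (Fin n → Fin 2)))) j)
  rw [Matrix.IsHermitian.eigenvalues, Equiv.symm_apply_apply] at h1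
  exact h1

theorem IsState.sum_spec {n : ℕ} {ρ : QubitOp n} (h : IsState ρ) : ∑ j, h.spec j = 1 := by
  have h1 := trace_pow_eq_sum_eigenvalues₀ h.posSemidef.isHermitian 1
  rw [pow_one, h.trace_eq_one] at h1
  simp only [pow_one] at h1
  exact_mod_cast h1.symm

theorem IsState.rank_eq {n : ℕ} {ρ : QubitOp n} (h : IsState ρ) :
    (ρ.rank : ℝ) = ∑ j, if h.spec j = 0 then (0 : ℝ) else 1 := by
  rw [h.posSemidef.isHermitian.rank_eq_card_non_zero_eigs, Fintype.card_subtype]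
  rw [← Equiv.sum_comp (Fintype.equivOfCardEq
    (Fintype.card_fin (Fintype.card (Fin n → Fin 2)))).symm
    (fun j => if h.spec j = 0 then (0 : ℝ) else 1)]
  rw [Finset.card_filter]
  push_cast
  refine Finset.sum_congr rfl fun i _ => ?_
  rw [ite_not]
  rfl

theorem IsState.majorized_of_convex {n : ℕ} {ρ η : QubitOp n} (hρ : IsState ρ) (hη : IsState η)
    (h : ∀ f : ℝ → ℝ, ConvexOn ℝ (Set.Ici 0) f → ∑ j, f (hρ.spec j) ≤ ∑ j, f (hη.spec j)) :
    hρ.Majorized hη := by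
  refine ⟨fun k => ?_, by rw [hρ.sum_spec, hη.sum_spec]⟩
  rcases lt_or_ge k (Fintype.card (Fin n → Fin 2)) with hk | hk
  -- The threshold is the eigenvalue number `k + 1` of `η`. The positive part of `t - c` sums to
  -- exactly the first `k` differences for `η`, and to at least those for `ρ`.
  · set c := hη.spec ⟨k, hk⟩ with hc
    have h1 := h (fun t => max (t - c) 0)
      (((convexOn_id (convex_Ici 0)).sub (concaveOn_const c (convex_Ici 0))).sup
        (convexOn_const 0 (convex_Ici 0)))
    have h2 : ∑ j, max (hη.spec j - c) 0 = ∑ j with Fin.val j < k, (hη.spec j - c) := by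
      rw [Finset.sum_filter]
      refine Finset.sum_congr rfl fun j _ => ?_
      split_ifs with hj
      · exact max_eq_left (sub_nonneg.mpr (hη.spec_antitone (Fin.le_def.mpr hj.le)))
      · exact max_eq_right (sub_nonpos.mpr (hη.spec_antitone (Fin.le_def.mpr (not_lt.mp hj))))
    have h3 : ∑ j with Fin.val j < k, (hρ.spec j - c) ≤ ∑ j, max (hρ.spec j - c) 0 := by
      rw [Finset.sum_filter]
      refine Finset.sum_le_sum fun j _ => ?_
      split_ifs
      · exact le_max_left _ _
      · exact le_max_right _ _
    have h4 := h3.trans (h1.trans_eq h2)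
    rw [Finset.sum_sub_distrib, Finset.sum_sub_distrib] at h4
    linarith
  · have hf : Finset.univ.filter (fun j : Fin (Fintype.card (Fin n → Fin 2)) => Fin.val j < k)
        = Finset.univ := Finset.filter_true_of_mem fun j _ => j.2.trans_le hk
    rw [hf, hρ.sum_spec, hη.sum_spec]

/-- The jump does no harm because it sits at the endpoint of the half-line. Summed over a spectrum
this function counts zero eigenvalues, which gives the order `0`. -/
theorem convexOn_ite_eq_zero : ConvexOn ℝ (Set.Ici 0) fun t : ℝ => if t = 0 then (1 : ℝ) else 0 := by
  refine ⟨convex_Ici 0, fun x hx y hy a b ha hb hab => ?_⟩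
  simp only [smul_eq_mul, Set.mem_Ici] at *
  by_cases h : a * x + b * y = 0
  · have h1 : a * x = 0 := by nlinarith [mul_nonneg ha hx, mul_nonneg hb hy]
    have h2 : b * y = 0 := by nlinarith [mul_nonneg ha hx, mul_nonneg hb hy]
    rw [if_pos h]
    rcases mul_eq_zero.mp h1 with h1 | h1 <;> rcases mul_eq_zero.mp h2 with h2 | h2 <;>
      simp_all
  · rw [if_neg h]
    split_ifs <;> simp <;> linarith

theorem IsState.rank_le_of_convex {n : ℕ} {ρ η : QubitOp n} (hρ : IsState ρ) (hη : IsState η)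
    (h : ∀ f : ℝ → ℝ, ConvexOn ℝ (Set.Ici 0) f → ∑ j, f (hρ.spec j) ≤ ∑ j, f (hη.spec j)) :
    (η.rank : ℝ) ≤ ρ.rank := by
  have h1 := h _ convexOn_ite_eq_zero
  have h2 : ∀ t : ℝ, (if t = 0 then (0 : ℝ) else 1) = 1 - if t = 0 then (1 : ℝ) else 0 := by
    intro t; split_ifs <;> norm_num
  rw [hρ.rank_eq, hη.rank_eq]
  simp only [h2, Finset.sum_sub_distrib]
  linarith

theorem IsState.exists_spec_pos {n : ℕ} {ρ : QubitOp n} (h : IsState ρ) : ∃ j, 0 < h.spec j := by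
  by_contra! hn
  have h1 : ∑ j, h.spec j ≤ 0 := Finset.sum_nonpos fun j _ => hn j
  rw [h.sum_spec] at h1
  linarith

theorem IsState.sum_spec_rpow_pos {n : ℕ} {ρ : QubitOp n} (h : IsState ρ) (a : ℝ) :
    0 < ∑ j, h.spec j ^ a := by
  obtain ⟨j, hj⟩ := h.exists_spec_pos
  exact Finset.sum_pos' (fun i _ => Real.rpow_nonneg (h.spec_nonneg i) a)
    ⟨j, Finset.mem_univ j, Real.rpow_pos_of_pos hj a⟩

theorem IsState.renyiEntropy_le_of_convex {n : ℕ} {ρ η : QubitOp n} (hρ : IsState ρ)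
    (hη : IsState η)
    (h : ∀ f : ℝ → ℝ, ConvexOn ℝ (Set.Ici 0) f → ∑ j, f (hρ.spec j) ≤ ∑ j, f (hη.spec j))
    (α : ℝ≥0∞) : hη.renyiEntropy α ≤ hρ.renyiEntropy α := by
  have h2 : (1 : ℝ) < 2 := one_lt_two
  unfold IsState.renyiEntropy
  split_ifs with h0 h1 htop
  · refine Real.logb_le_logb_of_le h2 ?_ (hρ.rank_le_of_convex hη h)
    obtain ⟨j, hj⟩ := hη.exists_spec_pos
    rw [hη.rank_eq]
    exact Finset.sum_pos' (fun i _ => by split_ifs <;> norm_num)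
      ⟨j, Finset.mem_univ j, by rw [if_neg hj.ne']; norm_num⟩
  · refine neg_le_neg ?_
    have h3 := h _ Real.convexOn_mul_log
    simp only [Real.logb, ← mul_div_assoc, ← Finset.sum_div]
    exact div_le_div_of_nonneg_right h3 (Real.log_nonneg h2.le)
  · refine neg_le_neg ?_
    obtain ⟨j₀, hj₀⟩ := hρ.exists_spec_pos
    have hbdd : ∀ {σ : QubitOp n} (hσ : IsState σ), BddAbove (Set.range hσ.spec) :=
      fun hσ => Set.Finite.bddAbove (Set.finite_range _)
    refine Real.logb_le_logb_of_le h2 (hj₀.trans_le (le_ciSup (hbdd hρ) j₀)) ?_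
    have : Nonempty (Fin (Fintype.card (Fin n → Fin 2))) := ⟨j₀⟩
    refine ciSup_le fun j => ?_
    -- With the largest eigenvalue of `η` as threshold, the sum of positive parts vanishes for `η`,
    -- hence no eigenvalue of `ρ` exceeds it.
    set c := ⨆ j, hη.spec j with hc
    have h1 := h (fun t => max (t - c) 0)
      (((convexOn_id (convex_Ici 0)).sub (concaveOn_const c (convex_Ici 0))).sup
        (convexOn_const 0 (convex_Ici 0)))
    have h3 : ∑ j, max (hη.spec j - c) 0 = 0 := Finset.sum_eq_zero fun i _ =>
      max_eq_right (sub_nonpos.mpr (le_ciSup (hbdd hη) i))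
    have h4 : max (hρ.spec j - c) 0 ≤ ∑ j, max (hρ.spec j - c) 0 :=
      Finset.single_le_sum (f := fun j => max (hρ.spec j - c) 0)
        (fun i _ => le_max_right _ _) (Finset.mem_univ j)
    have h5 := le_max_left (hρ.spec j - c) 0
    linarith
  · have ha0 : 0 < α.toReal := ENNReal.toReal_pos h0 htop
    rcases lt_trichotomy α.toReal 1 with ha | ha | ha
    · have h3 := h _ (Real.concaveOn_rpow ha0.le ha.le).neg
      simp only [Pi.neg_apply, Finset.sum_neg_distrib, neg_le_neg_iff] at h3
      exact mul_le_mul_of_nonneg_left (Real.logb_le_logb_of_le h2 (hη.sum_spec_rpow_pos _) h3)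
        (one_div_nonneg.mpr (by linarith))
    · exact absurd ((ENNReal.toReal_eq_one_iff α).mp ha) h1
    · have h3 := h _ (convexOn_rpow ha.le)
      exact mul_le_mul_of_nonpos_left (Real.logb_le_logb_of_le h2 (hρ.sum_spec_rpow_pos _) h3)
        (one_div_nonpos.mpr (by linarith))

/-! ### The canonical form of a skew-adjoint real map -/

/-- The square of `A` is symmetric and nonzero, with eigenvalues `-‖A v‖²` at unit eigenvectors `v`.
For a nonzero eigenvalue, `v` and the normalized `A v` span an invariant plane. -/
theorem exists_eigenvector_sq_of_skew {E : Type*} [NormedAddCommGroup E] [InnerProductSpace ℝ E]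
    [FiniteDimensional ℝ E] {A : E →ₗ[ℝ] E} (hA : ∀ x y, inner ℝ (A x) y = -inner ℝ x (A y))
    (h0 : A ≠ 0) : ∃ (f g : E) (c : ℝ), 0 ≤ c ∧ inner ℝ f f = 1 ∧ inner ℝ g g = 1 ∧
      inner ℝ f g = 0 ∧ A g = c • f ∧ A f = -c • g := by
  have hS : (A ∘ₗ A).IsSymmetric := fun x y => by
    simp only [LinearMap.comp_apply]
    rw [hA, hA, neg_neg]
  obtain ⟨i, hi⟩ : ∃ i, hS.eigenvalues rfl i ≠ 0 := by
    by_contra! hall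
    apply h0
    have h1 : A ∘ₗ A = 0 := (hS.eigenvectorBasis rfl).toBasis.ext fun i => by
      simp [hS.apply_eigenvectorBasis, hall i]
    ext x
    have h2 : inner ℝ (A x) (A x) = 0 := by
      rw [hA, ← LinearMap.comp_apply, h1]
      simp
    simpa using inner_self_eq_zero.mp h2
  set v := hS.eigenvectorBasis rfl i with hv
  set κ := hS.eigenvalues rfl i with hκ
  have hAAv : A (A v) = κ • v := by
    exact hS.apply_eigenvectorBasis rfl i
  have hvv : inner ℝ v v = 1 := by
    rw [real_inner_self_eq_norm_sq, (hS.eigenvectorBasis rfl).orthonormal.1 i, one_pow]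
  have hnorm : ‖A v‖ ^ 2 = -κ := by
    rw [← real_inner_self_eq_norm_sq, hA, hAAv, inner_smul_right, hvv, mul_one]
  have hc : ‖A v‖ ≠ 0 := by
    intro h
    rw [h] at hnorm
    exact hi (by linarith)
  have hvAv : inner ℝ (A v) v = 0 := by
    have h1 := hA v v
    rw [real_inner_comm] at h1
    rw [real_inner_comm]
    linarith
  refine ⟨‖A v‖⁻¹ • A v, v, ‖A v‖, norm_nonneg _, ?_, hvv, ?_, ?_, ?_⟩
  · rw [inner_smul_left, inner_smul_right, real_inner_self_eq_norm_sq]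
    simp only [conj_trivial]
    field_simp
  · rw [inner_smul_left, hvAv, mul_zero]
  · rw [smul_smul, mul_inv_cancel₀ hc, one_smul]
  · rw [map_smul, hAAv, smul_smul]
    congr 1
    rw [← neg_neg κ, ← hnorm]
    field_simp

/-- Two families of vectors in a real inner product space that are orthonormal together. -/
structure OrthonormalPairs {E ι : Type*} [NormedAddCommGroup E] [InnerProductSpace ℝ E]
    [DecidableEq ι] (f g : ι → E) : Prop where
  left : ∀ i j, inner ℝ (f i) (f j) = if i = j then 1 else 0
  right : ∀ i j, inner ℝ (g i) (g j) = if i = j then 1 else 0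
  cross : ∀ i j, inner ℝ (f i) (g j) = 0

theorem exists_orthonormalPairs {E : Type*} [NormedAddCommGroup E] [InnerProductSpace ℝ E]
    [FiniteDimensional ℝ E] {m : ℕ} (h : 2 * m ≤ Module.finrank ℝ E) :
    ∃ f g : Fin m → E, OrthonormalPairs f g := by
  let b := stdOrthonormalBasis ℝ E
  have hb := orthonormal_iff_ite.mp b.orthonormal
  refine ⟨fun j => b ⟨j, by omega⟩, fun j => b ⟨m + j, by omega⟩,
    fun i j => ?_, fun i j => ?_, fun i j => ?_⟩
  · rw [hb]; simp [Fin.ext_iff]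
  · rw [hb]; simp [Fin.ext_iff]
  · rw [hb, if_neg]
    rw [Fin.mk.injEq]
    omega

theorem OrthonormalPairs.cons {E : Type*} [NormedAddCommGroup E] [InnerProductSpace ℝ E] {m : ℕ}
    {f g : Fin m → E} (h : OrthonormalPairs f g) {x y : E} (hx : inner ℝ x x = 1)
    (hy : inner ℝ y y = 1) (hxy : inner ℝ x y = 0) (hfx : ∀ j, inner ℝ (f j) x = 0)
    (hfy : ∀ j, inner ℝ (f j) y = 0) (hgx : ∀ j, inner ℝ (g j) x = 0)
    (hgy : ∀ j, inner ℝ (g j) y = 0) :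
    OrthonormalPairs (Fin.cons x f : Fin (m + 1) → E) (Fin.cons y g : Fin (m + 1) → E) := by
  refine ⟨fun i j => ?_, fun i j => ?_, fun i j => ?_⟩
  · refine Fin.cases ?_ (fun i => ?_) i <;> refine Fin.cases ?_ (fun j => ?_) j
    · simpa using hx
    · simpa [real_inner_comm, (Fin.succ_ne_zero j).symm] using hfx j
    · simpa using hfx i
    · simpa using h.left i j
  · refine Fin.cases ?_ (fun i => ?_) i <;> refine Fin.cases ?_ (fun j => ?_) j
    · simpa using hy
    · simpa [real_inner_comm, (Fin.succ_ne_zero j).symm] using hgy j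
    · simpa using hgy i
    · simpa using h.right i j
  · refine Fin.cases ?_ (fun i => ?_) i <;> refine Fin.cases ?_ (fun j => ?_) j
    · simpa using hxy
    · simpa [real_inner_comm] using hgx j
    · simpa using hfy i
    · simpa using h.cross i j

/-- Split off an invariant plane; by skewness its orthogonal complement is invariant too. The odd
dimension finally leaves a line, where a skew map vanishes. -/
theorem exists_skew_canonical_form (m : ℕ) {E : Type*} [NormedAddCommGroup E]
    [InnerProductSpace ℝ E] [FiniteDimensional ℝ E] (hE : Module.finrank ℝ E = 2 * m + 1)
    (A : E →ₗ[ℝ] E) (hA : ∀ x y, inner ℝ (A x) y = -inner ℝ x (A y)) :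
    ∃ (f g : Fin m → E) (c : Fin m → ℝ), OrthonormalPairs f g ∧ (∀ j, 0 ≤ c j) ∧
      ∀ x, A x = ∑ j, c j • (inner ℝ (g j) x • f j - inner ℝ (f j) x • g j) := by
  induction m generalizing E with
  | zero =>
    refine ⟨Fin.elim0, Fin.elim0, Fin.elim0,
      ⟨fun i => i.elim0, fun i => i.elim0, fun i => i.elim0⟩, fun i => i.elim0, fun x => ?_⟩
    obtain ⟨v, hv, hspan⟩ := finrank_eq_one_iff'.mp hE
    obtain ⟨a, ha⟩ := hspan (A v)
    have h1 := hA v v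
    rw [← ha, inner_smul_left, inner_smul_right] at h1
    have hvv : inner ℝ v v ≠ 0 := fun h => hv (inner_self_eq_zero.mp h)
    have ha0 : a = 0 := by
      have : a * inner ℝ v v = 0 := by simp only [conj_trivial] at h1; linarith
      exact (mul_eq_zero.mp this).resolve_right hvv
    obtain ⟨t, rfl⟩ := hspan x
    rw [map_smul, ← ha, ha0]
    simp
  | succ m ih =>
    by_cases h0 : A = 0
    · obtain ⟨f, g, hfg⟩ := exists_orthonormalPairs (E := E) (m := m + 1) (by omega)
      exact ⟨f, g, 0, hfg, fun _ => le_rfl, fun x => by simp [h0]⟩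
    · obtain ⟨x₀, y₀, c₀, hc₀, hx, hy, hxy, hAy, hAx⟩ := exists_eigenvector_sq_of_skew hA h0
      set S : Submodule ℝ E := Submodule.span ℝ (Set.range ![x₀, y₀]) with hS
      have hmem : ∀ z, z ∈ Sᗮ ↔ inner ℝ x₀ z = 0 ∧ inner ℝ y₀ z = 0 := by
        intro z
        rw [Submodule.mem_orthogonal]
        constructor
        · exact fun h => ⟨h _ (Submodule.subset_span ⟨0, rfl⟩), h _ (Submodule.subset_span ⟨1, rfl⟩)⟩
        · rintro ⟨h1, h2⟩ u hu
          induction hu using Submodule.span_induction with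
          | mem u hu => obtain ⟨i, rfl⟩ := hu; fin_cases i <;> simpa
          | zero => simp
          | add u v _ _ hu hv => rw [inner_add_left, hu, hv, add_zero]
          | smul c u _ hu => rw [inner_smul_left, hu, mul_zero]
      have hfin : Module.finrank ℝ Sᗮ = 2 * m + 1 := by
        have hon : Orthonormal ℝ ![x₀, y₀] := by
          rw [orthonormal_iff_ite]
          intro i j
          have hyx : inner ℝ y₀ x₀ = 0 := by rw [real_inner_comm, hxy]
          fin_cases i <;> fin_cases j
          exacts [hx, hxy, hyx, hy]
        have h2 : Module.finrank ℝ S = 2 := by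
          rw [hS, finrank_span_eq_card hon.linearIndependent]
          simp
        have := S.finrank_add_finrank_orthogonal
        omega
      have hinv : ∀ z ∈ Sᗮ, A z ∈ Sᗮ := by
        intro z hz
        obtain ⟨h1, h2⟩ := (hmem z).mp hz
        rw [hmem]
        constructor
        · rw [← neg_eq_zero, ← hA, hAx, inner_smul_left, h2, mul_zero]
        · rw [← neg_eq_zero, ← hA, hAy, inner_smul_left, h1, mul_zero]
      obtain ⟨f, g, c, hfg, hc, hform⟩ := ih hfin (A.restrict hinv) (fun x y => hA x y)
      have hf : ∀ j, inner ℝ x₀ (f j : E) = 0 ∧ inner ℝ y₀ (f j : E) = 0 :=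
        fun j => (hmem _).mp (f j).2
      have hg : ∀ j, inner ℝ x₀ (g j : E) = 0 ∧ inner ℝ y₀ (g j : E) = 0 :=
        fun j => (hmem _).mp (g j).2
      have hfg' : OrthonormalPairs (fun j => (f j : E)) (fun j => (g j : E)) :=
        ⟨hfg.left, hfg.right, hfg.cross⟩
      refine ⟨Fin.cons x₀ fun j => (f j : E), Fin.cons y₀ fun j => (g j : E), Fin.cons c₀ c,
        hfg'.cons hx hy hxy (fun j => (real_inner_comm _ _).trans (hf j).1)
          (fun j => (real_inner_comm _ _).trans (hf j).2)
          (fun j => (real_inner_comm _ _).trans (hg j).1)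
          (fun j => (real_inner_comm _ _).trans (hg j).2), ?_, fun x => ?_⟩
      · intro j
        refine Fin.cases hc₀ (fun j => ?_) j
        simpa using hc j
      · set y := x - inner ℝ x₀ x • x₀ - inner ℝ y₀ x • y₀ with hydef
        have hyS : y ∈ Sᗮ := by
          rw [hmem, hydef]
          simp only [inner_sub_right, inner_smul_right, hx, hy, hxy, real_inner_comm x₀ y₀]
          constructor <;> ring
        have h1 := congrArg Subtype.val (hform ⟨y, hyS⟩)
        have h2 : A x = inner ℝ x₀ x • A x₀ + inner ℝ y₀ x • A y₀ + A y := by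
          rw [hydef]; simp only [map_sub, map_smul]; abel
        have h3 : ∀ z : E, inner ℝ x₀ z = 0 → inner ℝ y₀ z = 0 → inner ℝ z y = inner ℝ z x := by
          intro z hz1 hz2
          rw [hydef, inner_sub_right, inner_sub_right, inner_smul_right, inner_smul_right,
            real_inner_comm x₀ z, hz1, real_inner_comm y₀ z, hz2]
          ring
        rw [LinearMap.restrict_apply] at h1
        simp only [Submodule.coe_sum, Submodule.coe_smul, Submodule.coe_sub, Submodule.coe_inner]
          at h1
        rw [h2, h1, hAx, hAy, Fin.sum_univ_succ]
        simp only [Fin.cons_zero, Fin.cons_succ]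
        congr 1
        · module
        · refine Finset.sum_congr rfl fun j _ => ?_
          rw [h3 _ (hg j).1 (hg j).2, h3 _ (hf j).1 (hf j).2]

theorem exists_skew_canonical_form_antitone {m : ℕ} {E : Type*} [NormedAddCommGroup E]
    [InnerProductSpace ℝ E] [FiniteDimensional ℝ E] (hE : Module.finrank ℝ E = 2 * m + 1)
    (A : E →ₗ[ℝ] E) (hA : ∀ x y, inner ℝ (A x) y = -inner ℝ x (A y)) :
    ∃ (f g : Fin m → E) (c : Fin m → ℝ), OrthonormalPairs f g ∧ (∀ j, 0 ≤ c j) ∧ Antitone c ∧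
      ∀ x, A x = ∑ j, c j • (inner ℝ (g j) x • f j - inner ℝ (f j) x • g j) := by
  obtain ⟨f, g, c, hfg, hc, h⟩ := exists_skew_canonical_form m hE A hA
  set σ := Tuple.sort fun j => -c j with hσ
  have hmono : Monotone ((fun j => -c j) ∘ σ) := Tuple.monotone_sort _
  refine ⟨f ∘ σ, g ∘ σ, c ∘ σ, ⟨fun i j => ?_, fun i j => ?_, fun i j => hfg.cross _ _⟩,
    fun j => hc _, fun i j hij => neg_le_neg_iff.mp (hmono hij), fun x => ?_⟩
  · simp [hfg.left]
  · simp [hfg.right]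
  · rw [h x, ← Equiv.sum_comp σ]
    rfl

/-! ### Conjugation by exponentials -/

section BanachAlgebra

variable {𝔸 : Type*} [NormedRing 𝔸] [NormedAlgebra ℂ 𝔸] [CompleteSpace 𝔸]

/-- The hypothesis says that `x` intertwines `K + c` with `K`, so it intertwines their exponentials.
-/
theorem exp_mul_eq_smul_mul_exp {K x : 𝔸} {c : ℂ} (h : K * x - x * K = c • x) :
    NormedSpace.exp K * x = Complex.exp c • (x * NormedSpace.exp K) := by
  have : NormedAlgebra ℚ 𝔸 := NormedAlgebra.restrictScalars ℚ ℂ 𝔸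
  have hs : SemiconjBy x (K + algebraMap ℂ 𝔸 c) K := by
    rw [SemiconjBy, mul_add, ← Algebra.commutes, ← Algebra.smul_def, ← h]
    abel
  have h1 := hs.exp_right
  rw [SemiconjBy, NormedSpace.exp_add_of_commute (Algebra.commutes' c K).symm,
    ← NormedSpace.algebraMap_exp_comm, ← Complex.exp_eq_exp_ℂ, ← Algebra.commutes,
    ← Algebra.smul_def, mul_smul_comm] at h1
  exact h1.symm

/-- The conjugate is `exp(ad K) x`, where `ad K` is the sum of the commuting left multiplication by
`K` and right multiplication by `-K`. Partial sums of the series stay in `W`, which is closed since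
it is finite-dimensional. -/
theorem exp_conj_mem (K : 𝔸) (W : Submodule ℂ 𝔸) [FiniteDimensional ℂ W]
    (hW : ∀ x ∈ W, K * x - x * K ∈ W) {x : 𝔸} (hx : x ∈ W) :
    NormedSpace.exp K * x * NormedSpace.exp (-K) ∈ W := by
  have : NormedAlgebra ℚ 𝔸 := NormedAlgebra.restrictScalars ℚ ℂ 𝔸
  have : NormedAlgebra ℚ (𝔸 →L[ℂ] 𝔸) := NormedAlgebra.restrictScalars ℚ ℂ _
  have happly : ∀ (T : 𝔸 →L[ℂ] 𝔸) (y : 𝔸),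
      HasSum (fun k => ((k.factorial : ℂ)⁻¹) • (T ^ k) y) (NormedSpace.exp T y) := fun T y => by
    have h := NormedSpace.exp_series_hasSum_exp' (𝕂 := ℂ) T
    simpa using h.mapL (ContinuousLinearMap.apply ℂ 𝔸 y)
  set P : 𝔸 →L[ℂ] 𝔸 := ContinuousLinearMap.mul ℂ 𝔸 K with hP
  set R : 𝔸 →L[ℂ] 𝔸 := (ContinuousLinearMap.mul ℂ 𝔸).flip (-K) with hR
  have hPk : ∀ k y, (P ^ k) y = K ^ k * y := by
    intro k y
    induction k with
    | zero => simp
    | succ k ih => rw [pow_succ', mul_apply_eq_comp, ih, pow_succ', mul_assoc]; rfl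
  have hRk : ∀ k y, (R ^ k) y = y * (-K) ^ k := by
    intro k y
    induction k with
    | zero => simp
    | succ k ih => rw [pow_succ', mul_apply_eq_comp, ih, pow_succ, ← mul_assoc]; rfl
  have hexpP : ∀ y, NormedSpace.exp P y = NormedSpace.exp K * y := fun y => by
    refine (happly P y).unique ?_
    have := (NormedSpace.exp_series_hasSum_exp' (𝕂 := ℂ) K).mul_right y
    simpa only [hPk, smul_mul_assoc] using this
  have hexpR : ∀ y, NormedSpace.exp R y = y * NormedSpace.exp (-K) := fun y => by
    refine (happly R y).unique ?_
    have := (NormedSpace.exp_series_hasSum_exp' (𝕂 := ℂ) (-K)).mul_left y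
    simpa only [hRk, mul_smul_comm] using this
  have hcomm : Commute R P := by
    ext y
    exact mul_assoc K y (-K)
  have h1 : NormedSpace.exp (R + P) x = NormedSpace.exp K * x * NormedSpace.exp (-K) := by
    rw [NormedSpace.exp_add_of_commute hcomm, mul_apply_eq_comp, hexpP, hexpR]
  rw [← h1]
  have hk : ∀ k, ((R + P) ^ k) x ∈ W := by
    intro k
    induction k with
    | zero => simpa using hx
    | succ k ih =>
      rw [pow_succ', mul_apply_eq_comp]
      have h2 := hW _ ih
      convert h2 using 1
      change ((R + P) ^ k) x * (-K) + K * ((R + P) ^ k) x = _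
      rw [mul_neg]
      abel
  have hclosed : IsClosed (W : Set 𝔸) := W.closed_of_finiteDimensional
  refine hclosed.mem_of_tendsto (happly (R + P) x) (Filter.Eventually.of_forall fun s => ?_)
  exact Submodule.sum_mem _ fun k _ => Submodule.smul_mem _ _ (hk k)

end BanachAlgebra

section MatrixExp

variable {N : Type*} [Fintype N] [DecidableEq N]

theorem matrix_exp_mul_eq_smul_mul_exp {K x : Matrix N N ℂ} {c : ℂ}
    (h : K * x - x * K = c • x) :
    NormedSpace.exp K * x = Complex.exp c • (x * NormedSpace.exp K) :=
  open scoped Matrix.Norms.Operator in exp_mul_eq_smul_mul_exp h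

theorem matrix_exp_conj_mem (K : Matrix N N ℂ) (W : Submodule ℂ (Matrix N N ℂ))
    (hW : ∀ x ∈ W, K * x - x * K ∈ W) {x : Matrix N N ℂ} (hx : x ∈ W) :
    NormedSpace.exp K * x * NormedSpace.exp (-K) ∈ W :=
  open scoped Matrix.Norms.Operator in exp_conj_mem K W hW hx

end MatrixExp

/-! ### Orthonormal pairs of generators -/

/-- Real coefficient vectors over the extended family of generators. -/
abbrev RealVec (n : ℕ) : Type := EuclideanSpace ℝ (Fin (2 * n + 1))

/-- A real coefficient vector as a complex one. -/
def toCoeff {n : ℕ} (x : RealVec n) : CoeffVec n := fun a => (x a : ℂ)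

theorem toCoeff_dotProduct {n : ℕ} (x y : RealVec n) :
    toCoeff x ⬝ᵥ toCoeff y = (inner ℝ x y : ℂ) := by
  simp only [dotProduct, toCoeff, PiLp.inner_apply, RCLike.inner_apply, conj_trivial]
  push_cast
  exact Finset.sum_congr rfl fun a _ => mul_comm _ _

theorem star_toCoeff {n : ℕ} (x : RealVec n) : star (toCoeff x) = toCoeff x := by
  ext a
  simp [toCoeff]

theorem toCoeff_single {n : ℕ} (a : Fin (2 * n + 1)) :
    toCoeff (EuclideanSpace.single a (1 : ℝ)) = Pi.single a 1 := by
  ext c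
  by_cases h : c = a
  · subst h; simp [toCoeff]
  · simp [toCoeff, h]

theorem toCoeff_smul {n : ℕ} (r : ℝ) (x : RealVec n) : toCoeff (r • x) = (r : ℂ) • toCoeff x := by
  ext a
  simp [toCoeff]

theorem OrthonormalPairs.orthogonalPairs {n : ℕ} {ι : Type*} [DecidableEq ι] {f g : ι → RealVec n}
    (h : OrthonormalPairs f g) :
    OrthogonalPairs (fun j => toCoeff (f j)) (fun j => toCoeff (g j)) := by
  refine ⟨fun i j hij => ?_, fun i j hij => ?_, fun i j => ?_⟩
  · rw [toCoeff_dotProduct, h.left, if_neg hij, Complex.ofReal_zero]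
  · rw [toCoeff_dotProduct, h.right, if_neg hij, Complex.ofReal_zero]
  · rw [toCoeff_dotProduct, h.cross, Complex.ofReal_zero]

/-- The Hermitian involution `-i γ(f_j) γ(g_j)` of a pair of orthonormal vectors. -/
def pairInvolution {n : ℕ} {ι : Type*} (f g : ι → RealVec n) (j : ι) : QubitOp n :=
  (-Complex.I) • cliffordPair (fun j => toCoeff (f j)) (fun j => toCoeff (g j)) j

theorem commute_mul_of_anticomm {A : Type*} [Ring A] {x a b : A} (ha : x * a = -(a * x))
    (hb : x * b = -(b * x)) : Commute x (a * b) := by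
  rw [Commute, SemiconjBy, ← mul_assoc, ha, neg_mul, mul_assoc, hb, mul_neg, neg_neg, mul_assoc]

theorem OrthonormalPairs.independentInvolutions {n : ℕ} {ι : Type*} [DecidableEq ι]
    {f g : ι → RealVec n} (h : OrthonormalPairs f g) :
    IndependentInvolutions (pairInvolution f g) := by
  have hl : ∀ i j, i ≠ j → cliffordLin n (toCoeff (f i)) * cliffordLin n (toCoeff (f j)) =
      -(cliffordLin n (toCoeff (f j)) * cliffordLin n (toCoeff (f i))) := fun i j hij =>
    cliffordLin_anticomm (h.orthogonalPairs.left i j hij)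
  have hr : ∀ i j, i ≠ j → cliffordLin n (toCoeff (g i)) * cliffordLin n (toCoeff (g j)) =
      -(cliffordLin n (toCoeff (g j)) * cliffordLin n (toCoeff (g i))) := fun i j hij =>
    cliffordLin_anticomm (h.orthogonalPairs.right i j hij)
  have hc : ∀ i j, cliffordLin n (toCoeff (f i)) * cliffordLin n (toCoeff (g j)) =
      -(cliffordLin n (toCoeff (g j)) * cliffordLin n (toCoeff (f i))) := fun i j =>
    cliffordLin_anticomm (h.orthogonalPairs.cross i j)
  have hc' : ∀ i j, cliffordLin n (toCoeff (g i)) * cliffordLin n (toCoeff (f j)) =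
      -(cliffordLin n (toCoeff (f j)) * cliffordLin n (toCoeff (g i))) := fun i j => by
    rw [hc, neg_neg]
  have hff : ∀ i, cliffordLin n (toCoeff (f i)) * cliffordLin n (toCoeff (f i)) = 1 := fun i => by
    rw [cliffordLin_mul_self, toCoeff_dotProduct, h.left, if_pos rfl, Complex.ofReal_one, one_smul]
  have hgg : ∀ i, cliffordLin n (toCoeff (g i)) * cliffordLin n (toCoeff (g i)) = 1 := fun i => by
    rw [cliffordLin_mul_self, toCoeff_dotProduct, h.right, if_pos rfl, Complex.ofReal_one, one_smul]
  have hmul : ∀ j, pairInvolution f g j * pairInvolution f g j = 1 := fun j => by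
    have e : cliffordLin n (toCoeff (f j)) * cliffordLin n (toCoeff (g j)) *
        (cliffordLin n (toCoeff (f j)) * cliffordLin n (toCoeff (g j))) = -1 := by
      calc _ = cliffordLin n (toCoeff (f j)) *
            (cliffordLin n (toCoeff (g j)) * cliffordLin n (toCoeff (f j))) *
            cliffordLin n (toCoeff (g j)) := by simp only [mul_assoc]
        _ = -((cliffordLin n (toCoeff (f j)) * cliffordLin n (toCoeff (f j))) *
            (cliffordLin n (toCoeff (g j)) * cliffordLin n (toCoeff (g j)))) := by
          rw [hc']; noncomm_ring
        _ = -1 := by rw [hff, hgg, mul_one]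
    rw [pairInvolution, smul_mul_smul_comm, cliffordPair, e]
    simp
  -- The flip of the involution number `j` is the Clifford vector of `f j` itself: it anticommutes
  -- with its partner and passes through any other pair with two sign changes.
  refine ⟨fun j => ?_, hmul, fun i j => ?_, fun j => ⟨cliffordLin n (toCoeff (f j)), hff j, ?_, ?_⟩⟩
  · rw [pairInvolution, conjTranspose_smul, cliffordPair, conjTranspose_mul,
      cliffordLin_conjTranspose, cliffordLin_conjTranspose, star_toCoeff, star_toCoeff, hc' j j]
    simp
  · by_cases hij : i = j
    · rw [hij]
    · refine ((Commute.mul_left ?_ ?_).smul_left _).smul_right _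
      · exact commute_mul_of_anticomm (hl i j hij) (hc i j)
      · exact commute_mul_of_anticomm (hc' i j) (hr i j hij)
  · rw [pairInvolution, mul_smul_comm, smul_mul_assoc, cliffordPair, mul_assoc, hc' j j, mul_neg,
      smul_neg, neg_neg]
  · exact fun i hij => (commute_mul_of_anticomm (hl j i hij.symm) (hc j i)).smul_right _

theorem conj_affineProd {A ι : Type*} [Ring A] [Algebra ℂ A] {U V : A} (hVU : V * U = 1)
    (hUV : U * V = 1) (Z : ι → A) (α β : ι → ℂ) (L : List ι) :
    U * affineProd Z α β L * V = affineProd (fun j => U * Z j * V) α β L := by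
  induction L with
  | nil => rw [affineProd_nil, affineProd_nil, mul_one, hUV]
  | cons i L ih =>
    rw [affineProd_cons, affineProd_cons, ← ih]
    have e : U * ((α i • (1 : A) + β i • Z i) * affineProd Z α β L) * V =
        (U * (α i • (1 : A) + β i • Z i) * V) * (U * affineProd Z α β L * V) := by
      simp only [mul_assoc]
      rw [← mul_assoc V U, hVU, one_mul]
    rw [e]
    congr 1
    rw [mul_add, add_mul, mul_smul_comm, mul_smul_comm, smul_mul_assoc, smul_mul_assoc, mul_one, hUV]

theorem conj_productState {n : ℕ} {U V : QubitOp n} (hVU : V * U = 1) (hUV : U * V = 1)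
    (Z : Fin n → QubitOp n) (μ : Fin n → ℝ) :
    U * productState Z μ * V = productState (fun j => U * Z j * V) μ := by
  rw [productState, productState, mul_smul_comm, smul_mul_assoc, conj_affineProd hVU hUV]

/-! ### The standard Gaussian operator as a product -/

/-- The operator `σ^z` on a single qubit. -/
def qubitZ {n : ℕ} (j : Fin n) : QubitOp n := tensor fun k => if k = j then pauliZ else 1

theorem tensor_update {n : ℕ} (j : Fin n) (a b : ℂ) :
    (tensor fun k => if k = j then a • 1 + b • pauliZ else 1 : QubitOp n) =
      a • (1 : QubitOp n) + b • qubitZ j := by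
  have h : ∀ B : Matrix (Fin 2) (Fin 2) ℂ, ∀ x y : Fin n → Fin 2,
      (tensor fun k => if k = j then B else 1 : QubitOp n) x y =
        B (x j) (y j) * ∏ k ∈ Finset.univ.erase j, (1 : Matrix (Fin 2) (Fin 2) ℂ) (x k) (y k) := by
    intro B x y
    rw [tensor, Matrix.of_apply, ← Finset.mul_prod_erase _ _ (Finset.mem_univ j), if_pos rfl]
    congr 1
    refine Finset.prod_congr rfl fun k hk => ?_
    rw [if_neg (Finset.ne_of_mem_erase hk)]
  have h1 : (1 : QubitOp n) = tensor fun k => if k = j then 1 else 1 := by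
    simp [tensor_one]
  ext x y
  rw [qubitZ, h1]
  simp only [Matrix.add_apply, Matrix.smul_apply, h, smul_eq_mul]
  ring

theorem affineProd_qubitZ {n : ℕ} (l : Fin n → ℂ) {L : List (Fin n)} (hL : L.Nodup) :
    affineProd qubitZ 1 l L = tensor fun k => if k ∈ L then 1 + l k • pauliZ else 1 := by
  induction L with
  | nil => simp [affineProd_nil, tensor_one]
  | cons i L ih =>
    obtain ⟨hi, hL'⟩ := List.nodup_cons.mp hL
    rw [affineProd_cons, ih hL', ← tensor_update, tensor_mul]
    congr 1
    funext k
    by_cases hk : k = i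
    · subst hk
      simp [hi]
    · simp [hk]

theorem standardGaussian_eq {n : ℕ} (l : Fin n → ℝ) :
    standardGaussian l = productState qubitZ l := by
  rw [standardGaussian, productState, affineProd_qubitZ _ (List.nodup_finRange n)]
  simp

/-- The index of the first generator of a qubit. -/
def genFst {n : ℕ} (j : Fin n) : Fin (2 * n + 1) := ⟨2 * j + 1, by omega⟩

/-- The index of the second generator of a qubit. -/
def genSnd {n : ℕ} (j : Fin n) : Fin (2 * n + 1) := ⟨2 * j + 2, by omega⟩

/-- The Jordan–Wigner strings on earlier qubits square to 1, and `σ^x σ^y = i σ^z`. Indices are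
shifted by one because `0` denotes the parity. -/
theorem qubitZ_eq {n : ℕ} (j : Fin n) :
    qubitZ j = (-Complex.I) • ((cliffordGen (genFst j) : QubitOp n) * cliffordGen (genSnd j)) := by
  have h1 : genFst j = (⟨2 * j, by omega⟩ : Fin (2 * n)).succ := rfl
  have h2 : genSnd j = (⟨2 * j + 1, by omega⟩ : Fin (2 * n)).succ := rfl
  rw [h1, h2, cliffordGen_succ_mul_succ, majorana, majorana, tensor_mul]
  have h3 : ∀ k : Fin n, majoranaFactor (2 * j) k * majoranaFactor (2 * j + 1) k =
      (if k = j then Complex.I else 1) • (if k = j then pauliZ else 1) := by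
    intro k
    have e1 : 2 * (j : ℕ) / 2 = j := by omega
    have e2 : (2 * (j : ℕ) + 1) / 2 = j := by omega
    have e3 : (2 * (j : ℕ)) % 2 = 0 := by omega
    have e4 : (2 * (j : ℕ) + 1) % 2 = 1 := by omega
    rcases lt_trichotomy k j with h | h | h
    · have h' : (k : ℕ) < j := h
      simp only [majoranaFactor, e1, e2, if_pos h', if_neg h.ne, pauliZ_mul_self, one_smul]
    · subst h
      simp only [majoranaFactor, e1, e2, e3, e4, lt_irrefl, if_true, if_false, one_ne_zero]
      ext a b
      fin_cases a <;> fin_cases b <;> simp [pauliX, pauliY, pauliZ]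
    · have h' : ¬ (k : ℕ) < j := not_lt.mpr (le_of_lt h)
      have h'' : ¬ (k : ℕ) = j := fun e => h.ne' (Fin.ext e)
      simp only [majoranaFactor, e1, e2, if_neg h', if_neg h'', if_neg h.ne', mul_one, one_smul]
  simp only [h3, tensor_smul]
  rw [Finset.prod_ite_eq' Finset.univ j, if_pos (Finset.mem_univ j), smul_smul, qubitZ]
  simp

/-! ### Gaussian states as product states of orthonormal pairs -/

theorem cliffordLin_injective (n : ℕ) : Function.Injective (cliffordLin n) := by
  rw [← LinearMap.ker_eq_bot, LinearMap.ker_eq_bot']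
  intro v hv
  ext a
  have h := cliffordLin_mul_add_mul v (Pi.single a 1)
  rw [hv, zero_mul, mul_zero, add_zero, dotProduct_single_one] at h
  have h2 : (2 : ℂ) * v a = 0 := by
    by_contra hne
    exact one_ne_zero ((smul_eq_zero.mp h.symm).resolve_left hne)
  simpa using h2

/-- By the Clifford relation, `[xy, v] = x{y, v} - {x, v}y` is again linear, since anticommutators
of vectors are scalars. -/
theorem commutator_mem_range_cliffordLin {n : ℕ} {K : QubitOp n}
    (hK : K ∈ Submodule.span ℂ (Set.range fun ab : Fin (2 * n + 1) × Fin (2 * n + 1) =>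
      (cliffordGen ab.1 : QubitOp n) * cliffordGen ab.2)) :
    ∀ x ∈ LinearMap.range (cliffordLin n), K * x - x * K ∈ LinearMap.range (cliffordLin n) := by
  rintro _ ⟨v, rfl⟩
  induction hK using Submodule.span_induction with
  | mem K hK =>
    obtain ⟨⟨a, c⟩, rfl⟩ := hK
    simp only
    rw [← cliffordLin_single a, ← cliffordLin_single c]
    set x : CoeffVec n := Pi.single a 1
    set y : CoeffVec n := Pi.single c 1
    have h1 := cliffordLin_mul_add_mul y v
    have h2 := cliffordLin_mul_add_mul x v
    have e : cliffordLin n x * cliffordLin n y * cliffordLin n v -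
        cliffordLin n v * (cliffordLin n x * cliffordLin n y) =
        cliffordLin n x * (cliffordLin n y * cliffordLin n v + cliffordLin n v * cliffordLin n y) -
        (cliffordLin n x * cliffordLin n v + cliffordLin n v * cliffordLin n x) *
          cliffordLin n y := by noncomm_ring
    rw [e, h1, h2, mul_smul_comm, smul_mul_assoc, mul_one, one_mul]
    exact Submodule.sub_mem _ (Submodule.smul_mem _ _ ⟨x, rfl⟩) (Submodule.smul_mem _ _ ⟨y, rfl⟩)
  | zero => simp
  | add X Y _ _ hX hY =>
    have e : (X + Y) * cliffordLin n v - cliffordLin n v * (X + Y) =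
      (X * cliffordLin n v - cliffordLin n v * X) + (Y * cliffordLin n v - cliffordLin n v * Y) := by
      noncomm_ring
    rw [e]
    exact Submodule.add_mem _ hX hY
  | smul c X _ hX =>
    rw [smul_mul_assoc, mul_smul_comm, ← smul_sub]
    exact Submodule.smul_mem _ _ hX

/-- Hermiticity of the conjugated generators makes their coefficients real, and the preserved
anticommutators make the coefficient vectors orthonormal. -/
theorem conj_cliffordGen_eq {n : ℕ} {U : QubitOp n} (hU : Uᴴ * U = 1) (hU' : U * Uᴴ = 1)
    (hW : ∀ x ∈ LinearMap.range (cliffordLin n), U * x * Uᴴ ∈ LinearMap.range (cliffordLin n)) :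
    ∃ o : Fin (2 * n + 1) → RealVec n, (∀ a, U * cliffordGen a * Uᴴ = cliffordLin n (toCoeff (o a)))
      ∧ ∀ a c, inner ℝ (o a) (o c) = if a = c then 1 else 0 := by
  have h1 : ∀ a, ∃ v, cliffordLin n v = U * cliffordGen a * Uᴴ := fun a =>
    hW _ ⟨Pi.single a 1, cliffordLin_single a⟩
  choose v hv using h1
  have hreal : ∀ a, star (v a) = v a := fun a => by
    apply cliffordLin_injective n
    rw [← cliffordLin_conjTranspose, hv, conjTranspose_mul, conjTranspose_mul,
      conjTranspose_conjTranspose, cliffordGen_conjTranspose, mul_assoc]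
  let o : Fin (2 * n + 1) → RealVec n := fun a => WithLp.toLp 2 fun c => (v a c).re
  have ho : ∀ a, toCoeff (o a) = v a := fun a => by
    ext c
    have := congrFun (hreal a) c
    exact Complex.conj_eq_iff_re.mp this
  refine ⟨o, fun a => by rw [ho, hv], fun a c => ?_⟩
  have h2 := cliffordLin_mul_add_mul (v a) (v c)
  have h3 := cliffordLin_mul_add_mul (n := n) (Pi.single a 1) (Pi.single c 1)
  rw [cliffordLin_single, cliffordLin_single] at h3
  have h4 : ∀ X Y : QubitOp n, (U * X * Uᴴ) * (U * Y * Uᴴ) = U * (X * Y) * Uᴴ := fun X Y => by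
    simp only [mul_assoc]
    rw [← mul_assoc Uᴴ U, hU, one_mul]
  rw [hv, hv, h4, h4, ← add_mul, ← mul_add, h3, mul_smul_comm, smul_mul_assoc, mul_one, hU'] at h2
  have h5 : (2 : ℂ) * (Pi.single a 1 : CoeffVec n) ⬝ᵥ Pi.single c 1 = 2 * v a ⬝ᵥ v c :=
    smul_left_injective ℂ (one_ne_zero : (1 : QubitOp n) ≠ 0) h2
  have h6 := mul_left_cancel₀ two_ne_zero h5
  rw [← ho a, ← ho c, toCoeff_dotProduct, dotProduct_single_one, Pi.single_apply] at h6
  rw [← Complex.ofReal_inj, ← h6]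
  split_ifs with h7 h8 h8
  · simp
  · exact absurd h7.symm h8
  · exact absurd h8.symm h7
  · simp

theorem skew_of_isHermitian {n : ℕ} {H₁ H₂ : QubitOp n} (h₁ : H₁.IsHermitian)
    (h₂ : H₂.IsHermitian) :
    (Complex.I • H₂ + Complex.I • H₁)ᴴ = -(Complex.I • H₂ + Complex.I • H₁) := by
  rw [conjTranspose_add, conjTranspose_smul, conjTranspose_smul, h₁.eq, h₂.eq]
  simp [add_comm]

theorem exp_conjTranspose_of_skew {n : ℕ} {K : QubitOp n} (hK : Kᴴ = -K) :
    (NormedSpace.exp K)ᴴ = NormedSpace.exp (-K) ∧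
      (NormedSpace.exp K)ᴴ * NormedSpace.exp K = 1 ∧
      NormedSpace.exp K * (NormedSpace.exp K)ᴴ = 1 := by
  have h1 : (NormedSpace.exp K)ᴴ = NormedSpace.exp (-K) := by
    rw [← Matrix.exp_conjTranspose, hK]
  refine ⟨h1, ?_, ?_⟩
  · rw [h1, ← Matrix.exp_add_of_commute _ _ (Commute.refl K).neg_left, neg_add_cancel,
      NormedSpace.exp_zero]
  · rw [h1, ← Matrix.exp_add_of_commute _ _ (Commute.refl K).neg_right, add_neg_cancel,
      NormedSpace.exp_zero]

theorem generator_mem_span {n : ℕ} {H₁ H₂ : QubitOp n}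
    (h₂ : H₂ ∈ Submodule.span ℂ
      (Set.range fun pq : Fin (2 * n) × Fin (2 * n) => majorana pq.1 * majorana pq.2))
    (h₁ : H₁ ∈ Submodule.span ℂ (Set.range fun p : Fin (2 * n) => majorana p)) :
    Complex.I • H₂ + Complex.I • H₁ ∈
      Submodule.span ℂ (Set.range fun ab : Fin (2 * n + 1) × Fin (2 * n + 1) =>
        (cliffordGen ab.1 : QubitOp n) * cliffordGen ab.2) := by
  refine Submodule.add_mem _ (Submodule.smul_mem _ _ ?_) (Submodule.smul_mem _ _ ?_)
  · refine (Submodule.span_le.mpr ?_) h₂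
    rintro _ ⟨⟨p, q⟩, rfl⟩
    exact Submodule.subset_span ⟨(p.succ, q.succ), cliffordGen_succ_mul_succ p q⟩
  · refine (Submodule.span_le.mpr ?_) h₁
    rintro _ ⟨p, rfl⟩
    simp only [majorana_eq_cliffordGen, SetLike.mem_coe]
    exact Submodule.smul_mem _ _ (Submodule.subset_span ⟨(0, p.succ), rfl⟩)

theorem genFst_inj {n : ℕ} {i j : Fin n} : genFst i = genFst j ↔ i = j := by
  simp [genFst, Fin.ext_iff]

theorem genSnd_inj {n : ℕ} {i j : Fin n} : genSnd i = genSnd j ↔ i = j := by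
  simp [genSnd, Fin.ext_iff]

theorem genFst_ne_genSnd {n : ℕ} (i j : Fin n) : genFst i ≠ genSnd j := by
  simp only [genFst, genSnd, ne_eq, Fin.mk.injEq]
  omega

theorem IsGaussian.exists_productState {n : ℕ} {ρ : QubitOp n} (h : IsGaussian ρ) :
    ∃ (f g : Fin n → RealVec n) (l : Fin n → ℝ), OrthonormalPairs f g ∧
      ρ = productState (pairInvolution f g) l := by
  obtain ⟨_, l, H₂, H₁, h₂, hs₂, h₁, hs₁, rfl⟩ := h
  set K := Complex.I • H₂ + Complex.I • H₁ with hK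
  obtain ⟨e1, e2, e3⟩ := exp_conjTranspose_of_skew (skew_of_isHermitian h₁ h₂)
  rw [← hK] at e1 e2 e3
  obtain ⟨o, ho, hon⟩ := conj_cliffordGen_eq e2 e3 (fun x hx => by
    rw [e1]
    exact matrix_exp_conj_mem K _ (commutator_mem_range_cliffordLin (generator_mem_span hs₂ hs₁)) hx)
  refine ⟨fun j => o (genFst j), fun j => o (genSnd j), l,
    ⟨fun i j => ?_, fun i j => ?_, fun i j => ?_⟩, ?_⟩
  · simp only [hon, genFst_inj]
  · simp only [hon, genSnd_inj]
  · simp only [hon, if_neg (genFst_ne_genSnd i j)]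
  · rw [standardGaussian_eq, conj_productState e2 e3]
    congr 1
    funext j
    rw [qubitZ_eq, mul_smul_comm, smul_mul_assoc, pairInvolution, cliffordPair, ← ho, ← ho]
    congr 1
    simp only [mul_assoc]
    rw [← mul_assoc _ᴴ (NormedSpace.exp K), e2, one_mul]

/-! ### The optimal state is Gaussian -/

/-- The index of the first generator in a pair of the optimal state. -/
def evenGen {n : ℕ} (j : Fin n) : Fin (2 * n + 1) := ⟨2 * j, by omega⟩

/-- The index of the second generator in a pair of the optimal state. -/
def oddGen {n : ℕ} (j : Fin n) : Fin (2 * n + 1) := ⟨2 * j + 1, by omega⟩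

/-- The sign of a pair of the optimal state. -/
def starSign {n : ℕ} (j : Fin n) : ℝ := if (j : ℕ) = 0 then -1 else 1

theorem starSign_mul_self {n : ℕ} (j : Fin n) : starSign j * starSign j = 1 := by
  unfold starSign
  split_ifs <;> norm_num

/-- The first vectors of the orthonormal pairs of the optimal state. -/
def starFst {n : ℕ} (j : Fin n) : RealVec n :=
  starSign j • EuclideanSpace.single (evenGen j) 1

/-- The second vectors of the orthonormal pairs of the optimal state. -/
def starSnd {n : ℕ} (j : Fin n) : RealVec n := EuclideanSpace.single (oddGen j) 1

theorem inner_single_one_single_one {n : ℕ} (a c : Fin (2 * n + 1)) :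
    inner ℝ (EuclideanSpace.single a (1 : ℝ)) (EuclideanSpace.single c (1 : ℝ)) =
      if a = c then (1 : ℝ) else 0 := by
  rw [EuclideanSpace.inner_single_left]
  simp

theorem orthonormalPairs_star (n : ℕ) :
    OrthonormalPairs (starFst : Fin n → RealVec n) starSnd := by
  refine ⟨fun i j => ?_, fun i j => ?_, fun i j => ?_⟩
  · rw [starFst, starFst, inner_smul_left, inner_smul_right]
    by_cases h : i = j
    · subst h
      simp [starSign_mul_self]
    · have h' : evenGen i ≠ evenGen j := by
        simp only [evenGen, ne_eq, Fin.mk.injEq]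
        omega
      simp [inner_single_one_single_one, h, h']
  · by_cases h : i = j
    · subst h
      simp [starSnd]
    · have h' : oddGen i ≠ oddGen j := by
        simp only [oddGen, ne_eq, Fin.mk.injEq]
        omega
      simp [starSnd, inner_single_one_single_one, h, h']
  · have h' : evenGen i ≠ oddGen j := by
      simp only [evenGen, oddGen, ne_eq, Fin.mk.injEq]
      omega
    simp [starFst, starSnd, inner_smul_left, inner_single_one_single_one, h']

theorem pairInvolution_star {n : ℕ} (j : Fin n) :
    pairInvolution starFst starSnd j =
      (-Complex.I * starSign j) • ((cliffordGen (evenGen j) : QubitOp n) * cliffordGen (oddGen j)) := by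
  rw [pairInvolution, cliffordPair, starFst, starSnd, toCoeff_smul, toCoeff_single, toCoeff_single,
    map_smul, cliffordLin_single, cliffordLin_single, smul_mul_assoc, smul_smul]

/-- The factor with `ĉ_1 = i γ_0 γ_1` has the sign opposite to that of the factors with `-i γ_{2j}
γ_{2j+1}`, which `starSign` corrects. -/
theorem rhoStar_eq {n : ℕ} (hn : 1 ≤ n) :
    rhoStar n hn = productState (pairInvolution starFst starSnd) 1 := by
  obtain ⟨k, rfl⟩ : ∃ k, n = k + 1 := ⟨n - 1, by omega⟩
  rw [rhoStar, productState, List.finRange_succ, affineProd_cons, affineProd]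
  congr 2
  · rw [pairInvolution_star, majorana_eq_cliffordGen]
    simp [starSign, evenGen, oddGen]
  · rw [List.map_map, ← List.ofFn_eq_map]
    congr 1
    refine congrArg List.ofFn (funext fun j => ?_)
    rw [← cliffordGen_succ_mul_succ, Function.comp_apply, pairInvolution_star]
    have e1 : starSign (Fin.succ j) = 1 := by simp [starSign]
    rw [e1]
    have e2 : evenGen (Fin.succ j) = Fin.succ (⟨2 * j + 1, by omega⟩ : Fin (2 * (k + 1))) := by
      simp only [evenGen, Fin.ext_iff, Fin.val_succ]
      omega
    have e3 : oddGen (Fin.succ j) = Fin.succ (⟨2 * j + 2, by omega⟩ : Fin (2 * (k + 1))) := by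
      simp only [oddGen, Fin.ext_iff, Fin.val_succ]
      omega
    rw [e2, e3]
    simp [sub_eq_add_neg]

/-- The combinations `x ± i y` are eigenvectors of the commutator with eigenvalues `± i π / 2`, so
conjugation by the exponential is a quarter turn in their plane. -/
theorem exp_mul_of_rotation {N : Type*} [Fintype N] [DecidableEq N] {K x y : Matrix N N ℂ}
    (hx : K * x - x * K = -((Real.pi / 2 : ℂ) • y)) (hy : K * y - y * K = (Real.pi / 2 : ℂ) • x) :
    NormedSpace.exp K * x = -(y * NormedSpace.exp K) ∧
      NormedSpace.exp K * y = x * NormedSpace.exp K := by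
  have h1 : K * (x + Complex.I • y) - (x + Complex.I • y) * K =
      (Real.pi / 2 * Complex.I : ℂ) • (x + Complex.I • y) := by
    have e : K * (x + Complex.I • y) - (x + Complex.I • y) * K =
        (K * x - x * K) + Complex.I • (K * y - y * K) := by
      rw [mul_add, add_mul, mul_smul_comm, smul_mul_assoc, smul_sub]; abel
    rw [e, hx, hy, smul_add, smul_smul, smul_smul, mul_assoc _ Complex.I, Complex.I_mul_I,
      mul_comm Complex.I]
    module
  have h2 : K * (x - Complex.I • y) - (x - Complex.I • y) * K =
      (-(Real.pi / 2) * Complex.I : ℂ) • (x - Complex.I • y) := by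
    have e : K * (x - Complex.I • y) - (x - Complex.I • y) * K =
        (K * x - x * K) - Complex.I • (K * y - y * K) := by
      rw [mul_sub, sub_mul, mul_smul_comm, smul_mul_assoc, smul_sub]; abel
    rw [e, hx, hy, smul_sub, smul_smul, smul_smul, mul_assoc _ Complex.I, Complex.I_mul_I,
      mul_comm Complex.I]
    module
  have h3 := matrix_exp_mul_eq_smul_mul_exp h1
  have h4 := matrix_exp_mul_eq_smul_mul_exp h2
  rw [Complex.exp_pi_div_two_mul_I] at h3
  rw [← neg_div, Complex.exp_neg_pi_div_two_mul_I] at h4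
  set U := NormedSpace.exp K
  rw [mul_add, add_mul, mul_smul_comm, smul_mul_assoc] at h3
  rw [mul_sub, sub_mul, mul_smul_comm, smul_mul_assoc] at h4
  have hI : ∀ z : Matrix N N ℂ, Complex.I • Complex.I • z = -z := fun z => by
    rw [smul_smul, Complex.I_mul_I, neg_one_smul]
  constructor
  · have h5 : (2 : ℂ) • (U * x) = (2 : ℂ) • -(y * U) := by
      have := congrArg₂ (· + ·) h3 h4
      simp only [smul_add, smul_sub, neg_smul, hI] at this
      rw [two_smul, two_smul]
      refine (Eq.trans ?_ this).trans ?_ <;> module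
    exact smul_right_injective _ (two_ne_zero : (2 : ℂ) ≠ 0) h5
  · have h5 : (2 * Complex.I : ℂ) • (U * y) = (2 * Complex.I : ℂ) • (x * U) := by
      have := congrArg₂ (· - ·) h3 h4
      simp only [smul_add, smul_sub, neg_smul, hI] at this
      rw [mul_smul, two_smul, mul_smul, two_smul]
      refine (Eq.trans ?_ this).trans ?_ <;> module
    exact smul_right_injective _ (mul_ne_zero two_ne_zero Complex.I_ne_zero : (2 * Complex.I : ℂ) ≠ 0) h5

theorem commutator_cliffordGen_mul {n : ℕ} (a c d : Fin (2 * n + 1)) :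
    (cliffordGen a * cliffordGen c * cliffordGen d -
      cliffordGen d * (cliffordGen a * cliffordGen c) : QubitOp n) =
      (if c = d then (2 : ℂ) • cliffordGen a else 0) -
        (if a = d then (2 : ℂ) • cliffordGen c else 0) := by
  have h : ∀ a b : Fin (2 * n + 1), (cliffordGen a : QubitOp n) * cliffordGen b +
      cliffordGen b * cliffordGen a = if a = b then (2 : ℂ) • 1 else 0 := by
    intro a b
    split_ifs with h
    · subst h
      rw [cliffordGen_mul_self, two_smul]
    · rw [cliffordGen_anticomm h, neg_add_cancel]
  have e : (cliffordGen a * cliffordGen c * cliffordGen d -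
      cliffordGen d * (cliffordGen a * cliffordGen c) : QubitOp n) =
      cliffordGen a * (cliffordGen c * cliffordGen d + cliffordGen d * cliffordGen c) -
      (cliffordGen a * cliffordGen d + cliffordGen d * cliffordGen a) * cliffordGen c := by
    noncomm_ring
  rw [e, h, h]
  split_ifs <;> simp

/-- The generator of the rotation that maps the generator with index `a` to plus or minus the
generator with index `2n - a`. -/
def reversalGen (n : ℕ) : QubitOp n :=
  (Real.pi / 4 : ℂ) • ∑ a : Fin (2 * n + 1),
    if (a : ℕ) < n then cliffordGen a * cliffordGen a.rev else 0

/-- At most the summands indexed by `d` and by its mirror image contribute; the factor 2 from the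
anticommutator turns the `π / 4` into the quarter-turn angle. -/
theorem commutator_reversalGen {n : ℕ} (d : Fin (2 * n + 1)) :
    reversalGen n * cliffordGen d - cliffordGen d * reversalGen n =
      (Real.pi / 2 : ℂ) • ((if (d.rev : ℕ) < n then cliffordGen d.rev else 0) -
        (if (d : ℕ) < n then cliffordGen d.rev else 0)) := by
  have h1 : ∀ a : Fin (2 * n + 1),
      ((if (a : ℕ) < n then cliffordGen a * cliffordGen a.rev else 0 : QubitOp n) * cliffordGen d -
        cliffordGen d * (if (a : ℕ) < n then cliffordGen a * cliffordGen a.rev else 0)) =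
      (if d.rev = a then (if (a : ℕ) < n then (2 : ℂ) • cliffordGen a else 0) else 0) -
        (if d = a then (if (a : ℕ) < n then (2 : ℂ) • cliffordGen a.rev else 0) else 0) := by
    intro a
    have hrev : d.rev = a ↔ a.rev = d := by rw [Fin.rev_eq_iff, eq_comm]
    simp only [hrev, eq_comm (a := d)]
    by_cases ha : (a : ℕ) < n
    · simp only [if_pos ha]
      rw [commutator_cliffordGen_mul]
    · simp [ha]
  rw [reversalGen, smul_mul_assoc, mul_smul_comm, ← smul_sub, Finset.sum_mul, Finset.mul_sum,
    ← Finset.sum_sub_distrib, Finset.sum_congr rfl fun a _ => h1 a, Finset.sum_sub_distrib,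
    Finset.sum_ite_eq, Finset.sum_ite_eq]
  simp only [Finset.mem_univ, if_true]
  split_ifs <;> module

/-- The sign acquired by a generator under the reversal. -/
def reversalSign {n : ℕ} (d : Fin (2 * n + 1)) : ℝ := if (d : ℕ) < n then -1 else 1

theorem reversalSign_mul_self {n : ℕ} (d : Fin (2 * n + 1)) :
    reversalSign d * reversalSign d = 1 := by
  unfold reversalSign
  split_ifs <;> norm_num

theorem exp_reversalGen_mul {n : ℕ} (d : Fin (2 * n + 1)) :
    NormedSpace.exp (reversalGen n) * cliffordGen d =
      (reversalSign d : ℂ) • (cliffordGen d.rev * NormedSpace.exp (reversalGen n)) := by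
  have hval : (d.rev : ℕ) = 2 * n - d := by rw [Fin.val_rev]; omega
  have h := commutator_reversalGen d
  have h' := commutator_reversalGen d.rev
  rw [Fin.rev_rev] at h'
  rcases lt_trichotomy (d : ℕ) n with hd | hd | hd
  · have h1 : ¬ (d.rev : ℕ) < n := by omega
    rw [if_neg h1, if_pos hd, zero_sub, smul_neg] at h
    rw [if_neg h1, if_pos hd, sub_zero] at h'
    rw [(exp_mul_of_rotation h h').1, reversalSign, if_pos hd]
    simp
  -- The middle index `n` is its own mirror image and commutes with the rotation generator.
  · have hrev : d.rev = d := Fin.ext (by omega)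
    rw [if_neg (by omega), if_neg (by omega), sub_zero, smul_zero] at h
    have h1 := matrix_exp_mul_eq_smul_mul_exp (c := 0) (h.trans (zero_smul ℂ _).symm)
    rw [h1, hrev, reversalSign, if_neg (by omega)]
    simp
  · have h1 : (d.rev : ℕ) < n := by omega
    rw [if_pos h1, if_neg (by omega), sub_zero] at h
    rw [if_pos h1, if_neg (by omega), zero_sub, smul_neg] at h'
    rw [(exp_mul_of_rotation h' h).2, reversalSign, if_neg (by omega)]
    simp

theorem isHermitian_smul_cliffordGen_mul {n : ℕ} {a c : Fin (2 * n + 1)} (h : a ≠ c) (r : ℝ) :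
    ((-Complex.I * r : ℂ) • ((cliffordGen a : QubitOp n) * cliffordGen c)).IsHermitian := by
  rw [Matrix.IsHermitian, conjTranspose_smul, conjTranspose_mul, cliffordGen_conjTranspose,
    cliffordGen_conjTranspose, cliffordGen_anticomm h.symm]
  simp

/-- Only the summand with index `0` contains the parity generator: it is the linear part, and the
other summands form the quadratic part. -/
theorem exists_reversalGen_eq {n : ℕ} (hn : 1 ≤ n) :
    ∃ H₂ H₁ : QubitOp n, H₂.IsHermitian ∧
      H₂ ∈ Submodule.span ℂ
        (Set.range fun pq : Fin (2 * n) × Fin (2 * n) => majorana pq.1 * majorana pq.2) ∧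
      H₁.IsHermitian ∧
      H₁ ∈ Submodule.span ℂ (Set.range fun p : Fin (2 * n) => majorana p) ∧
      reversalGen n = Complex.I • H₂ + Complex.I • H₁ := by
  refine ⟨∑ p : Fin (2 * n), if (p.succ : ℕ) < n then (-Complex.I * (Real.pi / 4 : ℝ) : ℂ) •
      (cliffordGen p.succ * cliffordGen p.succ.rev) else 0,
    (-Complex.I * (Real.pi / 4 : ℝ) : ℂ) • (cliffordGen 0 * cliffordGen (Fin.rev 0)),
    ?_, ?_, ?_, ?_, ?_⟩
  · rw [Matrix.IsHermitian, conjTranspose_sum]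
    refine Finset.sum_congr rfl fun p _ => ?_
    split_ifs with hp
    · refine isHermitian_smul_cliffordGen_mul (fun h => ?_) _
      have := congrArg Fin.val h
      rw [Fin.val_rev] at this
      omega
    · exact conjTranspose_zero
  · refine Submodule.sum_mem _ fun p _ => ?_
    split_ifs with hp
    · obtain ⟨q, hq⟩ : ∃ q : Fin (2 * n), q.succ = p.succ.rev := by
        refine Fin.exists_succ_eq.mpr fun h => ?_
        have := congrArg Fin.val h
        rw [Fin.val_rev] at this
        simp at this
        simp at hp
        omega
      rw [← hq, cliffordGen_succ_mul_succ]
      exact Submodule.smul_mem _ _ (Submodule.subset_span ⟨(p, q), rfl⟩)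
    · exact Submodule.zero_mem _
  · refine isHermitian_smul_cliffordGen_mul (fun h => ?_) _
    have := congrArg Fin.val h
    rw [Fin.val_rev] at this
    simp at this
    omega
  · obtain ⟨q, hq⟩ : ∃ q : Fin (2 * n), q.succ = (0 : Fin (2 * n + 1)).rev := by
      refine Fin.exists_succ_eq.mpr fun h => ?_
      have := congrArg Fin.val h
      rw [Fin.val_rev] at this
      simp at this
      omega
    rw [← hq, cliffordGen_zero_mul_succ, smul_smul]
    exact Submodule.smul_mem _ _ (Submodule.subset_span ⟨q, rfl⟩)
  · rw [reversalGen, Fin.sum_univ_succ, if_pos (by simpa using! hn), Finset.smul_sum, smul_add,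
      Finset.smul_sum, smul_smul, add_comm]
    have hc : Complex.I * (-Complex.I * ((Real.pi / 4 : ℝ) : ℂ)) = (Real.pi / 4 : ℂ) := by
      push_cast
      linear_combination (-(Real.pi : ℂ) / 4) * Complex.I_mul_I
    rw [hc]
    congr 1
    refine Finset.sum_congr rfl fun p _ => ?_
    split_ifs
    · rw [smul_smul, hc]
    · simp

theorem productState_comp_rev {n : ℕ} {Z : Fin n → QubitOp n} (hZ : IndependentInvolutions Z) :
    productState (fun j => Z j.rev) 1 = productState Z 1 := by
  rw [productState, productState, affineProd, affineProd]
  congr 1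
  have hperm : ((List.finRange n).map Fin.rev).Perm (List.finRange n) := by
    rw [List.perm_ext_iff_of_nodup ((List.nodup_finRange n).map Fin.rev_injective)
      (List.nodup_finRange n)]
    intro a
    simp only [List.mem_map, List.mem_finRange, true_and, iff_true]
    exact ⟨a.rev, a.rev_rev⟩
  have h2 := (hperm.map fun j => (1 : ℂ) • (1 : QubitOp n) + ((1 : ℝ) : ℂ) • Z j).prod_eq' (by
    rw [List.pairwise_map]
    refine List.pairwise_of_forall fun i j => ?_
    refine Commute.add_left ((Commute.one_left _).smul_left _) (Commute.smul_left ?_ _)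
    exact Commute.add_right ((Commute.one_right _).smul_right _) ((hZ.commute i j).smul_right _))
  rw [List.map_map] at h2
  exact h2

/-- The standard state pairs the indices `(1, 2), (3, 4), …` and leaves out `0`, whereas `ρ_*` pairs
`(0, 1), (2, 3), …` and leaves out `2n`. The reversal `a ↦ 2n - a` carries one pairing to the other,
in the opposite order. -/
theorem isGaussian_rhoStar {n : ℕ} (hn : 1 ≤ n) : IsGaussian (rhoStar n hn) := by
  have hZ := (orthonormalPairs_star n).independentInvolutions
  refine ⟨?_, ?_⟩
  · rw [rhoStar_eq]
    exact isState_productState hZ fun j => by simp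
  · obtain ⟨H₂, H₁, a1, a2, a3, a4, a5⟩ := exists_reversalGen_eq hn
    -- The parameters are signs: they absorb the two reversal signs, the minus sign from exchanging
    -- the generators of a pair, and `starSign`.
    let l : Fin n → ℝ := fun j =>
      -(reversalSign (genFst j) * reversalSign (genSnd j) * starSign j.rev)
    have hl : ∀ j, l j * l j = 1 := fun j => by
      have e1 := reversalSign_mul_self (genFst j)
      have e2 := reversalSign_mul_self (genSnd j)
      have e3 := starSign_mul_self j.rev
      calc l j * l j = (reversalSign (genFst j) * reversalSign (genFst j)) *
            (reversalSign (genSnd j) * reversalSign (genSnd j)) *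
            (starSign j.rev * starSign j.rev) := by simp only [l]; ring
        _ = 1 := by rw [e1, e2, e3]; norm_num
    refine ⟨l, H₂, H₁, a1, a2, a3, a4, ?_⟩
    obtain ⟨e1, e2, e3⟩ := exp_conjTranspose_of_skew (skew_of_isHermitian a3 a1)
    rw [← a5] at e1 e2 e3 ⊢
    rw [standardGaussian_eq, conj_productState e2 e3]
    have hconj : ∀ j : Fin n, NormedSpace.exp (reversalGen n) * qubitZ j *
        (NormedSpace.exp (reversalGen n))ᴴ = (l j : ℂ) • pairInvolution starFst starSnd j.rev := by
      intro j
      have r1 : (genFst j).rev = oddGen j.rev := by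
        simp only [genFst, oddGen, Fin.ext_iff, Fin.val_rev]
        omega
      have r2 : (genSnd j).rev = evenGen j.rev := by
        simp only [genSnd, evenGen, Fin.ext_iff, Fin.val_rev]
        omega
      have hne : oddGen j.rev ≠ evenGen j.rev := by
        simp only [oddGen, evenGen, ne_eq, Fin.mk.injEq]
        omega
      rw [qubitZ_eq, mul_smul_comm, ← mul_assoc, exp_reversalGen_mul, smul_mul_assoc,
        smul_mul_assoc, mul_assoc (cliffordGen _) (NormedSpace.exp _), exp_reversalGen_mul, r1, r2, mul_smul_comm,
        smul_smul, smul_mul_assoc, ← mul_assoc (cliffordGen _),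
        mul_assoc _ (NormedSpace.exp _), e3, mul_one,
        cliffordGen_anticomm hne, pairInvolution_star]
      simp only [smul_neg, smul_smul, l, Complex.ofReal_neg, Complex.ofReal_mul]
      rw [← neg_smul]
      have := congrArg (fun t : ℝ => (t : ℂ)) (starSign_mul_self j.rev)
      simp only [Complex.ofReal_mul, Complex.ofReal_one] at this
      congr 1
      linear_combination (-Complex.I * reversalSign (genFst j) * reversalSign (genSnd j)) * this
    simp only [hconj]
    rw [rhoStar_eq, ← productState_comp_rev hZ, productState, productState, affineProd_smul]
    congr 2
    funext j
    rw [← Complex.ofReal_mul, hl]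
    rfl

/-! ### The image of a product state under the channel -/

theorem productState_pairInvolution {n : ℕ} {f g : Fin n → RealVec n} (h : OrthonormalPairs f g)
    (l : Fin n → ℝ) :
    productState (pairInvolution f g) l = (1 / 2 ^ n : ℂ) • symbolMap n
      (affineProd (wedgePair (fun j => toCoeff (f j)) (fun j => toCoeff (g j))) 1
        (fun j => (l j : ℂ) * -Complex.I) (List.finRange n)) := by
  rw [symbolMap_affineProd h.orthogonalPairs _ _ (List.nodup_finRange n), ← affineProd_smul]
  rfl

theorem map_affineProd_wedgePair {n : ℕ} {ι : Type*} (D : CoeffVec n →ₗ[ℂ] CoeffVec n)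
    (u w : ι → CoeffVec n) (α β : ι → ℂ) (L : List ι) :
    ExteriorAlgebra.map D (affineProd (wedgePair u w) α β L) =
      affineProd (wedgePair (fun j => D (u j)) (fun j => D (w j))) α β L := by
  rw [map_affineProd]
  congr 1
  funext j
  rw [wedgePair, wedgePair, map_mul, ExteriorAlgebra.map_apply_ι, ExteriorAlgebra.map_apply_ι]

theorem channel_productState {n : ℕ} (b : Fin (2 * n) → ℝ) {f g : Fin n → RealVec n}
    (h : OrthonormalPairs f g) (l : Fin n → ℝ) :
    channel b (productState (pairInvolution f g) l) = (1 / 2 ^ n : ℂ) • symbolMap n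
      (affineProd (wedgePair (fun j => scaleMap (extCoeff b) (toCoeff (f j)))
        (fun j => scaleMap (extCoeff b) (toCoeff (g j)))) 1
        (fun j => (l j : ℂ) * -Complex.I) (List.finRange n)) := by
  rw [productState_pairInvolution h, map_smul,
    channel_symbolMap b (affineProd_wedgePair_mem_wedgeSpan _ _ _ _ _), map_affineProd_wedgePair]

/-- For square-zero elements `1 + βZ = exp(βZ)`. As they commute, the product depends only on the
sum, so two product forms agree once their bivectors do. -/
theorem affineProd_one_eq_exp {A ι : Type*} [Ring A] [Algebra ℂ A] [Module ℚ A] {Z : ι → A}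
    (hsq : ∀ j, Z j * Z j = 0) (hc : ∀ i j, Commute (Z i) (Z j)) (β : ι → ℂ) (L : List ι) :
    IsNilpotent (L.map fun j => β j • Z j).sum ∧
      affineProd Z 1 β L = IsNilpotent.exp (L.map fun j => β j • Z j).sum := by
  induction L with
  | nil => exact ⟨by simp, by simp [affineProd_nil]⟩
  | cons i L ih =>
    have h2 : (β i • Z i) ^ 2 = 0 := by
      rw [pow_two, smul_mul_smul_comm, hsq, smul_zero]
    have hnil : IsNilpotent (β i • Z i) := ⟨2, h2⟩
    have hcom : Commute (β i • Z i) (L.map fun j => β j • Z j).sum := by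
      refine Commute.list_sum_right _ _ fun y hy => ?_
      obtain ⟨j, _, rfl⟩ := List.mem_map.mp hy
      exact ((hc i j).smul_left _).smul_right _
    refine ⟨?_, ?_⟩
    · rw [List.map_cons, List.sum_cons]
      exact hcom.isNilpotent_add hnil ih.1
    · rw [affineProd_cons, ih.2, List.map_cons, List.sum_cons,
        IsNilpotent.exp_add_of_commute hcom hnil ih.1, IsNilpotent.exp_eq_sum h2]
      simp [Finset.sum_range_succ]

theorem ι_anticomm {n : ℕ} (x y : CoeffVec n) :
    ExteriorAlgebra.ι ℂ x * ExteriorAlgebra.ι ℂ y =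
      -(ExteriorAlgebra.ι ℂ y * ExteriorAlgebra.ι ℂ x) :=
  eq_neg_of_add_eq_zero_left (ExteriorAlgebra.ι_add_mul_swap x y)

theorem affineProd_wedgePair_congr {n : ℕ} {ι ι' : Type*} (u w : ι → CoeffVec n)
    (u' w' : ι' → CoeffVec n) (β : ι → ℂ) (β' : ι' → ℂ) (L : List ι) (L' : List ι')
    (h : (L.map fun j => β j • wedgePair u w j).sum = (L'.map fun j => β' j • wedgePair u' w' j).sum) :
    affineProd (wedgePair u w) 1 β L = affineProd (wedgePair u' w') 1 β' L' := by
  let _ : Module ℚ (ExteriorAlgebra ℂ (CoeffVec n)) := Module.compHom _ (algebraMap ℚ ℂ)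
  have hsq : ∀ x y : CoeffVec n, (ExteriorAlgebra.ι ℂ x * ExteriorAlgebra.ι ℂ y) *
      (ExteriorAlgebra.ι ℂ x * ExteriorAlgebra.ι ℂ y) = 0 := fun x y => by
    rw [mul_assoc, ← mul_assoc (ExteriorAlgebra.ι ℂ y), ι_anticomm y x, neg_mul, mul_assoc,
      ExteriorAlgebra.ι_sq_zero]
    simp
  have hc : ∀ x y x' y' : CoeffVec n,
      Commute (ExteriorAlgebra.ι ℂ x * ExteriorAlgebra.ι ℂ y)
        (ExteriorAlgebra.ι ℂ x' * ExteriorAlgebra.ι ℂ y') := fun x y x' y' =>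
    Commute.mul_left (commute_mul_of_anticomm (ι_anticomm _ _) (ι_anticomm _ _))
      (commute_mul_of_anticomm (ι_anticomm _ _) (ι_anticomm _ _))
  rw [(affineProd_one_eq_exp (Z := wedgePair u w) (fun _ => hsq _ _) (fun _ _ => hc _ _ _ _) β L).2,
    (affineProd_one_eq_exp (Z := wedgePair u' w') (fun _ => hsq _ _)
      (fun _ _ => hc _ _ _ _) β' L').2, h]

/-- The degree-one element of the exterior algebra given by a real coefficient vector. -/
def realι {n : ℕ} (x : RealVec n) : ExteriorAlgebra ℂ (CoeffVec n) :=
  ExteriorAlgebra.ι ℂ (toCoeff x)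

theorem realι_add {n : ℕ} (x y : RealVec n) : realι (x + y) = realι x + realι y := by
  rw [realι, realι, realι, ← map_add]
  congr 1
  ext a
  simp [toCoeff]

theorem realι_smul {n : ℕ} (r : ℝ) (x : RealVec n) : realι (r • x) = (r : ℂ) • realι x := by
  rw [realι, realι, toCoeff_smul, map_smul]

theorem realι_zero {n : ℕ} : realι (0 : RealVec n) = 0 := by
  simpa using realι_smul 0 (0 : RealVec n)

theorem realι_sub {n : ℕ} (x y : RealVec n) : realι (x - y) = realι x - realι y := by
  have h : x - y = x + (-1 : ℝ) • y := by module
  rw [h, realι_add, realι_smul]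
  push_cast
  module

theorem realι_sum {n : ℕ} {ι : Type*} (s : Finset ι) (x : ι → RealVec n) :
    realι (∑ i ∈ s, x i) = ∑ i ∈ s, realι (x i) := by
  classical
  induction s using Finset.induction_on with
  | empty => simp [realι_zero]
  | insert i s hi ih => rw [Finset.sum_insert hi, Finset.sum_insert hi, realι_add, ih]

/-- A bivector is recovered from its skew map by wedging the image of each basis vector with that
vector; antisymmetry counts every term twice. Equal skew maps therefore give equal bivectors. -/
theorem sum_realι_mul {n m : ℕ} (F G : Fin m → RealVec n) (l : Fin m → ℝ) :
    (2 : ℂ) • ∑ j, (l j : ℂ) • (realι (F j) * realι (G j)) =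
      ∑ a, realι (∑ j, l j • (inner ℝ (G j) (EuclideanSpace.single a (1 : ℝ)) • F j -
        inner ℝ (F j) (EuclideanSpace.single a (1 : ℝ)) • G j)) *
          realι (EuclideanSpace.single a 1) := by
  have hexp : ∀ x : RealVec n, ∑ a, (inner ℝ x (EuclideanSpace.single a (1 : ℝ)) : ℂ) •
      realι (EuclideanSpace.single a 1) = realι x := by
    intro x
    conv_rhs => rw [← (EuclideanSpace.basisFun (Fin (2 * n + 1)) ℝ).sum_repr' x]
    rw [realι_sum]
    refine Finset.sum_congr rfl fun a _ => ?_
    rw [realι_smul, EuclideanSpace.basisFun_apply, real_inner_comm]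
  have h1 : ∀ a, realι (∑ j, l j • (inner ℝ (G j) (EuclideanSpace.single a (1 : ℝ)) • F j -
        inner ℝ (F j) (EuclideanSpace.single a (1 : ℝ)) • G j)) *
          realι (EuclideanSpace.single a 1) =
      ∑ j, (l j : ℂ) • (realι (F j) * ((inner ℝ (G j) (EuclideanSpace.single a (1 : ℝ)) : ℂ) •
          realι (EuclideanSpace.single a 1)) -
        realι (G j) * ((inner ℝ (F j) (EuclideanSpace.single a (1 : ℝ)) : ℂ) •
          realι (EuclideanSpace.single a 1))) := by
    intro a
    rw [realι_sum, Finset.sum_mul]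
    refine Finset.sum_congr rfl fun j _ => ?_
    rw [realι_smul, realι_sub, realι_smul, realι_smul, smul_mul_assoc, sub_mul, smul_mul_assoc,
      smul_mul_assoc, mul_smul_comm, mul_smul_comm]
  simp only [h1]
  rw [Finset.sum_comm, Finset.smul_sum]
  refine Finset.sum_congr rfl fun j _ => ?_
  rw [← Finset.smul_sum, Finset.sum_sub_distrib, ← Finset.mul_sum, ← Finset.mul_sum, hexp, hexp,
    smul_comm]
  congr 1
  have : realι (G j) * realι (F j) = -(realι (F j) * realι (G j)) := ι_anticomm _ _
  rw [this, two_smul, sub_neg_eq_add]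

/-- The real diagonal scaling of a coefficient vector. -/
def realScale {n : ℕ} (d : Fin (2 * n + 1) → ℝ) (x : RealVec n) : RealVec n :=
  WithLp.toLp 2 fun a => d a * x a

theorem toCoeff_realScale {n : ℕ} (d : Fin (2 * n + 1) → ℝ) (x : RealVec n) :
    toCoeff (realScale d x) = scaleMap d (toCoeff x) := by
  ext a
  rw [scaleMap_apply]
  simp [toCoeff, realScale]

/-- The scaled vectors `F j`, `G j` need not be orthonormal, but the skew map of their bivector has
a canonical form, which supplies orthonormal pairs with the same bivector and hence the same
exponential. -/
theorem exists_channel_productState_eq {n : ℕ} (b : Fin (2 * n) → ℝ) {f g : Fin n → RealVec n}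
    (h : OrthonormalPairs f g) (l : Fin n → ℝ) :
    ∃ (f' g' : Fin n → RealVec n) (μ : Fin n → ℝ), OrthonormalPairs f' g' ∧ (∀ j, 0 ≤ μ j) ∧
      Antitone μ ∧ channel b (productState (pairInvolution f g) l) =
        productState (pairInvolution f' g') μ := by
  set F : Fin n → RealVec n := fun j => realScale (extCoeff b) (f j) with hF
  set G : Fin n → RealVec n := fun j => realScale (extCoeff b) (g j) with hG
  let A : RealVec n →ₗ[ℝ] RealVec n := ∑ j, l j •
    ((innerₛₗ ℝ (G j)).smulRight (F j) - (innerₛₗ ℝ (F j)).smulRight (G j))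
  have hAx : ∀ x, A x = ∑ j, l j • (inner ℝ (G j) x • F j - inner ℝ (F j) x • G j) := by
    intro x
    simp [A, LinearMap.sum_apply]
  obtain ⟨f', g', μ, h', hμ, hanti, hform⟩ := exists_skew_canonical_form_antitone
    (m := n) (E := RealVec n) (by simp) A (fun x y => by
      rw [hAx, hAx, sum_inner, inner_sum, ← Finset.sum_neg_distrib]
      refine Finset.sum_congr rfl fun j _ => ?_
      rw [inner_smul_left, inner_smul_right, inner_sub_left, inner_sub_right, inner_smul_left,
        inner_smul_left, inner_smul_right, inner_smul_right, real_inner_comm x (F j),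
        real_inner_comm x (G j)]
      simp only [conj_trivial]
      ring)
  refine ⟨f', g', μ, h', hμ, hanti, ?_⟩
  rw [channel_productState b h, productState_pairInvolution h']
  congr 2
  refine affineProd_wedgePair_congr _ _ _ _ _ _ _ _ ?_
  have hsum : ∑ j, (l j : ℂ) • (realι (F j) * realι (G j)) =
      ∑ j, (μ j : ℂ) • (realι (f' j) * realι (g' j)) := by
    refine smul_right_injective _ (two_ne_zero : (2 : ℂ) ≠ 0) ?_
    simp only
    rw [sum_realι_mul, sum_realι_mul]
    refine Finset.sum_congr rfl fun a _ => ?_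
    rw [← hAx, ← hform]
  rw [← List.ofFn_eq_map, ← List.ofFn_eq_map, List.sum_ofFn, List.sum_ofFn]
  simp only [wedgePair, ← toCoeff_realScale, mul_comm _ (-Complex.I), mul_smul, ← Finset.smul_sum]
  exact congrArg _ hsum

/-- The spectral parameters of the image of the optimal state. -/
def starCoeff {n : ℕ} (b : Fin (2 * n) → ℝ) (j : Fin n) : ℝ :=
  extCoeff b (evenGen j) * extCoeff b (oddGen j)

/-- The pairs of the optimal state lie along coordinate vectors, which the diagonal map merely
rescales; the involutions stay the same. -/
theorem channel_rhoStar {n : ℕ} (hn : 1 ≤ n) (b : Fin (2 * n) → ℝ) :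
    channel b (rhoStar n hn) = productState (pairInvolution starFst starSnd) (starCoeff b) := by
  have h := orthonormalPairs_star n
  rw [rhoStar_eq, channel_productState b h, productState_pairInvolution h]
  congr 2
  have e : wedgePair (fun j : Fin n => scaleMap (extCoeff b) (toCoeff (starFst j)))
      (fun j => scaleMap (extCoeff b) (toCoeff (starSnd j))) =
      fun j => (starCoeff b j : ℂ) •
        wedgePair (fun j => toCoeff (starFst j)) (fun j => toCoeff (starSnd j)) j := by
    funext j
    rw [wedgePair, wedgePair, starFst, starSnd, toCoeff_smul, map_smul, toCoeff_single,
      toCoeff_single, scaleMap_single, scaleMap_single, map_smul, map_smul, map_smul, map_smul,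
      starCoeff]
    simp only [smul_mul_assoc, mul_smul_comm, smul_smul, Complex.ofReal_mul]
    congr 1
    ring
  rw [e, affineProd_smul]
  congr 1
  funext j
  simp only [Pi.one_apply, Complex.ofReal_one]
  ring

/-! ### Hilbert–Schmidt estimates -/

theorem trace_conjTranspose_mul_eq_sum {n : ℕ} (Y A : QubitOp n) :
    (Yᴴ * A).trace =
      ∑ x, star ((monomial x)ᴴ * Y).trace * ((monomial x)ᴴ * A).trace / 2 ^ n := by
  conv_lhs => rw [eq_sum_monomial A]
  rw [Matrix.mul_sum, Matrix.trace_sum]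
  refine Finset.sum_congr rfl fun x _ => ?_
  rw [Matrix.mul_smul, Matrix.trace_smul, smul_eq_mul, ← Matrix.trace_conjTranspose,
    conjTranspose_mul, conjTranspose_conjTranspose]
  ring

theorem trace_conjTranspose_mul_channel {n : ℕ} (b : Fin (2 * n) → ℝ) (Y A : QubitOp n) :
    (Yᴴ * channel b A).trace = ((channel b Y)ᴴ * A).trace := by
  rw [trace_conjTranspose_mul_eq_sum, trace_conjTranspose_mul_eq_sum]
  refine Finset.sum_congr rfl fun x _ => ?_
  rw [trace_monomial_mul_channel, trace_monomial_mul_channel, star_mul', Complex.star_def,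
    Complex.conj_ofReal]
  ring

theorem re_trace_conjTranspose_mul_self {n : ℕ} (A : QubitOp n) :
    (Aᴴ * A).trace.re = ∑ x, Complex.normSq ((monomial x)ᴴ * A).trace / 2 ^ n := by
  rw [trace_conjTranspose_mul_eq_sum, Complex.re_sum]
  refine Finset.sum_congr rfl fun x _ => ?_
  rw [Complex.star_def, ← Complex.normSq_eq_conj_mul_self]
  norm_cast

/-- By Parseval for the monomials, the channel multiplies each coefficient by its attenuation, which
is at most `c` wherever the coefficient is nonzero. -/
theorem re_trace_channel_le {n : ℕ} {b : Fin (2 * n) → ℝ} (hb : ∀ p, 0 ≤ b p) {c : ℝ}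
    (A : QubitOp n) (hA : ∀ x, c < attenuation b x → ((monomial x)ᴴ * A).trace = 0) :
    ((channel b A)ᴴ * channel b A).trace.re ≤ c ^ 2 * (Aᴴ * A).trace.re := by
  rw [re_trace_conjTranspose_mul_self, re_trace_conjTranspose_mul_self, Finset.mul_sum]
  refine Finset.sum_le_sum fun x _ => ?_
  rw [trace_monomial_mul_channel, Complex.normSq_mul, Complex.normSq_ofReal, mul_div_assoc]
  have h0 : 0 ≤ attenuation b x := Finset.prod_nonneg fun p _ => pow_nonneg (hb p) _
  have h1 : 0 ≤ Complex.normSq ((monomial x)ᴴ * A).trace / 2 ^ n :=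
    div_nonneg (Complex.normSq_nonneg _) (by positivity)
  rcases lt_or_ge c (attenuation b x) with h | h
  · rw [hA x h]
    simp
  · refine mul_le_mul_of_nonneg_right ?_ h1
    rw [pow_two]
    exact mul_le_mul h h h0 (h0.trans h)

/-- This is nonnegativity of a variance: for `X = t - B` with `t = Re Tr(ρB)`, expanding `Tr(ρ X† X)
≥ 0` leaves `s - t² ≥ 0`. -/
theorem IsState.sq_re_trace_mul_le {n : ℕ} {ρ B : QubitOp n} (hρ : IsState ρ) {s : ℝ}
    (hB : Bᴴ * B = (s : ℂ) • (1 : QubitOp n)) : (ρ * B).trace.re ^ 2 ≤ s := by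
  set t : ℝ := (ρ * B).trace.re with ht
  set X : QubitOp n := (t : ℂ) • (1 : QubitOp n) - B with hX
  have h1 : 0 ≤ (X * ρ * Xᴴ).trace := (hρ.posSemidef.mul_mul_conjTranspose_same X).trace_nonneg
  have h2 : (X * ρ * Xᴴ).trace = (ρ * (Xᴴ * X)).trace := by
    rw [mul_assoc, Matrix.trace_mul_comm, mul_assoc]
  have h3 : Xᴴ * X = ((t : ℂ) * t + s) • (1 : QubitOp n) - (t : ℂ) • (B + Bᴴ) := by
    rw [hX, conjTranspose_sub, conjTranspose_smul, conjTranspose_one, sub_mul, mul_sub, mul_sub, hB,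
      Complex.star_def, Complex.conj_ofReal, smul_mul_smul_comm, one_mul, smul_mul_assoc, one_mul,
      mul_smul_comm, mul_one]
    module
  have h4 : (ρ * Bᴴ).trace = star (ρ * B).trace := by
    rw [← Matrix.trace_conjTranspose, conjTranspose_mul, hρ.posSemidef.isHermitian.eq,
      Matrix.trace_mul_comm]
  rw [h2, h3, mul_sub, mul_smul_comm, mul_smul_comm, mul_one, mul_add, trace_sub, trace_smul,
    trace_smul, trace_add, h4, hρ.trace_eq_one] at h1
  have h5 := (Complex.le_def.mp h1).1
  simp only [smul_eq_mul, mul_one, Complex.sub_re, Complex.add_re, Complex.mul_re,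
    Complex.ofReal_re, Complex.ofReal_im, Complex.zero_re, Complex.star_def, Complex.conj_re,
    ← ht] at h5
  nlinarith

/-! ### Orthogonalization of wedge products -/

theorem realι_mul_prod_eq_zero {n : ℕ} {q : RealVec n} {l : List (RealVec n)} (hq : q ∈ l) :
    realι q * (l.map realι).prod = 0 := by
  induction l with
  | nil => simp at hq
  | cons y l ih =>
    rw [List.map_cons, List.prod_cons, ← mul_assoc]
    rcases List.mem_cons.mp hq with rfl | hq
    · rw [realι, ExteriorAlgebra.ι_sq_zero, zero_mul]
    · have : realι q * realι y = -(realι y * realι q) := ι_anticomm _ _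
      rw [this, neg_mul, mul_assoc, ih hq, mul_zero, neg_zero]

/-- Gram–Schmidt without normalization: the component of a vector in the span of the later ones is
killed by their wedge product. -/
theorem exists_orthogonal_prod_realι_eq {n : ℕ} (l : List (RealVec n)) :
    ∃ q : List (RealVec n), q.Pairwise (fun x y => inner ℝ x y = 0) ∧
      (l.map realι).prod = (q.map realι).prod := by
  induction l with
  | nil => exact ⟨[], List.Pairwise.nil, rfl⟩
  | cons x l ih =>
    obtain ⟨q, hq, hprod⟩ := ih
    obtain ⟨p, hp, r, hr, rfl⟩ :=
      (Submodule.span ℝ {y | y ∈ q}).exists_add_mem_mem_orthogonal x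
    refine ⟨r :: q, List.pairwise_cons.mpr ⟨fun y hy => ?_, hq⟩, ?_⟩
    · exact (Submodule.mem_orthogonal' _ _).mp hr y (Submodule.subset_span hy)
    · have h0 : realι p * (q.map realι).prod = 0 := by
        induction hp using Submodule.span_induction with
        | mem y hy => exact realι_mul_prod_eq_zero hy
        | zero => rw [realι_zero, zero_mul]
        | add y z _ _ hy hz => rw [realι_add, add_mul, hy, hz, add_zero]
        | smul c y _ hy => rw [realι_smul, smul_mul_assoc, hy, smul_zero]
      rw [List.map_cons, List.prod_cons, List.map_cons, List.prod_cons, hprod, realι_add, add_mul,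
        h0, zero_add]

theorem exists_conjTranspose_mul_self_eq {n : ℕ} (q : List (RealVec n)) :
    ∃ s : ℝ, ((q.map fun x => cliffordLin n (toCoeff x)).prod)ᴴ *
      (q.map fun x => cliffordLin n (toCoeff x)).prod = (s : ℂ) • (1 : QubitOp n) := by
  induction q with
  | nil => exact ⟨1, by simp⟩
  | cons x q ih =>
    obtain ⟨s, hs⟩ := ih
    refine ⟨inner ℝ x x * s, ?_⟩
    rw [List.map_cons, List.prod_cons, conjTranspose_mul, mul_assoc,
      ← mul_assoc (cliffordLin n (toCoeff x))ᴴ, cliffordLin_conjTranspose, star_toCoeff,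
      cliffordLin_mul_self, toCoeff_dotProduct, smul_mul_assoc, one_mul, mul_smul_comm, hs,
      smul_smul, Complex.ofReal_mul]

/-- After orthogonalization the symbol is an operator product of real Clifford vectors, each with
scalar square. The scalar `s` may be zero. -/
theorem exists_symbolMap_conjTranspose_mul_self_eq {n : ℕ} (l : List (RealVec n)) :
    ∃ s : ℝ, (symbolMap n (l.map realι).prod)ᴴ * symbolMap n (l.map realι).prod =
      (s : ℂ) • (1 : QubitOp n) := by
  obtain ⟨q, hq, hprod⟩ := exists_orthogonal_prod_realι_eq l
  obtain ⟨s, hs⟩ := exists_conjTranspose_mul_self_eq q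
  refine ⟨s, ?_⟩
  have h1 := symbolMap_map_ι_prod (n := n) (l := q.map toCoeff) (by
    rw [List.pairwise_map]
    exact hq.imp fun {x y} h => by rw [toCoeff_dotProduct, h, Complex.ofReal_zero])
  rw [List.map_map, List.map_map] at h1
  rw [hprod]
  have h2 : symbolMap n (q.map realι).prod = (q.map fun x => cliffordLin n (toCoeff x)).prod := h1
  rw [h2, hs]

/-! ### Log-majorization of the spectral parameters -/

theorem affineProd_ite {A ι : Type*} [Ring A] [Algebra ℂ A] (Z : ι → A) (p : ι → Bool) (c : ℂ)
    (L : List ι) :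
    affineProd Z (fun j => if p j then 0 else 1) (fun j => if p j then c else 0) L =
      c ^ (L.filter p).length • ((L.filter p).map Z).prod := by
  induction L with
  | nil => simp [affineProd_nil]
  | cons i L ih =>
    rw [affineProd_cons, ih]
    by_cases h : p i
    · rw [List.filter_cons_of_pos h, List.map_cons, List.prod_cons, List.length_cons, pow_succ]
      simp [h, smul_smul]
    · rw [List.filter_cons_of_neg h]
      simp [h]

theorem prod_map_wedgePair {n : ℕ} {ι : Type*} (f g : ι → RealVec n) (L : List ι) :
    (L.map (wedgePair (fun j => toCoeff (f j)) (fun j => toCoeff (g j)))).prod =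
      ((L.flatMap fun j => [f j, g j]).map realι).prod := by
  induction L with
  | nil => simp
  | cons i L ih =>
    rw [List.map_cons, List.prod_cons, ih, List.flatMap_cons, List.map_append, List.prod_append]
    congr 1
    simp [wedgePair, realι]

/-- The product of the first `k` involutions of a family. -/
def initialProd {n : ℕ} (Z : Fin n → QubitOp n) (k : ℕ) : QubitOp n :=
  affineProd Z (fun j => if decide ((j : ℕ) < k) then 0 else 1)
    (fun j => if decide ((j : ℕ) < k) then 1 else 0) (List.finRange n)

theorem initialProd_conjTranspose_mul_self {n : ℕ} {Z : Fin n → QubitOp n}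
    (hZ : IndependentInvolutions Z) (k : ℕ) : (initialProd Z k)ᴴ * initialProd Z k = 1 := by
  rw [initialProd, hZ.affineProd_conjTranspose, hZ.affineProd_mul]
  have h : ∀ L : List (Fin n), affineProd Z (fun _ => 1) (fun _ => 0) L = 1 := fun L => by
    simp [affineProd]
  rw [← h (List.finRange n)]
  congr 1 <;> funext j <;> by_cases hj : (j : ℕ) < k <;> simp [hj]

/-- A selected factor becomes `(1 + μ Z) Z`, with constant term `μ`; an unselected one keeps the
constant term 1. -/
theorem trace_productState_mul_initialProd {n : ℕ} {Z : Fin n → QubitOp n}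
    (hZ : IndependentInvolutions Z) (μ : Fin n → ℝ) (k : ℕ) :
    (productState Z μ * initialProd Z k).trace = ((∏ j with Fin.val j < k, μ j : ℝ) : ℂ) := by
  rw [productState, initialProd, smul_mul_assoc, hZ.affineProd_mul, trace_smul,
    hZ.trace_affineProd _ _ (List.nodup_finRange n), ← List.ofFn_eq_map, List.prod_ofFn,
    Finset.prod_filter]
  simp only [Fintype.card_pi, Fintype.card_fin, Finset.prod_const, Finset.card_univ, Nat.cast_pow,
    Nat.cast_ofNat, smul_eq_mul]
  rw [← mul_assoc, one_div, inv_mul_cancel₀ (by positivity), one_mul]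
  push_cast
  refine Finset.prod_congr rfl fun j _ => ?_
  by_cases hj : (j : ℕ) < k <;> simp [hj]

theorem initialProd_pairInvolution {n : ℕ} {f g : Fin n → RealVec n} (h : OrthonormalPairs f g)
    {k : ℕ} (hk : k ≤ n) :
    ∃ l : List (RealVec n), l.length = 2 * k ∧
      initialProd (pairInvolution f g) k = (-Complex.I) ^ k • symbolMap n (l.map realι).prod := by
  set L : List (Fin n) := (List.finRange n).filter fun j : Fin n => decide ((j : ℕ) < k) with hL
  have hlen : L.length = k := by
    have h1 : L.length = (Finset.univ.filter fun j : Fin n => (j : ℕ) < k).card := by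
      rw [← List.toFinset_card_of_nodup ((List.nodup_finRange n).filter _)]
      congr 1
      ext j
      simp
    rw [h1, Fin.card_filter_val_lt, min_eq_right hk]
  refine ⟨L.flatMap fun j => [f j, g j], ?_, ?_⟩
  · simp [List.length_flatMap, hlen, mul_comm]
  · have h1 : initialProd (pairInvolution f g) k = affineProd
        (cliffordPair (fun j => toCoeff (f j)) (fun j => toCoeff (g j)))
        (fun j => if decide ((j : ℕ) < k) then 0 else 1)
        (fun j => if decide ((j : ℕ) < k) then -Complex.I else 0) (List.finRange n) := by
      rw [initialProd]
      refine (affineProd_smul _ _ _ _ _).trans ?_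
      congr 1
      funext j
      split_ifs <;> simp
    rw [h1, ← symbolMap_affineProd h.orthogonalPairs _ _ (List.nodup_finRange n), affineProd_ite,
      map_smul, ← hL, hlen, prod_map_wedgePair]

/-- The largest element of a set of `k + 1` naturals is at least `k`, so removing it allows
induction. -/
theorem prod_le_prod_range_of_antitone {d : ℕ → ℝ} (hd : Antitone d) (h0 : ∀ i, 0 ≤ d i)
    (S : Finset ℕ) : ∏ i ∈ S, d i ≤ ∏ i ∈ Finset.range S.card, d i := by
  induction S using Finset.induction_on_max with
  | empty => simp
  | insert a S ha ih =>
    have hnot : a ∉ S := fun h => lt_irrefl _ (ha a h)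
    have hcard : S.card ≤ a := by
      have := Finset.card_le_card (s := S) (t := Finset.range a)
        fun x hx => Finset.mem_range.mpr (ha x hx)
      simpa using this
    rw [Finset.prod_insert hnot, Finset.card_insert_of_notMem hnot, Finset.prod_range_succ, mul_comm]
    exact mul_le_mul ih (hd hcard) (h0 a) (Finset.prod_nonneg fun i _ => h0 i)

/-- The attenuation coefficients of the extended family, continued by zero. -/
def extCoeffNat {n : ℕ} (b : Fin (2 * n) → ℝ) (i : ℕ) : ℝ :=
  if h : i < 2 * n + 1 then extCoeff b ⟨i, h⟩ else 0

theorem extCoeff_mem_Icc {n : ℕ} {b : Fin (2 * n) → ℝ} (hb0 : ∀ p, 0 ≤ b p) (hb1 : ∀ p, b p ≤ 1)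
    (a : Fin (2 * n + 1)) : 0 ≤ extCoeff b a ∧ extCoeff b a ≤ 1 := by
  refine Fin.cases ?_ (fun p => ?_) a
  · simp [extCoeff]
  · simpa [extCoeff] using ⟨hb0 p, hb1 p⟩

theorem extCoeff_antitone {n : ℕ} {b : Fin (2 * n) → ℝ} (hb1 : ∀ p, b p ≤ 1) (hb : Antitone b) :
    Antitone (extCoeff b) := by
  intro i j
  refine Fin.cases ?_ (fun p => ?_) i <;> refine Fin.cases ?_ (fun q => ?_) j
  · exact fun _ => le_rfl
  · exact fun _ => by simpa [extCoeff] using hb1 q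
  · intro h
    exact absurd (Fin.le_zero_iff.mp h) (Fin.succ_ne_zero p)
  · intro h
    simpa [extCoeff] using hb (Fin.succ_le_succ_iff.mp h)

theorem extCoeffNat_nonneg {n : ℕ} {b : Fin (2 * n) → ℝ} (hb0 : ∀ p, 0 ≤ b p)
    (hb1 : ∀ p, b p ≤ 1) (i : ℕ) : 0 ≤ extCoeffNat b i := by
  unfold extCoeffNat
  split_ifs
  · exact (extCoeff_mem_Icc hb0 hb1 _).1
  · exact le_rfl

theorem extCoeffNat_antitone {n : ℕ} {b : Fin (2 * n) → ℝ} (hb0 : ∀ p, 0 ≤ b p)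
    (hb1 : ∀ p, b p ≤ 1) (hb : Antitone b) : Antitone (extCoeffNat b) := by
  intro i j hij
  by_cases hj : j < 2 * n + 1
  · rw [extCoeffNat, extCoeffNat, dif_pos hj, dif_pos (hij.trans_lt hj)]
    exact extCoeff_antitone hb1 hb (Fin.mk_le_mk.mpr hij)
  · rw [extCoeffNat, dif_neg hj]
    exact extCoeffNat_nonneg hb0 hb1 i

theorem prod_range_two_mul {d : ℕ → ℝ} (k : ℕ) :
    ∏ i ∈ Finset.range (2 * k), d i = ∏ j ∈ Finset.range k, d (2 * j) * d (2 * j + 1) := by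
  induction k with
  | zero => simp
  | succ k ih =>
    rw [mul_add, mul_one, Finset.prod_range_succ, Finset.prod_range_succ, ih,
      Finset.prod_range_succ, mul_assoc]

theorem prod_extCoeff_le {n : ℕ} {b : Fin (2 * n) → ℝ} (hb0 : ∀ p, 0 ≤ b p)
    (hb1 : ∀ p, b p ≤ 1) (hb : Antitone b) {k : ℕ} (hk : k ≤ n) {L : List (Fin (2 * n + 1))}
    (hL : L.Nodup) (hlen : L.length = 2 * k) :
    (L.map (extCoeff b)).prod ≤ ∏ j : Fin n with Fin.val j < k, starCoeff b j := by
  have h1 : (L.map (extCoeff b)).prod = ∏ i ∈ L.toFinset.map Fin.valEmbedding, extCoeffNat b i := by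
    rw [Finset.prod_map, ← List.prod_toFinset _ hL]
    refine Finset.prod_congr rfl fun a _ => ?_
    rw [Fin.valEmbedding_apply, extCoeffNat, dif_pos a.2]
  have h2 : (L.toFinset.map Fin.valEmbedding).card = 2 * k := by
    rw [Finset.card_map, List.toFinset_card_of_nodup hL, hlen]
  have h3 : ∏ j : Fin n with Fin.val j < k, starCoeff b j =
      ∏ j ∈ Finset.range k, extCoeffNat b (2 * j) * extCoeffNat b (2 * j + 1) := by
    rw [Finset.prod_filter, Finset.prod_fin_eq_prod_range, ← Finset.prod_subset
      (Finset.range_subset_range.mpr hk)]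
    · refine Finset.prod_congr rfl fun j hj => ?_
      have hjk := Finset.mem_range.mp hj
      have hjn : j < n := hjk.trans_le hk
      rw [dif_pos hjn, if_pos hjk, starCoeff, extCoeffNat, extCoeffNat, dif_pos (by omega),
        dif_pos (by omega)]
      rfl
    · intro j hj hj'
      rw [Finset.mem_range] at hj hj'
      rw [dif_pos hj, if_neg hj']
  rw [h1, h3, ← prod_range_two_mul, ← h2]
  exact prod_le_prod_range_of_antitone (extCoeffNat_antitone hb0 hb1 hb)
    (extCoeffNat_nonneg hb0 hb1) _

theorem starCoeff_mem_Icc {n : ℕ} {b : Fin (2 * n) → ℝ} (hb0 : ∀ p, 0 ≤ b p) (hb1 : ∀ p, b p ≤ 1)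
    (j : Fin n) : 0 ≤ starCoeff b j ∧ starCoeff b j ≤ 1 := by
  have h1 := extCoeff_mem_Icc hb0 hb1 (evenGen j)
  have h2 := extCoeff_mem_Icc hb0 hb1 (oddGen j)
  exact ⟨mul_nonneg h1.1 h2.1, mul_le_one₀ h1.2 h2.1 h2.2⟩

/-- The product of the `μ j` is `Tr(ρ Φ(A))` by self-adjointness of the channel. Because `Φ(A)† Φ(A)
= s` is scalar, its square is at most `s`, and `s` is controlled by a Hilbert–Schmidt norm. No
positivity of `Φ(ρ)` enters. -/
theorem prod_le_prod_starCoeff {n : ℕ} {b : Fin (2 * n) → ℝ} (hb0 : ∀ p, 0 ≤ b p)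
    (hb1 : ∀ p, b p ≤ 1) (hb : Antitone b) {ρ : QubitOp n} (hρ : IsState ρ)
    {f g : Fin n → RealVec n} {μ : Fin n → ℝ} (h : OrthonormalPairs f g)
    (heq : channel b ρ = productState (pairInvolution f g) μ) {k : ℕ} (hk : k ≤ n) :
    ∏ j with Fin.val j < k, μ j ≤ ∏ j with Fin.val j < k, starCoeff b j := by
  have hZ := h.independentInvolutions
  set A := initialProd (pairInvolution f g) k with hA
  obtain ⟨l, hlen, hAl⟩ := initialProd_pairInvolution h hk
  set z := (l.map realι).prod with hz
  have hI : star ((-Complex.I) ^ k) * (-Complex.I) ^ k = 1 := by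
    rw [star_pow, ← mul_pow]
    simp
  have hzmem : z ∈ wedgeSpan n (· = 2 * k) := by
    have h1 := map_ι_prod_mem_wedgeSpan (l.map (toCoeff (n := n)))
    rw [List.map_map, List.length_map, hlen] at h1
    exact h1
  have hchan : channel b A = (-Complex.I) ^ k •
      symbolMap n ((l.map (realScale (extCoeff b))).map realι).prod := by
    rw [hA, hAl, map_smul, channel_symbolMap b (wedgeSpan_mono (fun m hm => ⟨k, by omega⟩) hzmem), hz,
      map_list_prod, List.map_map, List.map_map]
    congr 3
    refine List.map_congr_left fun x _ => ?_
    simp only [Function.comp_apply, realι, ExteriorAlgebra.map_apply_ι, toCoeff_realScale]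
  obtain ⟨s, hs⟩ := exists_symbolMap_conjTranspose_mul_self_eq (l.map (realScale (extCoeff b)))
  have hBB : (channel b A)ᴴ * channel b A = (s : ℂ) • (1 : QubitOp n) := by
    rw [hchan, conjTranspose_smul, smul_mul_smul_comm, hI, one_smul, hs]
  set C := ∏ j : Fin n with Fin.val j < k, starCoeff b j with hC
  have hC0 : 0 ≤ C := Finset.prod_nonneg fun j _ => (starCoeff_mem_Icc hb0 hb1 j).1
  -- Since `A` is unitary, the Hilbert–Schmidt estimate reads `s 2^n ≤ C² 2^n`.
  have hsC : s ≤ C ^ 2 := by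
    have h1 := re_trace_channel_le hb0 (c := C) A (fun x hx => by
      rw [hA, hAl, mul_smul_comm, trace_smul, trace_monomial_mul_symbolMap_eq_zero b (even_two_mul k)
        (fun L hL hL' => prod_extCoeff_le hb0 hb1 hb hk hL hL') hzmem hx, smul_zero])
    rw [hBB, initialProd_conjTranspose_mul_self hZ, trace_smul, trace_one] at h1
    simp only [Fintype.card_pi, Fintype.card_fin, Finset.prod_const, Finset.card_univ, Nat.cast_pow,
      Nat.cast_ofNat, smul_eq_mul] at h1
    have e : ((2 : ℂ) ^ n) = (((2 : ℝ) ^ n : ℝ) : ℂ) := by push_cast; rfl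
    rw [e, ← Complex.ofReal_mul, Complex.ofReal_re, Complex.ofReal_re] at h1
    exact le_of_mul_le_mul_right h1 (by positivity)
  have htr : (ρ * channel b A).trace = ((∏ j with Fin.val j < k, μ j : ℝ) : ℂ) := by
    rw [← trace_productState_mul_initialProd hZ μ k, ← heq]
    have h1 := trace_conjTranspose_mul_channel b ρ A
    have h2 : (channel b ρ)ᴴ = channel b ρ := by
      rw [heq]
      exact productState_isHermitian hZ μ
    rwa [hρ.posSemidef.isHermitian.eq, h2] at h1
  have h1 := hρ.sq_re_trace_mul_le hBB
  rw [htr, Complex.ofReal_re] at h1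
  exact le_of_abs_le (abs_le_of_sq_le_sq (h1.trans hsC) hC0)

theorem IsState.sum_spec_of_eq_productState {n : ℕ} {Z : Fin n → QubitOp n}
    (hZ : IndependentInvolutions Z) {σ : QubitOp n} (hσ : IsState σ) {μ : Fin n → ℝ}
    (heq : σ = productState Z μ) (f : ℝ → ℝ) :
    ∑ j, f (hσ.spec j) = ((productSpectrum (List.ofFn μ)).map f).sum := by
  subst heq
  exact sum_eigenvalues_productState hZ μ hσ.posSemidef.isHermitian f

end

end FermionicChannel

/-! ### Assembly of the theorem -/

theorem proposition1 (n : ℕ) (hn : 1 ≤ n) (b : Fin (2 * n) → ℝ)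
    (hb0 : ∀ p, 0 ≤ b p) (hb1 : ∀ p, b p ≤ 1) (hb : Antitone b) :
    IsGaussian (rhoStar n hn) ∧
    ∃ hstar : IsState (channel b (rhoStar n hn)),
      ∀ ρ : QubitOp n, IsGaussian ρ →
        ∃ h : IsState (channel b ρ),
          h.Majorized hstar ∧
          ∀ α : ENNReal, hstar.renyiEntropy α ≤ h.renyiEntropy α := by
  have hZstar := (orthonormalPairs_star n).independentInvolutions
  have hstar : IsState (channel b (rhoStar n hn)) := by
    rw [channel_rhoStar]
    exact isState_productState hZstar fun j =>
      ⟨by linarith [(starCoeff_mem_Icc hb0 hb1 j).1], (starCoeff_mem_Icc hb0 hb1 j).2⟩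
  refine ⟨isGaussian_rhoStar hn, hstar, fun ρ hρ => ?_⟩
  obtain ⟨f, g, l, hfg, rfl⟩ := hρ.exists_productState
  obtain ⟨f', g', μ, h', hμ0, hanti, heq⟩ := exists_channel_productState_eq b hfg l
  have hZ := h'.independentInvolutions
  have hlog : ∀ k ≤ n, ((List.ofFn μ).take k).prod ≤ ((List.ofFn (starCoeff b)).take k).prod := by
    intro k hk
    rw [List.prod_take_ofFn, List.prod_take_ofFn]
    exact prod_le_prod_starCoeff hb0 hb1 hb hρ.1 h' heq hk
  -- The log-majorization at `k = 1` bounds the largest parameter by 1. This is what makes `Φ(ρ)`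
  -- positive, without appeal to complete positivity of the channel.
  have hμ1 : ∀ j, μ j ≤ 1 := by
    intro j
    have h1 := hlog 1 hn
    rw [List.prod_take_ofFn, List.prod_take_ofFn] at h1
    have h2 : (Finset.univ.filter fun j : Fin n => Fin.val j < 1) = {⟨0, hn⟩} := by
      ext i
      simp [Fin.ext_iff]
    rw [h2, Finset.prod_singleton, Finset.prod_singleton] at h1
    exact (hanti (Fin.mk_le_mk.mpr (Nat.zero_le _) : (⟨0, hn⟩ : Fin n) ≤ j)).trans
      (h1.trans (starCoeff_mem_Icc hb0 hb1 _).2)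
  have hstate : IsState (channel b (productState (pairInvolution f g) l)) := by
    rw [heq]
    exact isState_productState hZ fun j => ⟨by linarith [hμ0 j], hμ1 j⟩
  have hmaj : SpectrumMajorized (List.ofFn μ) (List.ofFn (starCoeff b)) := by
    refine SpectrumMajorized.of_prod_take_le (by simp) ?_ ?_ ?_ (by simpa using hlog)
    · intro x hx
      obtain ⟨j, rfl⟩ := (List.mem_ofFn' _ _).mp hx
      exact ⟨hμ0 j, hμ1 j⟩
    · intro x hx
      obtain ⟨j, rfl⟩ := (List.mem_ofFn' _ _).mp hx
      exact starCoeff_mem_Icc hb0 hb1 j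
    · rw [List.pairwise_ofFn]
      exact fun i j hij => hanti hij.le
  have hconv : ∀ φ : ℝ → ℝ, ConvexOn ℝ (Set.Ici 0) φ →
      ∑ j, φ (hstate.spec j) ≤ ∑ j, φ (hstar.spec j) := by
    intro φ hφ
    rw [hstate.sum_spec_of_eq_productState hZ heq,
      hstar.sum_spec_of_eq_productState hZstar (channel_rhoStar hn b)]
    exact hmaj φ hφ
  exact ⟨hstate, hstate.majorized_of_convex hstar hconv,
    hstate.renyiEntropy_le_of_convex hstar hconv⟩
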